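/- Let $E\to M$ and $V\to M$ be smooth real vector bundles of finite rank over a smooth (finite-dimensional, Hausdorff, second countable) manifold. For a vector bundle $B\to M$ let $h_t\colon B\to B$ ($t\in\mathbb R$) be fibre-wise multiplication by $t$, let $V_B\to B$ be the pull-back of $V$ along $B\to M$, let $h_t^*$ denote the induced pull-back on $C^\infty(B)$ and on $\Gamma(V_B)$, and let $\ell_\varphi\in C^\infty(E)$ be the fibre-wise linear function of $\varphi\in\Gamma(E^*)$. *Derivations.* A derivation of $V_B$ is a pair of a vector field $X$ on $B$ (its symbol) and an $\mathbb R$-linear $\Delta\colon\Gamma(V_B)\to\Gamma(V_B)$ with $\Delta(fv)=f\Delta(v)+X(f)v$. It is polynomial of degree $k\in\mathbb Z$ if $h_t^*\circ X=t^kX\circ h_t^*$ and $h_t^*\circ \Delta=t^k\Delta\circ h_t^*$ for all $t\neq0$. Let $\mathfrak D_{\mathrm{poly}}(V_B)$ be the sum over $k$ of the spaces of polynomial derivations of degree $k$, with the commutator bracket. Let $C^\infty_{\mathrm{poly}}(B)$ be the sum over $k\ge 0$ of the spaces $C^\infty(B)_k=\{f: h_t^*f=t^kf\ \text{for all } t\in\mathbb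 R\}$; it is acted upon by $\mathfrak D_{\mathrm{poly}}(V_B)$ through the symbol. *Symmetric multivectors.* A symmetric $V_E$-multivector of degree $k\ge1$ is a pair $D$ consisting of a symmetric $k$-multiderivation $L_D$ of $C^\infty(E)$ and an $\mathbb R$-multilinear map $D(f_1,\dots,f_{k-1}|v)\in\Gamma(V_E)$, symmetric and a derivation in each $f_i\in C^\infty(E)$, with $D(f_1,\dots,f_{k-1}|fv)=fD(f_1,\dots,f_{k-1}|v)+L_D(f_1,\dots,f_{k-1},f)v$. One of degree $0$ is a function on $E$. $\mathfrak D^\bullet_{\mathrm{sym}}(V_E)$ is the direct sum over all degrees. It carries the commutative product given by $$L_{D_1D_2}(f_1,\dots)=\sum_\sigma L_{D_1}(f_{\sigma(1)},\dots)L_{D_2}(\dots,f_{\sigma(k_1+k_2)}),$$ $$(D_1D_2)(f_1,\dots|v)=\sum_\sigma L_{D_1}(f_{\sigma(1)},\dots)D_2(\dots|v)+\sum_\sigma L_{D_2}(f_{\sigma(1)},\dots)D_1(\dots|v)$$ (sums over unshuffles) and the Lie bracket $\{D_1,D_2\}=D_1\bullet D_2-D_2\bullet D_1$, where $L_{D_1\bullet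 D_2}(f_1,\dots)=\sum_\sigma L_{D_1}(L_{D_2}(f_{\sigma(1)},\dots),\dots)$ and $$(D_1\bullet D_2)(f_1,\dots|v)=\sum_\sigma D_1(f_{\sigma(1)},\dots|D_2(\dots|v))+\sum_\sigma D_1(f_{\sigma(1)},\dots,L_{D_2}(\dots)|v).$$ A symmetric multivector is fibre-wise linear (resp. core) if each component $D$ of degree $k$ satisfies $h_t^*D=t^{1-k}D$ (resp. $h_t^*D=t^{-k}D$) for all $t\ne0$, where $h_t^*D$ is defined by naturality. Write $\mathfrak D^\bullet_{\mathrm{sym,lin}}(V_E)$ and $\mathfrak D^\bullet_{\mathrm{sym,core}}(V_E)$ for these spaces. **Theorem.** $\mathfrak D^\bullet_{\mathrm{sym,core}}(V_E)$ is a commutative algebra and $\mathfrak D^\bullet_{\mathrm{sym,lin}}(V_E)$, with the product by core multivectors, the bracket and the anchor $D\mapsto\{D,-\}$, is a Lie–Rinehart algebra over it; $\mathfrak D_{\mathrm{poly}}(V_{E^*})$ is a Lie–Rinehart algebra over $C^\infty_{\mathrm{poly}}(E^*)$. There is an isomorphism of algebras $$j\colon\mathfrak D^\bullet_{\mathrm{sym,core}}(V_E)\to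 C^\infty_{\mathrm{poly}}(E^*),\qquad j(C)(\varphi_x)=\tfrac1{k!}L_C(\ell_\varphi,\dots,\ell_\varphi)(0_x)\quad(C\text{ of degree }k),$$ for $\varphi\in\Gamma(E^*)$, $x\in M$, under which multivectors of degree $k$ correspond to homogeneous functions of degree $k$. For each $D\in\mathfrak D^\bullet_{\mathrm{sym,lin}}(V_E)$ there is a unique derivation $D^*$ of $V_{E^*}$ whose symbol sends $j(C)$ to $j(\{D,C\})$ for every core $C$, and which satisfies, for all $v\in\Gamma(V)$ with pull-backs $v_E\in\Gamma(V_E)$ and $v_{E^*}\in\Gamma(V_{E^*})$, $$D^*(v_{E^*})(\varphi_x)=\tfrac1{(k-1)!}\,D(\ell_\varphi,\dots,\ell_\varphi|v_E)(0_x)\quad\text{for } D \text{ of degree } k\ge1$$ (for $k=0$ the right hand side is $0$; for inhomogeneous $D$ the sum over the components of $D$ is taken). The derivation $D^*$ is polynomial, and $D\mapsto D^*$ is an isomorphism of Lie–Rinehart algebras $\mathfrak D^\bullet_{\mathrm{sym,lin}}(V_E)\to\mathfrak D_{\mathrm{poly}}(V_{E^*})$ over $j$: it is bijective, preserves Lie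 brackets, and satisfies $(CD)^*=j(C)D^*$ and compatibility with the anchors. It is degree inverting: $D$ is of degree $k$ (so that $h_t^*D=t^{1-k}D$) if and only if $D^*$ is a polynomial derivation of degree $k-1$. -/

import Mathlib

open Bundle Manifold ContDiff

set_option linter.unusedSectionVars false

namespace FWL
noncomputable section

section AntidiagonalSums

/-- `unshuffleSum G S = ∑ G S₁ S₂` over all ways of splitting the multiset `S` of arguments into
two complementary parts. Restricted to `card S₁ = p`, `card S₂ = q` this is the sum over
`(p, q)`-unshuffles of a `(p + q)`-tuple listing `S`. -/
def unshuffleSum {A N : Type*} [AddCommMonoid N] (G : Multiset A → Multiset A → N)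
    (S : Multiset A) : N :=
  (S.antidiagonal.map fun p => G p.1 p.2).sum

variable {A N N' : Type*} [AddCommGroup N] [AddCommGroup N']

theorem unshuffleSum_zero (G : Multiset A → Multiset A → N) : unshuffleSum G 0 = G 0 0 := by
  simp [unshuffleSum]

theorem unshuffleSum_cons (G : Multiset A → Multiset A → N) (a : A) (S : Multiset A) :
    unshuffleSum G (a ::ₘ S) = unshuffleSum (fun x y => G (a ::ₘ x) y + G x (a ::ₘ y)) S := by
  simp [unshuffleSum, Multiset.antidiagonal_cons, Multiset.map_map, Multiset.sum_map_add, add_comm]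

theorem unshuffleSum_add (G G' : Multiset A → Multiset A → N) (S : Multiset A) :
    unshuffleSum (fun x y => G x y + G' x y) S = unshuffleSum G S + unshuffleSum G' S := by
  simp [unshuffleSum, Multiset.sum_map_add]

theorem unshuffleSum_map {f : N → N'} (hf : ∀ a b, f (a + b) = f a + f b)
    (G : Multiset A → Multiset A → N) (S : Multiset A) :
    f (unshuffleSum G S) = unshuffleSum (fun x y => f (G x y)) S := by
  have := (AddMonoidHom.mk' f hf).map_multiset_sum (S.antidiagonal.map fun p => G p.1 p.2)
  simpa [unshuffleSum, Multiset.map_map] using this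

theorem unshuffleSum_smul {R : Type*} [Monoid R] [DistribMulAction R N] (r : R)
    (G : Multiset A → Multiset A → N) (S : Multiset A) :
    r • unshuffleSum G S = unshuffleSum (fun x y => r • G x y) S :=
  unshuffleSum_map (f := fun n : N => r • n) (smul_add r) G S

theorem unshuffleSum_swap (G : Multiset A → Multiset A → N) (S : Multiset A) :
    unshuffleSum (fun x y => G y x) S = unshuffleSum G S := by
  conv_rhs => rw [unshuffleSum, ← Multiset.map_swap_antidiagonal, Multiset.map_map]
  rfl

theorem unshuffleSum_congr {G G' : Multiset A → Multiset A → N} {S : Multiset A}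
    (h : ∀ x y, x + y = S → G x y = G' x y) : unshuffleSum G S = unshuffleSum G' S := by
  unfold unshuffleSum
  congr 1
  exact Multiset.map_congr rfl fun p hp => h _ _ (Multiset.mem_antidiagonal.1 hp)

theorem unshuffleSum_eq_zero {G : Multiset A → Multiset A → N} {S : Multiset A}
    (h : ∀ x y, x + y = S → G x y = 0) : unshuffleSum G S = 0 := by
  rw [unshuffleSum_congr h]
  simp [unshuffleSum]

theorem unshuffleSum_image (f : A → A) (G : Multiset A → Multiset A → N) (S : Multiset A) :
    unshuffleSum G (S.map f) = unshuffleSum (fun x y => G (x.map f) (y.map f)) S := by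
  induction S using Multiset.induction_on generalizing G with
  | empty => simp [unshuffleSum_zero]
  | cons a S ih => rw [Multiset.map_cons, unshuffleSum_cons, unshuffleSum_cons, ih]; simp

end AntidiagonalSums

section Algebra

variable (A Γ : Type*) [CommRing A] [Algebra ℝ A] [AddCommGroup Γ] [Module ℝ Γ] [Module A Γ]
  [IsScalarTower ℝ A Γ]

/-! ### Derivations of a vector bundle -/

/-- Derivations of a module `Γ` (e.g. the sections of a vector bundle) over an algebra `A` (e.g. the
smooth functions on the base): pairs `(X, D)` of a derivation `X` of `A` (the symbol) and an
`ℝ`-linear operator `D` on `Γ` with `D (a v) = a D v + X(a) v`. -/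
def ModDer : Submodule A (Derivation ℝ A A × Module.End ℝ Γ) where
  carrier := {D | ∀ (a : A) (v : Γ), D.2 (a • v) = a • D.2 v + D.1 a • v}
  add_mem' {D D'} h h' a v := by
    simp only [Prod.snd_add, Prod.fst_add, LinearMap.add_apply, Derivation.add_apply, h a v, h' a v]
    module
  zero_mem' a v := by simp
  smul_mem' c D h a v := by
    simp only [Prod.smul_snd, Prod.smul_fst, LinearMap.smul_apply, Derivation.smul_apply, h a v,
      smul_eq_mul]
    module

variable {A Γ}

namespace ModDer

/-- The symbol of a derivation. -/
def symbol (D : ModDer A Γ) : Derivation ℝ A A := D.1.1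

/-- The underlying operator of a derivation. -/
def op (D : ModDer A Γ) : Module.End ℝ Γ := D.1.2

theorem op_smul (D : ModDer A Γ) (a : A) (v : Γ) :
    (op D) (a • v) = a • (op D) v + (symbol D) a • v := D.2 a v

@[ext] theorem ext {D D' : ModDer A Γ} (h : ∀ a, (symbol D) a = (symbol D') a)
    (h' : ∀ v, (op D) v = (op D') v) : D = D' :=
  Subtype.ext (Prod.ext (Derivation.ext h) (LinearMap.ext h'))

@[simp] theorem symbol_add (D D' : ModDer A Γ) : (symbol (D + D')) = (symbol D) + (symbol D') := rfl
@[simp] theorem symbol_zero : (symbol (0 : ModDer A Γ)) = 0 := rfl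
@[simp] theorem op_add (D D' : ModDer A Γ) : (op (D + D')) = (op D) + (op D') := rfl
@[simp] theorem op_zero : (op (0 : ModDer A Γ)) = 0 := rfl
@[simp] theorem symbol_smul (c : A) (D : ModDer A Γ) : (symbol (c • D)) = c • (symbol D) := rfl
@[simp] theorem smul_op (c : A) (D : ModDer A Γ) : (op (c • D)) = c • (op D) := rfl
@[simp] theorem symbol_rsmul (c : ℝ) (D : ModDer A Γ) (a : A) :
    (symbol (c • D)) a = c • (symbol D) a := rfl
@[simp] theorem rsmul_op (c : ℝ) (D : ModDer A Γ) (v : Γ) : (op (c • D)) v = c • (op D) v := rfl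

/-- The Lie bracket of derivations is the commutator, on symbols and on operators. -/
instance instBracket : Bracket (ModDer A Γ) (ModDer A Γ) where
  bracket D D' := ⟨(⁅(symbol D), (symbol D')⁆, (op D) ∘ₗ (op D') - (op D') ∘ₗ (op D)), fun a v => by
    simp only [LinearMap.sub_apply, LinearMap.comp_apply, op_smul, map_add,
      Derivation.commutator_apply]
    module⟩

@[simp] theorem symbol_lie (D D' : ModDer A Γ) (a : A) :
    (symbol ⁅D, D'⁆) a = (symbol D) ((symbol D') a) - (symbol D') ((symbol D) a) :=
  Derivation.commutator_apply ..
@[simp] theorem op_lie (D D' : ModDer A Γ) (v : Γ) :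
    (op ⁅D, D'⁆) v = (op D) ((op D') v) - (op D') ((op D) v) := rfl

instance instLieRing : LieRing (ModDer A Γ) where
  add_lie D D' D'' := by ext <;> simp <;> abel
  lie_add D D' D'' := by ext <;> simp <;> abel
  lie_self D := by ext <;> simp
  leibniz_lie D D' D'' := by ext <;> simp <;> abel

instance instLieAlgebra : LieAlgebra ℝ (ModDer A Γ) where
  lie_smul c D D' := by ext <;> simp [smul_sub]

end ModDer

/-! ### Symmetric multivectors -/

section MultiDer

variable {N : Type*} [AddCommGroup N] [Module ℝ N] [Module A N]

/-- Symmetric multiderivations of `A` with values in an `A`-module `N`, all numbers of arguments at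
once: the value on arguments `f₁, …, f_k` is the value of `P` on the multiset `{f₁, …, f_k}`, so
that symmetry is built in; `P` is a derivation in each argument and vanishes when the number of
arguments is large. -/
structure IsMultiDer (P : Multiset A → N) : Prop where
  add : ∀ S a b, P ((a + b) ::ₘ S) = P (a ::ₘ S) + P (b ::ₘ S)
  smul : ∀ S (c : ℝ) a, P ((c • a) ::ₘ S) = c • P (a ::ₘ S)
  mul : ∀ S a b, P ((a * b) ::ₘ S) = a • P (b ::ₘ S) + b • P (a ::ₘ S)
  bounded : ∃ n : ℕ, ∀ S, n ≤ S.card → P S = 0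

end MultiDer

variable (A Γ)

/-- Pairs of a scalar valued and an operator valued function of a multiset of elements of `A`. -/
abbrev RawMult : Type _ := (Multiset A → A) × (Multiset A → Module.End ℝ Γ)

/-- Symmetric multivectors of the module `Γ`, i.e. finite sums of symmetric `k`-multivectors,
`k = 0, 1, 2, …`. Such a `D` is a pair `(L, P)` consisting of its symbol `L`, a symmetric
multiderivation of `A` with values in `A`, and a symmetric multiderivation `P` of `A` with values in
operators on `Γ`, such that `P(f₁, …, f_r | -)` is a derivation of `Γ` whose symbol is
`L(f₁, …, f_r, -)`. The component of degree `k` consists of `L` on `k` arguments and `P` on `k - 1`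
scalar arguments (for `k = 0` it is just an element of `A`). -/
def SymMult : Submodule ℝ (RawMult A Γ) where
  carrier := {D | IsMultiDer D.1 ∧ IsMultiDer D.2 ∧
    ∀ S (a : A) (v : Γ), D.2 S (a • v) = a • D.2 S v + D.1 (a ::ₘ S) • v}
  add_mem' {D D'} h h' := by
    obtain ⟨⟨a1, a2, a3, m, a4⟩, ⟨b1, b2, b3, n, b4⟩, c⟩ := h
    obtain ⟨⟨a1', a2', a3', m', a4'⟩, ⟨b1', b2', b3', n', b4'⟩, c'⟩ := h'
    refine ⟨⟨?_, ?_, ?_, m + m', ?_⟩, ⟨?_, ?_, ?_, n + n', ?_⟩, ?_⟩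
    · intro S a b; simp only [Prod.fst_add, Pi.add_apply, a1, a1']; abel
    · intro S a b; simp only [Prod.fst_add, Pi.add_apply, a2, a2']; module
    · intro S a b; simp only [Prod.fst_add, Pi.add_apply, a3, a3']; module
    · intro S hS; simp only [Prod.fst_add, Pi.add_apply, a4 S (by omega), a4' S (by omega), add_zero]
    · intro S a b; simp only [Prod.snd_add, Pi.add_apply, b1, b1']; abel
    · intro S a b; simp only [Prod.snd_add, Pi.add_apply, b2, b2']; module
    · intro S a b; simp only [Prod.snd_add, Pi.add_apply, b3, b3']; module
    · intro S hS; simp only [Prod.snd_add, Pi.add_apply, b4 S (by omega), b4' S (by omega), add_zero]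
    · intro S a v
      simp only [Prod.snd_add, Prod.fst_add, Pi.add_apply, LinearMap.add_apply, c, c']; module
  zero_mem' := ⟨⟨by simp, by simp, by simp, 0, by simp⟩, ⟨by simp, by simp, by simp, 0, by simp⟩,
    by simp⟩
  smul_mem' r D h := by
    obtain ⟨⟨a1, a2, a3, m, a4⟩, ⟨b1, b2, b3, n, b4⟩, c⟩ := h
    refine ⟨⟨?_, ?_, ?_, m, ?_⟩, ⟨?_, ?_, ?_, n, ?_⟩, ?_⟩
    · intro S a b; simp only [Prod.smul_fst, Pi.smul_apply, a1]; module
    · intro S a b; simp only [Prod.smul_fst, Pi.smul_apply, a2]; module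
    · intro S a b
      simp only [Prod.smul_fst, Pi.smul_apply, a3, smul_add, smul_comm r]
    · intro S hS; simp only [Prod.smul_fst, Pi.smul_apply, a4 S hS, smul_zero]
    · intro S a b; simp only [Prod.smul_snd, Pi.smul_apply, b1]; module
    · intro S a b; simp only [Prod.smul_snd, Pi.smul_apply, b2]; module
    · intro S a b
      simp only [Prod.smul_snd, Pi.smul_apply, b3, smul_add, smul_comm r]
    · intro S hS; simp only [Prod.smul_snd, Pi.smul_apply, b4 S hS, smul_zero]
    · intro S a v
      simp only [Prod.smul_snd, Prod.smul_fst, Pi.smul_apply, LinearMap.smul_apply, c, smul_add,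
        smul_comm r, smul_assoc]

variable {A Γ}

namespace RawMult

/-- The associative product:
`(D₁ D₂)(f₁, …) = ∑ D₁(f_σ(1), …) D₂(…)` on symbols and
`(D₁ D₂)(f₁, … | v) = ∑ L₁(f_σ(1), …) D₂(… | v) + ∑ L₂(f_σ(1), …) D₁(… | v)` on operators, sums
over unshuffles. -/
def mul (D₁ D₂ : RawMult A Γ) : RawMult A Γ :=
  (unshuffleSum fun x y => D₁.1 x * D₂.1 y,
    unshuffleSum fun x y => D₁.1 x • D₂.2 y + D₂.1 x • D₁.2 y)

/-- The composition `D₁ • D₂`: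
`∑ L₁(L₂(f_σ(1), …), …)` on symbols, and
`∑ D₁(f_σ(1), … | D₂(… | v)) + ∑ D₁(f_σ(1), …, L₂(…) | v)` on operators, sums over unshuffles. -/
def pre (D₁ D₂ : RawMult A Γ) : RawMult A Γ :=
  (unshuffleSum fun x y => D₁.1 (D₂.1 x ::ₘ y),
    unshuffleSum fun x y => D₁.2 x ∘ₗ D₂.2 y + D₁.2 (D₂.1 y ::ₘ x))

/-- Insertion of a first argument. -/
def ins (a : A) (D : RawMult A Γ) : RawMult A Γ :=
  (fun S => D.1 (a ::ₘ S), fun S => D.2 (a ::ₘ S))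

theorem ins_mul (a : A) (D D' : RawMult A Γ) :
    ins a (mul D D') = mul (ins a D) D' + mul D (ins a D') := by
  refine Prod.ext (funext fun S => ?_) (funext fun S => ?_)
  · simp only [ins, mul, unshuffleSum_cons, unshuffleSum_add, Prod.fst_add, Pi.add_apply]
  · simp only [ins, mul, unshuffleSum_cons, unshuffleSum_add, Prod.snd_add, Pi.add_apply]
    abel

theorem ins_pre (a : A) (D D' : RawMult A Γ) :
    ins a (pre D D') = pre (ins a D) D' + pre D (ins a D') := by
  refine Prod.ext (funext fun S => ?_) (funext fun S => ?_)
  · simp only [ins, pre, unshuffleSum_cons, unshuffleSum_add, Prod.fst_add, Pi.add_apply,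
      Multiset.cons_swap a, add_comm]
  · simp only [ins, pre, unshuffleSum_cons, unshuffleSum_add, Prod.snd_add, Pi.add_apply,
      Multiset.cons_swap a]

theorem add_mul (D D' E : RawMult A Γ) : mul (D + D') E = mul D E + mul D' E := by
  refine Prod.ext (funext fun S => ?_) (funext fun S => ?_)
  · simp only [mul, Prod.fst_add, Pi.add_apply, _root_.add_mul, unshuffleSum_add]
  · simp only [mul, Prod.fst_add, Prod.snd_add, Pi.add_apply, add_smul, smul_add, unshuffleSum_add]
    abel

theorem mul_comm (D D' : RawMult A Γ) : mul D D' = mul D' D := by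
  refine Prod.ext (funext fun S => ?_) (funext fun S => ?_)
  · simp only [mul]
    rw [← unshuffleSum_swap]
    simp only [_root_.mul_comm]
  · simp only [mul, add_comm]

theorem mul_add (D D' E : RawMult A Γ) : mul E (D + D') = mul E D + mul E D' := by
  rw [mul_comm, add_mul, mul_comm D, mul_comm D']

theorem ins_add (a : A) (D D' : RawMult A Γ) : ins a (D + D') = ins a D + ins a D' := rfl

/-- Two operations agree if they agree without arguments and after inserting any argument. -/
theorem eq_of_ins {ι : Type*} (X Y : ι → RawMult A Γ) (h0 : ∀ i, (X i).1 0 = (Y i).1 0)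
    (h0' : ∀ i, (X i).2 0 = (Y i).2 0)
    (h : ∀ a i, ∃ l : List ι, ins a (X i) = (l.map X).sum ∧ ins a (Y i) = (l.map Y).sum) :
    X = Y := by
  have key : ∀ S i, (X i).1 S = (Y i).1 S ∧ (X i).2 S = (Y i).2 S := by
    intro S
    induction S using Multiset.induction_on with
    | empty => exact fun i => ⟨h0 i, h0' i⟩
    | cons a S ih =>
      intro i
      obtain ⟨l, hx, hy⟩ := h a i
      have aux : ∀ l : List ι, (l.map X).sum.1 S = (l.map Y).sum.1 S ∧
          (l.map X).sum.2 S = (l.map Y).sum.2 S := by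
        intro l
        induction l with
        | nil => simp
        | cons j l ihl =>
          simp only [List.map_cons, List.sum_cons, Prod.fst_add, Prod.snd_add, Pi.add_apply,
            ihl.1, ihl.2, (ih j).1, (ih j).2, and_self]
      have := aux l
      rw [← hx, ← hy] at this
      exact this
  exact funext fun i => Prod.ext (funext fun S => (key S i).1) (funext fun S => (key S i).2)

theorem mul_assoc (D D' E : RawMult A Γ) : mul (mul D D') E = mul D (mul D' E) := by
  refine congrFun (eq_of_ins (ι := RawMult A Γ × RawMult A Γ × RawMult A Γ)
    (fun i => mul (mul i.1 i.2.1) i.2.2) (fun i => mul i.1 (mul i.2.1 i.2.2)) ?_ ?_ ?_) (D, D', E)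
  · intro i; simp only [mul, unshuffleSum_zero, _root_.mul_assoc]
  · intro i; simp only [mul, unshuffleSum_zero]; module
  · intro a i
    refine ⟨[(ins a i.1, i.2.1, i.2.2), (i.1, ins a i.2.1, i.2.2), (i.1, i.2.1, ins a i.2.2)], ?_, ?_⟩
    · simp only [ins_mul, add_mul, List.map_cons, List.map_nil, List.sum_cons, List.sum_nil]; abel
    · simp only [ins_mul, mul_add, List.map_cons, List.map_nil, List.sum_cons, List.sum_nil]; abel

theorem add_pre (D D' E : RawMult A Γ) : pre (D + D') E = pre D E + pre D' E := by
  refine Prod.ext (funext fun S => ?_) (funext fun S => ?_)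
  · simp only [pre, Prod.fst_add, Pi.add_apply, unshuffleSum_add]
  · simp only [pre, Prod.snd_add, Pi.add_apply, LinearMap.add_comp, unshuffleSum_add]
    abel

/-- Additivity in the first argument. -/
def Additive (D : RawMult A Γ) : Prop :=
  ∀ S a b, D.1 ((a + b) ::ₘ S) = D.1 (a ::ₘ S) + D.1 (b ::ₘ S) ∧
    D.2 ((a + b) ::ₘ S) = D.2 (a ::ₘ S) + D.2 (b ::ₘ S)

theorem Additive.ins {D : RawMult A Γ} (h : Additive D) (c : A) : Additive (ins c D) := by
  intro S a b
  simp only [RawMult.ins, Multiset.cons_swap c]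
  exact h _ a b

theorem Additive.zero {D : RawMult A Γ} (h : Additive D) (S : Multiset A) :
    D.1 (0 ::ₘ S) = 0 ∧ D.2 (0 ::ₘ S) = 0 := by
  simpa using h S 0 0

theorem pre_add {E : RawMult A Γ} (h : Additive E) (D D' : RawMult A Γ) :
    pre E (D + D') = pre E D + pre E D' := by
  refine Prod.ext (funext fun S => ?_) (funext fun S => ?_)
  · simp only [pre, Prod.fst_add, Pi.add_apply, (h _ _ _).1, unshuffleSum_add]
  · simp only [pre, Prod.fst_add, Prod.snd_add, Pi.add_apply, (h _ _ _).2, LinearMap.comp_add,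
      unshuffleSum_add]
    abel

theorem ins_sub (a : A) (D D' : RawMult A Γ) : ins a (D - D') = ins a D - ins a D' := rfl

theorem pre_assoc_symm {D : RawMult A Γ} (hD : Additive D) (D' D'' : RawMult A Γ) :
    pre (pre D D') D'' - pre D (pre D' D'') = pre (pre D D'') D' - pre D (pre D'' D') := by
  refine congrFun (eq_of_ins (ι := {D : RawMult A Γ // Additive D} × RawMult A Γ × RawMult A Γ)
    (fun i => pre (pre i.1.1 i.2.1) i.2.2 - pre i.1.1 (pre i.2.1 i.2.2))
    (fun i => pre (pre i.1.1 i.2.2) i.2.1 - pre i.1.1 (pre i.2.2 i.2.1)) ?_ ?_ ?_)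
    (⟨D, hD⟩, D', D'')
  · intro i
    simp only [pre, unshuffleSum_zero, unshuffleSum_cons, Prod.fst_sub, Pi.sub_apply]
    rw [Multiset.cons_swap]
    abel
  · rintro ⟨⟨D, hD⟩, D', D''⟩
    ext v
    simp only [pre, unshuffleSum_zero, unshuffleSum_cons, Prod.snd_sub, Pi.sub_apply,
      LinearMap.sub_apply, LinearMap.add_apply, LinearMap.comp_apply, map_add]
    rw [Multiset.cons_swap]
    abel
  · rintro a ⟨⟨D, hD⟩, D', D''⟩
    refine ⟨[(⟨ins a D, hD.ins a⟩, D', D''), (⟨D, hD⟩, ins a D', D''), (⟨D, hD⟩, D', ins a D'')],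
      ?_, ?_⟩
    · simp only [ins_sub, ins_pre, add_pre, pre_add hD, List.map_cons, List.map_nil,
        List.sum_cons, List.sum_nil]
      abel
    · simp only [ins_sub, ins_pre, add_pre, pre_add hD, List.map_cons, List.map_nil,
        List.sum_cons, List.sum_nil]
      abel

/-- The bracket `{D₁, D₂} = D₁ • D₂ - D₂ • D₁`. -/
def bracket (D₁ D₂ : RawMult A Γ) : RawMult A Γ := pre D₁ D₂ - pre D₂ D₁

end RawMult

namespace SymMult

open RawMult

theorem additive (D : SymMult A Γ) : Additive D.1 :=
  fun S a b => ⟨D.2.1.add S a b, D.2.2.1.add S a b⟩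

theorem op_smul (D : SymMult A Γ) (S : Multiset A) (a : A) (v : Γ) :
    D.1.2 S (a • v) = a • D.1.2 S v + D.1.1 (a ::ₘ S) • v := D.2.2.2 S a v

theorem unshuffleSum_apply (G : Multiset A → Multiset A → Module.End ℝ Γ) (S : Multiset A) (v : Γ) :
    unshuffleSum G S v = unshuffleSum (fun x y => G x y v) S :=
  unshuffleSum_map (f := fun T : Module.End ℝ Γ => T v) (fun _ _ => rfl) G S

theorem mul_mem (D D' : SymMult A Γ) : RawMult.mul D.1 D'.1 ∈ SymMult A Γ := by
  obtain ⟨a1, a2, a3, m, a4⟩ := D.2.1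
  obtain ⟨b1, b2, b3, n, b4⟩ := D.2.2.1
  have c := D.2.2.2
  obtain ⟨a1', a2', a3', m', a4'⟩ := D'.2.1
  obtain ⟨b1', b2', b3', n', b4'⟩ := D'.2.2.1
  have c' := D'.2.2.2
  refine ⟨⟨?_, ?_, ?_, m + m', ?_⟩, ⟨?_, ?_, ?_, m + m' + n + n', ?_⟩, ?_⟩
  · intro S a b
    simp only [RawMult.mul, unshuffleSum_cons, ← unshuffleSum_add]
    exact unshuffleSum_congr fun x y _ => by rw [a1, a1']; ring
  · intro S r a
    simp only [RawMult.mul, unshuffleSum_cons, unshuffleSum_smul r]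
    exact unshuffleSum_congr fun x y _ => by rw [a2, a2']; simp
  · intro S a b
    simp only [RawMult.mul, unshuffleSum_cons, unshuffleSum_smul a,
      unshuffleSum_smul b, ← unshuffleSum_add]
    exact unshuffleSum_congr fun x y _ => by rw [a3, a3']; simp only [smul_eq_mul]; ring
  · intro S hS
    simp only [RawMult.mul]
    refine unshuffleSum_eq_zero fun x y h => ?_
    have := congrArg Multiset.card h
    rw [Multiset.card_add] at this
    rcases le_or_gt m x.card with hx | hx
    · rw [a4 x hx, zero_mul]
    · rw [a4' y (by omega), mul_zero]
  · intro S a b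
    simp only [RawMult.mul, unshuffleSum_cons, ← unshuffleSum_add]
    exact unshuffleSum_congr fun x y _ => by rw [a1, a1', b1, b1']; module
  · intro S r a
    simp only [RawMult.mul, unshuffleSum_cons, unshuffleSum_smul r]
    exact unshuffleSum_congr fun x y _ => by
      rw [a2, a2', b2, b2']; simp only [smul_add, smul_assoc, smul_comm r]
  · intro S a b
    simp only [RawMult.mul, unshuffleSum_cons, unshuffleSum_smul a,
      unshuffleSum_smul b, ← unshuffleSum_add]
    exact unshuffleSum_congr fun x y _ => by rw [a3, a3', b3, b3']; module
  · intro S hS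
    simp only [RawMult.mul]
    refine unshuffleSum_eq_zero fun x y h => ?_
    have := congrArg Multiset.card h
    rw [Multiset.card_add] at this
    rcases le_or_gt (m + m') x.card with hx | hx
    · rw [a4 x (by omega), a4' x (by omega), zero_smul, zero_smul, add_zero]
    · rw [b4 y (by omega), b4' y (by omega), smul_zero, smul_zero, add_zero]
  · intro S a v
    have e : (unshuffleSum (fun x y => D.1.1 x * D'.1.1 y) (a ::ₘ S)) • v =
        unshuffleSum (fun x y => (D.1.1 x * D'.1.1 (a ::ₘ y)) • v + (D'.1.1 x * D.1.1 (a ::ₘ y)) • v) S := by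
      rw [unshuffleSum_cons, unshuffleSum_map (f := fun b : A => b • v)
        (fun _ _ => add_smul _ _ _), unshuffleSum_add, ← unshuffleSum_swap
          (fun x y => (D'.1.1 x * D.1.1 (a ::ₘ y)) • v), ← unshuffleSum_add]
      exact unshuffleSum_congr fun x y _ => by module
    simp only [RawMult.mul, unshuffleSum_apply, e]
    rw [unshuffleSum_smul a, ← unshuffleSum_add]
    refine unshuffleSum_congr fun x y _ => ?_
    simp only [LinearMap.add_apply, LinearMap.smul_apply, c, c']
    module

theorem pre_fn_mul (D D' : SymMult A Γ) (S : Multiset A) (a b : A) :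
    (pre D.1 D'.1).1 ((a * b) ::ₘ S) = a • (pre D.1 D'.1).1 (b ::ₘ S) +
      b • (pre D.1 D'.1).1 (a ::ₘ S) +
      unshuffleSum (fun x y => D'.1.1 (b ::ₘ x) * D.1.1 (a ::ₘ y) +
        D'.1.1 (a ::ₘ x) * D.1.1 (b ::ₘ y)) S := by
  simp only [pre, unshuffleSum_cons, unshuffleSum_smul a,
      unshuffleSum_smul b, ← unshuffleSum_add]
  refine unshuffleSum_congr fun x y _ => ?_
  simp only [D.2.1.add, D.2.1.mul, D'.2.1.mul, Multiset.cons_swap _ (a * b), smul_eq_mul,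
    Multiset.cons_swap (D'.1.1 x)]
  ring

theorem pre_op_mul (D D' : SymMult A Γ) (S : Multiset A) (a b : A) (v : Γ) :
    (pre D.1 D'.1).2 ((a * b) ::ₘ S) v = a • (pre D.1 D'.1).2 (b ::ₘ S) v +
      b • (pre D.1 D'.1).2 (a ::ₘ S) v +
      unshuffleSum (fun x y => (D.1.1 (a ::ₘ x) • D'.1.2 (b ::ₘ y) v +
        D.1.1 (b ::ₘ x) • D'.1.2 (a ::ₘ y) v) + (D'.1.1 (a ::ₘ y) • D.1.2 (b ::ₘ x) v +
        D'.1.1 (b ::ₘ y) • D.1.2 (a ::ₘ x) v)) S := by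
  simp only [pre, unshuffleSum_cons, unshuffleSum_apply, unshuffleSum_smul a,
      unshuffleSum_smul b, ← unshuffleSum_add]
  refine unshuffleSum_congr fun x y _ => ?_
  simp only [D.2.2.1.add, D.2.2.1.mul, D'.2.2.1.mul, D'.2.1.mul, Multiset.cons_swap _ (a * b),
    smul_eq_mul, Multiset.cons_swap (D'.1.1 y), LinearMap.add_apply, LinearMap.comp_apply,
    LinearMap.smul_apply, map_add, op_smul]
  module

theorem pre_op_smul (D D' : SymMult A Γ) (S : Multiset A) (a : A) (v : Γ) :
    (pre D.1 D'.1).2 S (a • v) = a • (pre D.1 D'.1).2 S v + (pre D.1 D'.1).1 (a ::ₘ S) • v +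
      unshuffleSum (fun x y => D.1.1 (a ::ₘ x) • D'.1.2 y v + D'.1.1 (a ::ₘ y) • D.1.2 x v) S := by
  have e : (pre D.1 D'.1).1 (a ::ₘ S) • v = unshuffleSum (fun x y =>
      D.1.1 (D'.1.1 (a ::ₘ y) ::ₘ x) • v + D.1.1 (D'.1.1 y ::ₘ a ::ₘ x) • v) S := by
    simp only [pre]
    rw [unshuffleSum_cons, unshuffleSum_map (f := fun b : A => b • v)
        (fun _ _ => add_smul _ _ _), ← unshuffleSum_swap]
    exact unshuffleSum_congr fun x y _ => by module
  rw [e]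
  simp only [pre, unshuffleSum_apply, unshuffleSum_smul a, ← unshuffleSum_add]
  refine unshuffleSum_congr fun x y _ => ?_
  simp only [LinearMap.add_apply, LinearMap.comp_apply, map_add, op_smul,
    Multiset.cons_swap (D'.1.1 y)]
  module

theorem pre_add_arg (D D' : SymMult A Γ) (S : Multiset A) (a b : A) :
    (pre D.1 D'.1).1 ((a + b) ::ₘ S) = (pre D.1 D'.1).1 (a ::ₘ S) +
      (pre D.1 D'.1).1 (b ::ₘ S) ∧
    (pre D.1 D'.1).2 ((a + b) ::ₘ S) = (pre D.1 D'.1).2 (a ::ₘ S) +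
      (pre D.1 D'.1).2 (b ::ₘ S) := by
  constructor
  · simp only [pre, unshuffleSum_cons, ← unshuffleSum_add]
    refine unshuffleSum_congr fun x y _ => ?_
    simp only [D.2.1.add, D'.2.1.add, Multiset.cons_swap (D'.1.1 x)]
    abel
  · simp only [pre, unshuffleSum_cons, ← unshuffleSum_add]
    refine unshuffleSum_congr fun x y _ => ?_
    simp only [D.2.2.1.add, D'.2.2.1.add, D'.2.1.add, Multiset.cons_swap (D'.1.1 y),
      LinearMap.add_comp, LinearMap.comp_add]
    abel

theorem pre_smul_arg (D D' : SymMult A Γ) (S : Multiset A) (r : ℝ) (a : A) :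
    (pre D.1 D'.1).1 ((r • a) ::ₘ S) = r • (pre D.1 D'.1).1 (a ::ₘ S) ∧
    (pre D.1 D'.1).2 ((r • a) ::ₘ S) = r • (pre D.1 D'.1).2 (a ::ₘ S) := by
  constructor
  · simp only [pre, unshuffleSum_cons, unshuffleSum_smul r]
    refine unshuffleSum_congr fun x y _ => ?_
    simp only [D.2.1.smul, D'.2.1.smul, Multiset.cons_swap (D'.1.1 x), smul_add]
  · simp only [pre, unshuffleSum_cons, unshuffleSum_smul r]
    refine unshuffleSum_congr fun x y _ => ?_
    simp only [D.2.2.1.smul, D'.2.2.1.smul, D'.2.1.smul, Multiset.cons_swap (D'.1.1 y),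
      LinearMap.smul_comp, LinearMap.comp_smul, smul_add]

theorem pre_bounded (D D' : SymMult A Γ) : ∃ n : ℕ, ∀ S : Multiset A, n ≤ S.card →
    (pre D.1 D'.1).1 S = 0 ∧ (pre D.1 D'.1).2 S = 0 := by
  have hz := (additive D).zero
  obtain ⟨m, a4⟩ := D.2.1.bounded
  obtain ⟨n, b4⟩ := D.2.2.1.bounded
  obtain ⟨m', a4'⟩ := D'.2.1.bounded
  obtain ⟨n', b4'⟩ := D'.2.2.1.bounded
  refine ⟨m + n + m' + n', fun S hS => ⟨?_, ?_⟩⟩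
  · simp only [pre]
    refine unshuffleSum_eq_zero fun x y h => ?_
    have := congrArg Multiset.card h
    rw [Multiset.card_add] at this
    rcases le_or_gt m' x.card with hx | hx
    · rw [a4' x hx, (hz y).1]
    · rw [a4 _ (by rw [Multiset.card_cons]; omega)]
  · simp only [pre]
    refine unshuffleSum_eq_zero fun x y h => ?_
    have := congrArg Multiset.card h
    rw [Multiset.card_add] at this
    rcases le_or_gt (m' + n') y.card with hx | hx
    · rw [a4' y (by omega), (hz x).2, b4' y (by omega), LinearMap.comp_zero, add_zero]
    · rw [b4 x (by omega), b4 (_ ::ₘ x) (by rw [Multiset.card_cons]; omega), LinearMap.zero_comp,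
        add_zero]

theorem bracket_mem (D D' : SymMult A Γ) : RawMult.bracket D.1 D'.1 ∈ SymMult A Γ := by
  obtain ⟨m, hm⟩ := pre_bounded D D'
  obtain ⟨n, hn⟩ := pre_bounded D' D
  refine ⟨⟨?_, ?_, ?_, m + n, ?_⟩, ⟨?_, ?_, ?_, m + n, ?_⟩, ?_⟩
  · intro S a b
    simp only [bracket, Prod.fst_sub, Pi.sub_apply, (pre_add_arg _ _ _ _ _).1]; abel
  · intro S r a
    simp only [bracket, Prod.fst_sub, Pi.sub_apply, (pre_smul_arg _ _ _ _ _).1, smul_sub]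
  · intro S a b
    simp only [bracket, Prod.fst_sub, Pi.sub_apply, pre_fn_mul]
    rw [← unshuffleSum_swap fun x y => D'.1.1 (b ::ₘ x) * _ + _]
    rw [unshuffleSum_congr (G' := fun x y => D.1.1 (b ::ₘ x) * D'.1.1 (a ::ₘ y) +
        D.1.1 (a ::ₘ x) * D'.1.1 (b ::ₘ y)) fun x y _ => by ring]
    module
  · intro S hS
    simp only [bracket, Prod.fst_sub, Pi.sub_apply, (hm S (by omega)).1, (hn S (by omega)).1,
      sub_zero]
  · intro S a b
    simp only [bracket, Prod.snd_sub, Pi.sub_apply, (pre_add_arg _ _ _ _ _).2]; abel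
  · intro S r a
    simp only [bracket, Prod.snd_sub, Pi.sub_apply, (pre_smul_arg _ _ _ _ _).2, smul_sub]
  · intro S a b
    ext v
    simp only [bracket, Prod.snd_sub, Pi.sub_apply, LinearMap.sub_apply, LinearMap.add_apply,
      LinearMap.smul_apply, pre_op_mul]
    rw [← unshuffleSum_swap fun x y => (D.1.1 (a ::ₘ x) • _ + _) + _]
    rw [unshuffleSum_congr (G' := fun x y => (D'.1.1 (a ::ₘ x) • D.1.2 (b ::ₘ y) v +
        D'.1.1 (b ::ₘ x) • D.1.2 (a ::ₘ y) v) + (D.1.1 (a ::ₘ y) • D'.1.2 (b ::ₘ x) v +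
        D.1.1 (b ::ₘ y) • D'.1.2 (a ::ₘ x) v)) fun x y _ => by abel]
    module
  · intro S hS
    simp only [bracket, Prod.snd_sub, Pi.sub_apply, (hm S (by omega)).2, (hn S (by omega)).2,
      sub_zero]
  · intro S a v
    simp only [bracket, Prod.snd_sub, Prod.fst_sub, Pi.sub_apply, LinearMap.sub_apply,
      pre_op_smul]
    rw [← unshuffleSum_swap fun x y => D.1.1 (a ::ₘ x) • _ + _]
    rw [unshuffleSum_congr (G' := fun x y => D'.1.1 (a ::ₘ x) • D.1.2 y v +
        D.1.1 (a ::ₘ y) • D'.1.2 x v) fun x y _ => by abel]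
    module

instance instBracket : Bracket (SymMult A Γ) (SymMult A Γ) where
  bracket D D' := ⟨RawMult.bracket D.1 D'.1, bracket_mem D D'⟩

theorem coe_lie (D D' : SymMult A Γ) : (⁅D, D'⁆).1 = pre D.1 D'.1 - pre D'.1 D.1 := rfl

instance instMul : Mul (SymMult A Γ) where
  mul D D' := ⟨RawMult.mul D.1 D'.1, mul_mem D D'⟩

theorem coe_mul (D D' : SymMult A Γ) : (D * D').1 = RawMult.mul D.1 D'.1 := rfl

theorem sub_pre' (D D' E : RawMult A Γ) : pre (D - D') E = pre D E - pre D' E := by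
  rw [eq_sub_iff_add_eq, ← add_pre, sub_add_cancel]

theorem pre_sub' {E : RawMult A Γ} (h : Additive E) (D D' : RawMult A Γ) :
    pre E (D - D') = pre E D - pre E D' := by
  rw [eq_sub_iff_add_eq, ← pre_add h, sub_add_cancel]

/-- Symmetric multivectors form a Lie algebra. -/
instance instLieRing : LieRing (SymMult A Γ) where
  add_lie D D' E := Subtype.ext (by
    simp only [coe_lie, Submodule.coe_add, add_pre, pre_add (additive E)]; abel)
  lie_add D D' E := Subtype.ext (by
    simp only [coe_lie, Submodule.coe_add, add_pre, pre_add (additive D)]; abel)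
  lie_self D := Subtype.ext (by simp [coe_lie])
  leibniz_lie D D' E := Subtype.ext (by
    have h1 := pre_assoc_symm (additive D) D'.1 E.1
    have h2 := pre_assoc_symm (additive D') D.1 E.1
    have h3 := pre_assoc_symm (additive E) D.1 D'.1
    simp only [coe_lie, Submodule.coe_add, sub_pre', pre_sub' (additive D), pre_sub' (additive D'),
      pre_sub' (additive E)]
    rw [sub_eq_sub_iff_add_eq_add] at h1 h2 h3
    grind)

instance instLieAlgebra : LieAlgebra ℝ (SymMult A Γ) where
  lie_smul r D E := Subtype.ext (by
    have h1 : RawMult.pre D.1 (r • E.1) = r • RawMult.pre D.1 E.1 := by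
      refine Prod.ext (funext fun S => ?_) (funext fun S => ?_)
      · simp only [pre, Prod.smul_fst, Pi.smul_apply, unshuffleSum_smul, D.2.1.smul]
      · simp only [pre, Prod.smul_fst, Prod.smul_snd, Pi.smul_apply, unshuffleSum_smul,
          D.2.2.1.smul, LinearMap.comp_smul, smul_add]
    have h2 : RawMult.pre (r • E.1) D.1 = r • RawMult.pre E.1 D.1 := by
      refine Prod.ext (funext fun S => ?_) (funext fun S => ?_)
      · simp only [pre, Prod.smul_fst, Pi.smul_apply, unshuffleSum_smul]
      · simp only [pre, Prod.smul_snd, Pi.smul_apply, unshuffleSum_smul,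
          LinearMap.smul_comp, smul_add]
    simp only [coe_lie, Submodule.coe_smul, h1, h2, smul_sub])

/-- The unit of the product, a symmetric multivector of degree `0`. -/
instance instOne : One (SymMult A Γ) where
  one := ⟨(fun S => if S.card = 0 then 1 else 0, 0), ⟨by simp, by simp, by simp, 1, fun S hS => by
    simp [show S.card ≠ 0 by omega]⟩, ⟨by simp, by simp, by simp, 0, by simp⟩, by simp⟩

theorem smul_raw_mul (r : ℝ) (D E : RawMult A Γ) : RawMult.mul (r • D) E = r • RawMult.mul D E := by
  refine Prod.ext (funext fun S => ?_) (funext fun S => ?_)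
  · simp only [RawMult.mul, Prod.smul_fst, Pi.smul_apply, unshuffleSum_smul, smul_mul_assoc]
  · simp only [RawMult.mul, Prod.smul_fst, Prod.smul_snd, Pi.smul_apply, unshuffleSum_smul,
      smul_add, smul_assoc, smul_comm r]

theorem zero_raw_mul (E : RawMult A Γ) : RawMult.mul 0 E = 0 := by
  simpa using smul_raw_mul (0 : ℝ) 0 E

theorem one_mul' (D : SymMult A Γ) : 1 * D = D := by
  refine Subtype.ext (congrFun (eq_of_ins (ι := RawMult A Γ)
    (fun D => RawMult.mul (1 : SymMult A Γ).1 D) (fun D => D) ?_ ?_ ?_) D.1)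
  · intro D
    change unshuffleSum (fun x y => (if x.card = 0 then 1 else 0) * D.1 y) 0 = _
    simp [unshuffleSum_zero]
  · intro D
    change unshuffleSum (fun x y => (if x.card = 0 then (1 : A) else 0) • D.2 y + D.1 x • 0) 0 = _
    simp [unshuffleSum_zero]
  · intro a D
    have h : ins a (1 : SymMult A Γ).1 = 0 := by
      refine Prod.ext (funext fun S => ?_) (funext fun S => rfl)
      change (if (a ::ₘ S).card = 0 then (1 : A) else 0) = 0
      simp
    exact ⟨[ins a D], by simp [ins_mul, h, zero_raw_mul], by simp⟩

theorem mul_comm' (D E : SymMult A Γ) : D * E = E * D := Subtype.ext (RawMult.mul_comm _ _)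
theorem mul_assoc' (D E F : SymMult A Γ) : D * E * F = D * (E * F) :=
  Subtype.ext (RawMult.mul_assoc _ _ _)
theorem mul_add' (D E F : SymMult A Γ) : D * (E + F) = D * E + D * F :=
  Subtype.ext (RawMult.mul_add _ _ _)
theorem add_mul' (D E F : SymMult A Γ) : (D + E) * F = D * F + E * F :=
  Subtype.ext (RawMult.add_mul _ _ _)
theorem smul_mul' (r : ℝ) (D E : SymMult A Γ) : (r • D) * E = r • (D * E) :=
  Subtype.ext (smul_raw_mul _ _ _)
theorem zero_mul' (D : SymMult A Γ) : 0 * D = 0 := Subtype.ext (zero_raw_mul _)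

/-- The symmetric multivectors of degree `k`: their symbol takes `k` arguments, their operator part
takes `k - 1` scalar arguments. -/
def degree (k : ℕ) : Submodule ℝ (SymMult A Γ) where
  carrier := {D | ∀ S : Multiset A, (S.card ≠ k → D.1.1 S = 0) ∧ (S.card + 1 ≠ k → D.1.2 S = 0)}
  add_mem' {D E} hD hE S := by
    refine ⟨fun h => ?_, fun h => ?_⟩
    · rw [Submodule.coe_add, Prod.fst_add, Pi.add_apply, (hD S).1 h, (hE S).1 h, add_zero]
    · rw [Submodule.coe_add, Prod.snd_add, Pi.add_apply, (hD S).2 h, (hE S).2 h, add_zero]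
  zero_mem' S := ⟨fun _ => rfl, fun _ => rfl⟩
  smul_mem' r D hD S := by
    refine ⟨fun h => ?_, fun h => ?_⟩
    · rw [Submodule.coe_smul, Prod.smul_fst, Pi.smul_apply, (hD S).1 h, smul_zero]
    · rw [Submodule.coe_smul, Prod.smul_snd, Pi.smul_apply, (hD S).2 h, smul_zero]

end SymMult

/-! ### Homogeneity -/

variable (A Γ) in
/-- The action of the multiplicative monoid `ℝ` on the smooth functions `A` on the total space of a
vector bundle and on the sections `Γ` of a pull-back bundle over it, by pull-back along the
fibre-wise multiplications. The last field records that a homogeneous function is homogeneous of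
nonnegative degree, also at `t = 0`. -/
structure Dilation where
  /-- the action on functions -/
  fn : ℝ → A →ₐ[ℝ] A
  /-- the action on sections -/
  sec : ℝ → Γ →ₗ[ℝ] Γ
  sec_smul : ∀ t a v, sec t (a • v) = fn t a • sec t v
  regular : ∀ (m : ℤ) (a : A), (∀ t : ℝ, t ≠ 0 → fn t a = t ^ m • a) →
    a = 0 ∨ ∃ k : ℕ, m = k ∧ ∀ t : ℝ, fn t a = t ^ k • a

namespace Dilation

variable (h : Dilation A Γ)

/-- Homogeneous polynomial functions of degree `k`. -/
def homFn (k : ℕ) : Submodule ℝ A where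
  carrier := {a | ∀ t : ℝ, h.fn t a = t ^ k • a}
  add_mem' ha hb t := by rw [map_add, ha t, hb t, smul_add]
  zero_mem' t := by rw [map_zero, smul_zero]
  smul_mem' r a ha t := by rw [map_smul, ha t, smul_comm]

theorem homFn_mul {j k : ℕ} {a b : A} (ha : a ∈ h.homFn j) (hb : b ∈ h.homFn k) :
    a * b ∈ h.homFn (j + k) := fun t => by
  rw [map_mul, ha t, hb t, smul_mul_smul_comm, pow_add]

theorem iSup_mul {a b : A} (ha : a ∈ ⨆ k, h.homFn k) (hb : b ∈ ⨆ k, h.homFn k) :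
    a * b ∈ ⨆ k, h.homFn k := by
  induction ha using Submodule.iSup_induction' with
  | mem j x hx =>
    induction hb using Submodule.iSup_induction' with
    | mem k y hy => exact Submodule.mem_iSup_of_mem _ (h.homFn_mul hx hy)
    | zero => rw [mul_zero]; exact Submodule.zero_mem _
    | add y z _ _ iy iz => rw [mul_add]; exact Submodule.add_mem _ iy iz
  | zero => rw [zero_mul]; exact Submodule.zero_mem _
  | add y z _ _ iy iz => rw [add_mul]; exact Submodule.add_mem _ iy iz

/-- The algebra of fibre-wise polynomial functions: sums of homogeneous ones. -/
def polyFn : Subalgebra ℝ A where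
  carrier := {a | a ∈ ⨆ k, h.homFn k}
  mul_mem' ha hb := h.iSup_mul ha hb
  add_mem' ha hb := Submodule.add_mem (⨆ k, h.homFn k) ha hb
  algebraMap_mem' r := Submodule.mem_iSup_of_mem 0 fun t => by simp

/-- Homogeneous derivations `D` of degree `k`, i.e. `h_t^* D = t ^ k D` for `t ≠ 0`, for the symbol
and for the operator. -/
def homDer (k : ℤ) : Submodule ℝ (ModDer A Γ) where
  carrier := {D | ∀ t : ℝ, t ≠ 0 →
    (∀ a, h.fn t (ModDer.symbol D a) = t ^ k • ModDer.symbol D (h.fn t a)) ∧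
    ∀ v, h.sec t (ModDer.op D v) = t ^ k • ModDer.op D (h.sec t v)}
  add_mem' {D E} hD hE t ht := by
    refine ⟨fun a => ?_, fun v => ?_⟩
    · simp [((hD t ht).1 a), ((hE t ht).1 a)]
    · simp [((hD t ht).2 v), ((hE t ht).2 v)]
  zero_mem' t ht := by simp
  smul_mem' r D hD t ht := by
    refine ⟨fun a => ?_, fun v => ?_⟩
    · simp [((hD t ht).1 a), smul_comm r]
    · simp [((hD t ht).2 v), smul_comm r]

theorem homDer_lie {j k : ℤ} {D E : ModDer A Γ} (hD : D ∈ h.homDer j) (hE : E ∈ h.homDer k) :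
    ⁅D, E⁆ ∈ h.homDer (j + k) := fun t ht => by
  refine ⟨fun a => ?_, fun v => ?_⟩
  · simp [((hD t ht).1 _), ((hE t ht).1 _), zpow_add₀ ht, smul_sub, smul_smul, mul_comm]
  · simp [((hD t ht).2 _), ((hE t ht).2 _), zpow_add₀ ht, smul_sub, smul_smul, mul_comm]

theorem homDer_smul {j : ℕ} {k : ℤ} {a : A} {D : ModDer A Γ} (ha : a ∈ h.homFn j)
    (hD : D ∈ h.homDer k) : a • D ∈ h.homDer (j + k) := fun t ht => by
  refine ⟨fun b => ?_, fun v => ?_⟩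
  · simp [((hD t ht).1 _), zpow_add₀ ht, ha t, smul_smul, mul_comm]
  · simp [((hD t ht).2 _), zpow_add₀ ht, ha t, smul_smul, h.sec_smul, mul_comm, smul_comm a]

theorem homDer_apply {j : ℕ} {k : ℤ} {a : A} {D : ModDer A Γ} (ha : a ∈ h.homFn j)
    (hD : D ∈ h.homDer k) : ModDer.symbol D a ∈ ⨆ i, h.homFn i := by
  have key : ∀ t : ℝ, t ≠ 0 → h.fn t (ModDer.symbol D a) = t ^ (k + j) • ModDer.symbol D a := by
    intro t ht
    rw [(hD t ht).1, ha t, Derivation.map_smul, smul_smul, zpow_add₀ ht, zpow_natCast]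
  rcases h.regular _ _ key with h0 | ⟨i, _, hi⟩
  · rw [h0]; exact Submodule.zero_mem _
  · exact Submodule.mem_iSup_of_mem i hi

/-- The Lie algebra of polynomial derivations: sums of homogeneous ones. -/
def polyDer : LieSubalgebra ℝ (ModDer A Γ) where
  toSubmodule := ⨆ k, h.homDer k
  lie_mem' {D E} hD hE := by
    induction hD using Submodule.iSup_induction' with
    | mem j x hx =>
      induction hE using Submodule.iSup_induction' with
      | mem k y hy => exact Submodule.mem_iSup_of_mem _ (h.homDer_lie hx hy)
      | zero => rw [lie_zero]; exact Submodule.zero_mem _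
      | add y z _ _ iy iz => rw [lie_add]; exact Submodule.add_mem _ iy iz
    | zero => rw [zero_lie]; exact Submodule.zero_mem _
    | add y z _ _ iy iz => rw [add_lie]; exact Submodule.add_mem _ iy iz

theorem polyDer_smul {a : A} {D : ModDer A Γ} (ha : a ∈ ⨆ k, h.homFn k)
    (hD : D ∈ ⨆ k, h.homDer k) : a • D ∈ ⨆ k, h.homDer k := by
  induction ha using Submodule.iSup_induction' with
  | mem j x hx =>
    induction hD using Submodule.iSup_induction' with
    | mem k y hy => exact Submodule.mem_iSup_of_mem _ (h.homDer_smul hx hy)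
    | zero => rw [smul_zero]; exact Submodule.zero_mem _
    | add y z _ _ iy iz => rw [smul_add]; exact Submodule.add_mem _ iy iz
  | zero => rw [zero_smul]; exact Submodule.zero_mem _
  | add y z _ _ iy iz => rw [add_smul]; exact Submodule.add_mem _ iy iz

theorem polyDer_apply {a : A} {D : ModDer A Γ} (ha : a ∈ ⨆ k, h.homFn k)
    (hD : D ∈ ⨆ k, h.homDer k) : ModDer.symbol D a ∈ ⨆ k, h.homFn k := by
  induction ha using Submodule.iSup_induction' with
  | mem j x hx =>
    induction hD using Submodule.iSup_induction' with
    | mem k y hy => exact h.homDer_apply hx hy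
    | zero => rw [ModDer.symbol_zero]; exact Submodule.zero_mem _
    | add y z _ _ iy iz => rw [ModDer.symbol_add]; exact Submodule.add_mem _ iy iz
  | zero => rw [map_zero]; exact Submodule.zero_mem _
  | add y z _ _ iy iz => rw [map_add]; exact Submodule.add_mem _ iy iz

/-- Polynomial derivations form a module over the polynomial functions. -/
instance instModulePoly : Module h.polyFn h.polyDer where
  smul a D := ⟨a.1 • D.1, h.polyDer_smul a.2 D.2⟩
  one_smul D := Subtype.ext (one_smul A D.1)
  mul_smul a b D := Subtype.ext (mul_smul a.1 b.1 D.1)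
  smul_zero a := Subtype.ext (smul_zero a.1)
  smul_add a D E := Subtype.ext (smul_add a.1 D.1 E.1)
  add_smul a b D := Subtype.ext (add_smul a.1 b.1 D.1)
  zero_smul D := Subtype.ext (zero_smul A D.1)

/-- Polynomial derivations act on polynomial functions through their symbol (the anchor). -/
instance instLieRingModulePoly : LieRingModule h.polyDer h.polyFn where
  bracket D a := ⟨ModDer.symbol D.1 a.1, h.polyDer_apply a.2 D.2⟩
  add_lie D E a := Subtype.ext rfl
  lie_add D a b := Subtype.ext (map_add (ModDer.symbol D.1) a.1 b.1)
  leibniz_lie D E a := Subtype.ext (by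
    change ModDer.symbol D.1 (ModDer.symbol E.1 a.1) =
      ModDer.symbol ⁅D.1, E.1⁆ a.1 + ModDer.symbol E.1 (ModDer.symbol D.1 a.1)
    rw [ModDer.symbol_lie]; abel)

/-- Symmetric multivectors whose degree `k` components `D` satisfy
`h_t^* D = t ^ (w - k) D` for all `t ≠ 0`, where
`(h_t^* D)(h_t^* f₁, … | h_t^* v) = h_t^* (D(f₁, … | v))`. -/
def weight (w : ℤ) : Submodule ℝ (SymMult A Γ) where
  carrier := {D | ∀ t : ℝ, t ≠ 0 → ∀ S : Multiset A,
    h.fn t (D.1.1 S) = t ^ (w - S.card) • D.1.1 (S.map (h.fn t)) ∧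
    ∀ v, h.sec t (D.1.2 S v) = t ^ (w - (S.card + 1)) • D.1.2 (S.map (h.fn t)) (h.sec t v)}
  add_mem' {D E} hD hE t ht S := by
    refine ⟨?_, fun v => ?_⟩
    · simp [(hD t ht S).1, (hE t ht S).1]
    · simp [(hD t ht S).2, (hE t ht S).2]
  zero_mem' t ht S := by simp
  smul_mem' r D hD t ht S := by
    refine ⟨?_, fun v => ?_⟩
    · simp [(hD t ht S).1, smul_comm r]
    · simp [(hD t ht S).2, smul_comm r]

theorem fn_unshuffleSum (t : ℝ) (G : Multiset A → Multiset A → A) (S : Multiset A) :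
    h.fn t (unshuffleSum G S) = unshuffleSum (fun x y => h.fn t (G x y)) S :=
  unshuffleSum_map (map_add (h.fn t)) G S

theorem sec_unshuffleSum (t : ℝ) (G : Multiset A → Multiset A → Γ) (S : Multiset A) :
    h.sec t (unshuffleSum G S) = unshuffleSum (fun x y => h.sec t (G x y)) S :=
  unshuffleSum_map (map_add (h.sec t)) G S

theorem smul_smul_aux (r s : ℝ) (a : A) (v : Γ) : (r • a) • s • v = (r * s) • a • v := by
  rw [smul_assoc, smul_comm a s, smul_smul]

theorem weight_mul {w w' : ℤ} {D E : SymMult A Γ} (hD : D ∈ h.weight w) (hE : E ∈ h.weight w') :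
    D * E ∈ h.weight (w + w') := fun t ht S => by
  refine ⟨?_, fun v => ?_⟩
  · simp only [SymMult.coe_mul, RawMult.mul]
    rw [h.fn_unshuffleSum, unshuffleSum_image, unshuffleSum_smul]
    refine unshuffleSum_congr fun x y hxy => ?_
    rw [map_mul, (hD t ht x).1, (hE t ht y).1, smul_mul_smul_comm, ← zpow_add₀ ht, ← hxy]
    congr 2
    push_cast [Multiset.card_add]; ring
  · simp only [SymMult.coe_mul, RawMult.mul, SymMult.unshuffleSum_apply]
    rw [h.sec_unshuffleSum, unshuffleSum_image, unshuffleSum_smul]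
    refine unshuffleSum_congr fun x y hxy => ?_
    simp only [LinearMap.add_apply, LinearMap.smul_apply]
    rw [map_add, h.sec_smul, h.sec_smul, (hD t ht x).1, (hE t ht y).2, (hD t ht y).2,
      (hE t ht x).1, smul_smul_aux, smul_smul_aux,
      ← zpow_add₀ ht, ← zpow_add₀ ht, ← hxy, smul_add]
    congr 3 <;> (push_cast [Multiset.card_add]; ring)

theorem weight_pre {w w' : ℤ} {D E : SymMult A Γ} (hD : D ∈ h.weight w) (hE : E ∈ h.weight w')
    (t : ℝ) (ht : t ≠ 0) (S : Multiset A) :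
    h.fn t ((RawMult.pre D.1 E.1).1 S) =
      t ^ (w + w' - 1 - S.card) • (RawMult.pre D.1 E.1).1 (S.map (h.fn t)) ∧
    ∀ v, h.sec t ((RawMult.pre D.1 E.1).2 S v) =
      t ^ (w + w' - 1 - (S.card + 1)) •
        (RawMult.pre D.1 E.1).2 (S.map (h.fn t)) (h.sec t v) := by
  refine ⟨?_, fun v => ?_⟩
  · simp only [RawMult.pre]
    rw [h.fn_unshuffleSum, unshuffleSum_image, unshuffleSum_smul]
    refine unshuffleSum_congr fun x y hxy => ?_
    rw [(hD t ht _).1, Multiset.map_cons, (hE t ht x).1, D.2.1.smul, smul_smul, ← zpow_add₀ ht,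
      ← hxy]
    congr 2
    push_cast [Multiset.card_add, Multiset.card_cons]; ring
  · simp only [RawMult.pre, SymMult.unshuffleSum_apply]
    rw [h.sec_unshuffleSum, unshuffleSum_image, unshuffleSum_smul]
    refine unshuffleSum_congr fun x y hxy => ?_
    simp only [LinearMap.add_apply, LinearMap.comp_apply]
    rw [map_add, (hD t ht _).2, (hD t ht _).2, Multiset.map_cons, (hE t ht y).1, (hE t ht y).2,
      D.2.2.1.smul, map_smul, LinearMap.smul_apply, smul_smul, smul_smul,
      ← zpow_add₀ ht, ← zpow_add₀ ht, ← hxy, smul_add]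
    congr 3 <;> (push_cast [Multiset.card_add, Multiset.card_cons]; ring)

theorem weight_lie {w w' : ℤ} {D E : SymMult A Γ} (hD : D ∈ h.weight w) (hE : E ∈ h.weight w') :
    ⁅D, E⁆ ∈ h.weight (w + w' - 1) := fun t ht S => by
  have h1 := h.weight_pre hD hE t ht S
  have h2 := h.weight_pre hE hD t ht S
  rw [add_comm w'] at h2
  refine ⟨?_, fun v => ?_⟩
  · simp only [SymMult.coe_lie, Prod.fst_sub, Pi.sub_apply, map_sub, h1.1, h2.1, smul_sub]
  · simp only [SymMult.coe_lie, Prod.snd_sub, Pi.sub_apply, LinearMap.sub_apply, map_sub, h1.2,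
      h2.2, smul_sub]

/-- Core symmetric multivectors: those whose degree `k` components satisfy
`h_t^* D = t ^ (-k) D`. -/
def core : Submodule ℝ (SymMult A Γ) := h.weight 0

/-- Fibre-wise linear symmetric multivectors: those whose degree `k` components satisfy
`h_t^* D = t ^ (1 - k) D`. They are closed under the bracket. -/
def lin : LieSubalgebra ℝ (SymMult A Γ) where
  toSubmodule := h.weight 1
  lie_mem' hD hE := by simpa using! h.weight_lie hD hE

theorem one_mem_core : (1 : SymMult A Γ) ∈ h.core := fun t ht S => by
  refine ⟨?_, fun v => ?_⟩
  · change h.fn t (if S.card = 0 then 1 else 0) =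
      _ • (if (S.map (h.fn t)).card = 0 then 1 else 0)
    rw [Multiset.card_map]
    split_ifs with hS
    · simp [hS]
    · simp
  · change h.sec t 0 = _ • (0 : Γ)
    simp

/-- Core symmetric multivectors form a commutative algebra under the product. -/
instance instCommRingCore : CommRing h.core where
  __ := (inferInstance : AddCommGroup h.core)
  mul C C' := ⟨C.1 * C'.1, by simpa using! h.weight_mul C.2 C'.2⟩
  one := ⟨1, h.one_mem_core⟩
  mul_assoc C C' C'' := Subtype.ext (SymMult.mul_assoc' _ _ _)
  mul_comm C C' := Subtype.ext (SymMult.mul_comm' _ _)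
  one_mul C := Subtype.ext (SymMult.one_mul' _)
  mul_one C := Subtype.ext ((SymMult.mul_comm' _ _).trans (SymMult.one_mul' _))
  left_distrib C C' C'' := Subtype.ext (SymMult.mul_add' _ _ _)
  right_distrib C C' C'' := Subtype.ext (SymMult.add_mul' _ _ _)
  zero_mul C := Subtype.ext (SymMult.zero_mul' _)
  mul_zero C := Subtype.ext ((SymMult.mul_comm' _ _).trans (SymMult.zero_mul' _))

instance instAlgebraCore : Algebra ℝ h.core :=
  Algebra.ofModule (fun r C C' => Subtype.ext (SymMult.smul_mul' _ _ _))
    (fun r C C' => Subtype.ext (by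
      change C.1 * (r • C'.1) = r • (C.1 * C'.1)
      rw [SymMult.mul_comm', SymMult.smul_mul', SymMult.mul_comm']))

/-- The product of a core and a fibre-wise linear multivector is fibre-wise linear. -/
instance instModuleLin : Module h.core h.lin where
  smul C D := ⟨C.1 * D.1, by simpa using! h.weight_mul C.2 D.2⟩
  one_smul D := Subtype.ext (SymMult.one_mul' _)
  mul_smul C C' D := Subtype.ext (SymMult.mul_assoc' _ _ _)
  smul_zero C := Subtype.ext ((SymMult.mul_comm' _ _).trans (SymMult.zero_mul' _))
  smul_add C D E := Subtype.ext (SymMult.mul_add' _ _ _)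
  add_smul C C' D := Subtype.ext (SymMult.add_mul' _ _ _)
  zero_smul D := Subtype.ext (SymMult.zero_mul' _)

/-- Fibre-wise linear multivectors act on core ones by the bracket (the anchor). -/
instance instLieRingModuleLin : LieRingModule h.lin h.core where
  bracket D C := ⟨⁅D.1, C.1⁆, by simpa using! h.weight_lie D.2 C.2⟩
  add_lie D E C := Subtype.ext (add_lie D.1 E.1 C.1)
  lie_add D C C' := Subtype.ext (lie_add D.1 C.1 C'.1)
  leibniz_lie D E C := Subtype.ext (leibniz_lie D.1 E.1 C.1)

end Dilation

end Algebra
section SecModule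
variable {EM : Type*} [NormedAddCommGroup EM] [NormedSpace ℝ EM]
  {H : Type*} [TopologicalSpace H] {I : ModelWithCorners ℝ EM H}
  {M : Type*} [TopologicalSpace M] [ChartedSpace H M]
  {F : Type*} [NormedAddCommGroup F] [NormedSpace ℝ F]
  {V : M → Type*} [TopologicalSpace (TotalSpace F V)] [∀ x, TopologicalSpace (V x)]
  [FiberBundle F V] [∀ x, AddCommGroup (V x)] [∀ x, Module ℝ (V x)] [VectorBundle ℝ F V]

instance : SMul C^∞⟮I, M; 𝓘(ℝ, ℝ), ℝ⟯ Cₛ^∞⟮I; F, V⟯ where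
  smul f s := ⟨fun x => f x • s x, f.contMDiff.smul_section s.contMDiff⟩

theorem smul_sec_apply (f : C^∞⟮I, M; 𝓘(ℝ, ℝ), ℝ⟯) (s : Cₛ^∞⟮I; F, V⟯) (x : M) :
    (f • s) x = f x • s x := rfl

instance : Module C^∞⟮I, M; 𝓘(ℝ, ℝ), ℝ⟯ Cₛ^∞⟮I; F, V⟯ where
  one_smul s := by ext x; exact one_smul ℝ (s x)
  mul_smul f g s := by ext x; exact mul_smul (f x) (g x) (s x)
  smul_zero f := by ext x; exact smul_zero (f x)
  smul_add f s t := by ext x; exact smul_add (f x) (s x) (t x)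
  add_smul f g s := by ext x; exact add_smul (f x) (g x) (s x)
  zero_smul s := by ext x; exact zero_smul ℝ (s x)

instance : IsScalarTower ℝ C^∞⟮I, M; 𝓘(ℝ, ℝ), ℝ⟯ Cₛ^∞⟮I; F, V⟯ where
  smul_assoc c f s := by ext x; exact smul_assoc c (f x) (s x)
end SecModule

instance {B B' : Type*} (f : B' → B) (W : B → Type*) [i : ∀ x, AddCommGroup (W x)] (x : B') :
    AddCommGroup ((f *ᵖ W) x) := inferInstanceAs (AddCommGroup (W (f x)))

section Bundles
variable {EM : Type*} [NormedAddCommGroup EM] [NormedSpace ℝ EM]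
  {H : Type*} [TopologicalSpace H] (I : ModelWithCorners ℝ EM H)
  {M : Type*} [TopologicalSpace M] [ChartedSpace H M]
  (F : Type*) [NormedAddCommGroup F] [NormedSpace ℝ F]
  (E : M → Type*) [TopologicalSpace (TotalSpace F E)] [∀ x, TopologicalSpace (E x)]
  [FiberBundle F E] [∀ x, AddCommGroup (E x)] [∀ x, Module ℝ (E x)] [VectorBundle ℝ F E]
  (G : Type*) [NormedAddCommGroup G] [NormedSpace ℝ G]
  (V : M → Type*) [TopologicalSpace (TotalSpace G V)] [∀ x, TopologicalSpace (V x)]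
  [FiberBundle G V] [∀ x, AddCommGroup (V x)] [∀ x, Module ℝ (V x)] [VectorBundle ℝ G V]

/-- Smooth functions on the total space of `E`. -/
abbrev TotFun : Type _ := C^∞⟮I.prod 𝓘(ℝ, F), TotalSpace F E; 𝓘(ℝ, ℝ), ℝ⟯

/-- The projection of a vector bundle as a smooth map. -/
def bproj : C^∞⟮I.prod 𝓘(ℝ, F), TotalSpace F E; I, M⟯ := ⟨π F E, Bundle.contMDiff_proj E⟩

/-- Smooth sections of the pull-back `V_E` of the bundle `V` to the total space of `E`. -/
abbrev PullSec : Type _ := Cₛ^∞⟮I.prod 𝓘(ℝ, F); G, bproj I F E *ᵖ V⟯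

/-- The dual bundle. -/
abbrev DualBundle : M → Type _ := fun x => E x →L[ℝ] Bundle.Trivial M ℝ x

variable {E} in
/-- Fibre-wise multiplication by `t` on the total space of `E`. -/
def scale (t : ℝ) (p : TotalSpace F E) : TotalSpace F E := ⟨p.1, t • p.2⟩

theorem contMDiff_scale (t : ℝ) : ContMDiff (I.prod 𝓘(ℝ, F)) (I.prod 𝓘(ℝ, F)) ∞
    (scale F t : TotalSpace F E → TotalSpace F E) := by
  intro p
  have hid : ContMDiffAt (I.prod 𝓘(ℝ, F)) (I.prod 𝓘(ℝ, F)) ∞ (id : TotalSpace F E → _) p :=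
    contMDiffAt_id
  rw [Bundle.contMDiffAt_totalSpace] at hid ⊢
  refine ⟨hid.1, ?_⟩
  have hc : ContMDiffAt (I.prod 𝓘(ℝ, F)) 𝓘(ℝ, ℝ) ∞ (fun _ : TotalSpace F E => t) p :=
    contMDiffAt_const
  refine (hc.smul hid.2).congr_of_eventuallyEq ?_
  have : ∀ᶠ q in nhds p, q.1 ∈ (trivializationAt F E p.1).baseSet :=
    (FiberBundle.continuous_proj F E).continuousAt.eventually
      ((trivializationAt F E p.1).open_baseSet.mem_nhds (FiberBundle.mem_baseSet_trivializationAt' p.1))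
  filter_upwards [this] with q hq
  exact ((trivializationAt F E p.1).linear ℝ hq).2 t q.2

theorem continuous_scale (p : TotalSpace F E) : Continuous fun t : ℝ => scale F t p := by
  have hp := FiberBundle.mem_baseSet_trivializationAt' (F := F) (E := E) p.1
  set e := trivializationAt F E p.1
  have : (fun t : ℝ => scale F t p) = fun t : ℝ =>
      e.toOpenPartialHomeomorph.symm (p.1, t • (e p).2) := by
    funext t
    have h1 : e (scale F t p) = (p.1, t • (e p).2) := by
      refine Prod.ext (e.coe_fst ((e.mem_source (x := scale F t p)).2 hp)) ?_
      exact (e.linear ℝ hp).2 t p.2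
    rw [← h1]
    exact (e.toOpenPartialHomeomorph.left_inv ((e.mem_source (x := scale F t p)).2 hp)).symm
  rw [this]
  refine e.continuousOn_invFun.comp_continuous (by fun_prop) fun t => ?_
  exact e.mem_target.2 hp

/-- A section of a pull-back bundle is smooth iff the underlying map to the total space of the
original bundle is. -/
theorem contMDiff_pullback_iff (s : ∀ p : TotalSpace F E, V p.1) :
    ContMDiff (I.prod 𝓘(ℝ, F)) ((I.prod 𝓘(ℝ, F)).prod 𝓘(ℝ, G)) ∞
      (fun p => (⟨p, s p⟩ : TotalSpace G (bproj I F E *ᵖ V))) ↔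
    ContMDiff (I.prod 𝓘(ℝ, F)) (I.prod 𝓘(ℝ, G)) ∞ (fun p => (⟨p.1, s p⟩ : TotalSpace G V)) := by
  refine forall_congr' fun p => ?_
  exact ⟨fun h => Bundle.contMDiffAt_totalSpace.2
      ⟨Bundle.contMDiff_proj E p, (Bundle.contMDiffAt_totalSpace.1 h).2⟩,
    fun h => Bundle.contMDiffAt_totalSpace.2
      ⟨contMDiffAt_id, (Bundle.contMDiffAt_totalSpace.1 h).2⟩⟩

/-- The pull-back `h_t^*` of smooth functions along the fibre-wise multiplication `h_t`. -/
def scaleFn (t : ℝ) : TotFun I F E →ₐ[ℝ] TotFun I F E where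
  toFun f := ⟨fun p => f (scale F t p), f.contMDiff.comp (contMDiff_scale I F E t)⟩
  map_one' := rfl
  map_mul' _ _ := rfl
  map_zero' := rfl
  map_add' _ _ := rfl
  commutes' _ := rfl

/-- The pull-back `h_t^*` of smooth sections of the pull-back bundle `V_E`. -/
def scaleSec (t : ℝ) : PullSec I F E G V →ₗ[ℝ] PullSec I F E G V where
  toFun s := ⟨fun p => (s (scale F t p) : V p.1), (contMDiff_pullback_iff I F E G V _).2
    (((contMDiff_pullback_iff I F E G V fun p => s p).1 s.contMDiff).comp
      (contMDiff_scale I F E t))⟩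
  map_add' _ _ := rfl
  map_smul' _ _ := rfl

/-- The action of `ℝ` on functions on `E` and on sections of `V_E`. -/
def dilation : Dilation (TotFun I F E) (PullSec I F E G V) where
  fn := scaleFn I F E
  sec := scaleSec I F E G V
  sec_smul _ _ _ := rfl
  regular m f hf := by
    have hf' : ∀ t : ℝ, t ≠ 0 → ∀ p, f (scale F t p) = t ^ m * f p := fun t ht p =>
      congrArg (fun g : TotFun I F E => g p) (hf t ht)
    have hc : ∀ p, Filter.Tendsto (fun t : ℝ => f (scale F t p)) (nhdsWithin 0 {0}ᶜ)
        (nhds (f (scale F 0 p))) := fun p =>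
      ((f.contMDiff.continuous.comp (continuous_scale F E p)).tendsto 0).mono_left
        nhdsWithin_le_nhds
    have h0 : Filter.Tendsto (fun t : ℝ => t) (nhdsWithin 0 {0}ᶜ) (nhds 0) :=
      Filter.tendsto_id.mono_left nhdsWithin_le_nhds
    rcases lt_or_ge m 0 with hm | hm
    · left
      ext p
      obtain ⟨k, rfl⟩ : ∃ k : ℕ, m = -k := ⟨m.natAbs, by omega⟩
      have hk : k ≠ 0 := by omega
      have h1 : Filter.Tendsto (fun t : ℝ => t ^ k * f (scale F t p)) (nhdsWithin 0 {0}ᶜ)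
          (nhds 0) := by
        simpa [hk] using (h0.pow k).mul (hc p)
      have h2 : (fun t : ℝ => t ^ k * f (scale F t p)) =ᶠ[nhdsWithin 0 {0}ᶜ] fun _ => f p := by
        filter_upwards [self_mem_nhdsWithin] with t ht
        have ht : t ≠ 0 := ht
        rw [hf' t ht, ← mul_assoc, zpow_neg, zpow_natCast, mul_inv_cancel₀ (pow_ne_zero k ht),
          one_mul]
      exact tendsto_nhds_unique tendsto_const_nhds (h1.congr' h2)
    · right
      obtain ⟨k, rfl⟩ := Int.eq_ofNat_of_zero_le hm
      refine ⟨k, rfl, fun t => ?_⟩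
      ext p
      change f (scale F t p) = t ^ k * f p
      rcases eq_or_ne t 0 with rfl | ht
      · have h1 : Filter.Tendsto (fun t : ℝ => t ^ k * f p) (nhdsWithin 0 {0}ᶜ)
            (nhds (0 ^ k * f p)) := (h0.pow k).mul_const _
        have h2 : (fun t : ℝ => f (scale F t p)) =ᶠ[nhdsWithin 0 {0}ᶜ] fun t => t ^ k * f p := by
          filter_upwards [self_mem_nhdsWithin] with t ht
          rw [hf' t ht, zpow_natCast]
        exact tendsto_nhds_unique (hc p) (h1.congr' h2.symm)
      · rw [hf' t ht, zpow_natCast]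

/-- The pull-back to the total space of `E` of a section of `V`. -/
def pullSec (v : Cₛ^∞⟮I; G, V⟯) : PullSec I F E G V :=
  ⟨fun p => (v p.1 : V p.1), (contMDiff_pullback_iff I F E G V fun p => v p.1).2
    (v.contMDiff.comp (Bundle.contMDiff_proj E))⟩

variable [ContMDiffVectorBundle ∞ F E I]

/-- The fibre-wise linear function on `E` defined by a section of the dual bundle. -/
def linFn (φ : Cₛ^∞⟮I; F →L[ℝ] ℝ, DualBundle E⟯) : TotFun I F E :=
  ⟨fun p => φ p.1 p.2, by
    have h := ContMDiff.clm_bundle_apply (IB := I) (n := ∞) (F₁ := F) (F₂ := ℝ) (E₁ := E)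
      (E₂ := Bundle.Trivial M ℝ) (b := fun p : TotalSpace F E => p.1)
      (ϕ := fun p => φ p.1) (v := fun p => p.2) (IM := I.prod 𝓘(ℝ, F))
      (φ.contMDiff.comp (Bundle.contMDiff_proj E)) contMDiff_id
    intro p
    exact (Bundle.contMDiffAt_totalSpace.1 (h p)).2⟩

/-- The function `f` on the dual bundle is the fibre-wise polynomial function corresponding to the
core multivector `C`: its value at `φ x` is the sum over `k` of `1 / k! • C(ℓ_φ, …, ℓ_φ)` (`k`
arguments), evaluated at the zero `0_x` of the fibre. Only finitely many terms are nonzero. -/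
def IsCoreFn (C : (dilation I F E G V).core)
    (f : (dilation I (F →L[ℝ] ℝ) (DualBundle E) G V).polyFn) : Prop :=
  ∀ (φ : Cₛ^∞⟮I; F →L[ℝ] ℝ, DualBundle E⟯) (x : M),
    f.1 ⟨x, φ x⟩ = ∑ᶠ k : ℕ, ((k.factorial : ℝ)⁻¹) •
      C.1.1.1 (Multiset.replicate k (linFn I F E φ)) ⟨x, 0⟩

/-- The derivation `D'` of the pull-back bundle `V_{E^*}` is dual to the fibre-wise linear symmetric
multivector `D`: its symbol acts on fibre-wise polynomial functions, i.e. core multivectors, as the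
bracket with `D`, and its value on the pull-back of a section `v` of `V` is, at the point `φ x`, the
sum over `k` of `1 / k! • D(ℓ_φ, …, ℓ_φ | v)` (`k` scalar arguments), evaluated at `0_x`.
Only finitely many terms are nonzero. -/
def IsDual (j : (dilation I F E G V).core ≃ₐ[ℝ] (dilation I (F →L[ℝ] ℝ) (DualBundle E) G V).polyFn)
    (D : (dilation I F E G V).lin)
    (D' : ModDer (TotFun I (F →L[ℝ] ℝ) (DualBundle E))
      (PullSec I (F →L[ℝ] ℝ) (DualBundle E) G V)) : Prop :=
  (∀ C, ModDer.symbol D' (j C).1 = (j ⁅D, C⁆).1) ∧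
  ∀ (v : Cₛ^∞⟮I; G, V⟯) (φ : Cₛ^∞⟮I; F →L[ℝ] ℝ, DualBundle E⟯) (x : M),
    (ModDer.op D' (pullSec I (F →L[ℝ] ℝ) (DualBundle E) G V v) ⟨x, φ x⟩ : V x) =
      ∑ᶠ k : ℕ, ((k.factorial : ℝ)⁻¹) •
        (D.1.1.2 (Multiset.replicate k (linFn I F E φ)) (pullSec I F E G V v) ⟨x, 0⟩ : V x)

end Bundles
end
end FWL
open FWL

/-! Weights decide everything. Take coordinates `x^i` on `M`, fibre coordinates `y^c` on `E` and a
frame of `V`. A multivector of weight `w` sends base functions `S` and fibre-linear functions `T` to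
a function of degree `w - |S|` (`Dilation.weight_fst`), the operator part to a section of one degree
less (`Dilation.weight_snd`), and whatever is homogeneous of negative degree vanishes. Hence a core
multivector (`w = 0`) is locally a polynomial in the derivatives `∂/∂y^c` with coefficients on the
base, which is a polynomial function on `E^*`. A fibre-wise linear one (`w = 1`) is locally a
combination, with core coefficients, of the functions `y^c`, the derivatives `∂/∂x^i` and elementary
endomorphisms of `V`. A polynomial derivation of `V_{E^*}` is a combination, with polynomial
coefficients, of `∂/∂η_c`, `∂/∂x^i` and the same endomorphisms, `η_c` being the fibre coordinates
dual to `y^c`. The isomorphism is a fibre-wise Fourier transform: `∂/∂y^c` becomes `η_c`, `-y^c`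
becomes `∂/∂η_c`, and the other generators keep their form.

The exponential `∑ 1 / k! • D(a, …, a)` makes this independent of coordinates. It turns sums over
unshuffles into products (`expF_mul`, `expS_mul`) and the composition of multivectors into the
insertion of an exponential (`expSum_pre_fst`, `expSum_pre_snd`). So `j` is multiplicative, and the
commutator of two dual derivations, computed in `evS_op_op`, is the exponential of the bracket
(`expS_lie`).

Bijectivity of `j` is proved by induction on the degree. Euler's relation recovers a core
multivector from the insertions of the `y^c` (`core_decomp`) and a polynomial function from its
fibre derivatives, and these two operations correspond to each other (`ev_coreFn_ins`). Dual
derivations are given by a formula in a frame (`dualAt_derOf`) and are unique (`DualAt.agree`), so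
they glue. In the other direction every homogeneous derivation is locally dual to a multivector
(`dualAt_linOf`), and injectivity (`eq_zero_of_dual`) lets the local multivectors glue.

Geometry enters only through `Realization` (evaluation at points, gluing) and `Frame` (coordinates
made global by cut-off functions). The analytic input is Hadamard's lemma, by which derivations at a
point are determined by their values on coordinates. Identities over a coordinate domain become
global after multiplication by a bump function. -/

namespace FWL
noncomputable section

/-! ### Leibniz rule of the bracket, multivectors of degree zero, and the grading -/

section Poisson
variable {A Γ : Type*} [CommRing A] [Algebra ℝ A] [AddCommGroup Γ] [Module ℝ Γ] [Module A Γ]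
  [IsScalarTower ℝ A Γ]

namespace RawMult

/-- The value of `D` is inserted into an argument of a product, so it lands either in `C` or in `E`.
Since `ins` is a derivation of `mul` and of `pre`, both sides keep their shape under insertion, and
`eq_of_ins` leaves only the case without arguments. -/
theorem pre_mul_left (C E D : RawMult A Γ) :
    pre (mul C E) D = mul C (pre E D) + mul (pre C D) E := by
  refine congrFun (eq_of_ins (ι := RawMult A Γ × RawMult A Γ × RawMult A Γ)
    (fun i => pre (mul i.1 i.2.1) i.2.2)
    (fun i => mul i.1 (pre i.2.1 i.2.2) + mul (pre i.1 i.2.2) i.2.1) ?_ ?_ ?_) (C, E, D)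
  · intro i
    simp only [pre, mul, unshuffleSum_zero, unshuffleSum_cons, Prod.fst_add, Pi.add_apply]
    ring
  · intro i
    ext v
    simp only [pre, mul, unshuffleSum_zero, unshuffleSum_cons, Prod.snd_add, Pi.add_apply,
      LinearMap.add_apply, LinearMap.comp_apply, LinearMap.smul_apply]
    module
  · rintro a ⟨C, E, D⟩
    refine ⟨[(ins a C, E, D), (C, ins a E, D), (C, E, ins a D)], ?_, ?_⟩
    · simp only [ins_pre, ins_mul, add_pre, List.map_cons, List.map_nil, List.sum_cons,
        List.sum_nil]
      abel
    · simp only [ins_add, ins_pre, ins_mul, add_mul, mul_add, List.map_cons, List.map_nil,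
        List.sum_cons, List.sum_nil]
      abel

theorem ins_mem {D : RawMult A Γ} (hD : D ∈ SymMult A Γ) (a : A) : ins a D ∈ SymMult A Γ := by
  obtain ⟨⟨a1, a2, a3, m, a4⟩, ⟨b1, b2, b3, n, b4⟩, c⟩ := hD
  refine ⟨⟨?_, ?_, ?_, m, ?_⟩, ⟨?_, ?_, ?_, n, ?_⟩, ?_⟩
  · intro S x y; simp only [ins, Multiset.cons_swap a, a1]
  · intro S x y; simp only [ins, Multiset.cons_swap a, a2]
  · intro S x y; simp only [ins, Multiset.cons_swap a, a3]
  · intro S hS; exact a4 _ (by rw [Multiset.card_cons]; omega)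
  · intro S x y; simp only [ins, Multiset.cons_swap a, b1]
  · intro S x y; simp only [ins, Multiset.cons_swap a, b2]
  · intro S x y; simp only [ins, Multiset.cons_swap a, b3]
  · intro S hS; exact b4 _ (by rw [Multiset.card_cons]; omega)
  · intro S x v; simp only [ins, c, Multiset.cons_swap a]

/-- Here, unlike in `pre_mul_left`, `D` has to be a derivation in the argument that receives the
product. The index type of `eq_of_ins` therefore consists of multivectors, which `ins_mem` shows to
be closed under insertion. -/
theorem pre_mul_right {D : RawMult A Γ} (hD : D ∈ SymMult A Γ) (C E : RawMult A Γ) :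
    pre D (mul C E) = mul C (pre D E) + mul (pre D C) E := by
  refine congrFun (eq_of_ins (ι := SymMult A Γ × RawMult A Γ × RawMult A Γ)
    (fun i => pre i.1.1 (mul i.2.1 i.2.2))
    (fun i => mul i.2.1 (pre i.1.1 i.2.2) + mul (pre i.1.1 i.2.1) i.2.2) ?_ ?_ ?_)
    (⟨D, hD⟩, C, E)
  · intro i
    simp only [pre, mul, unshuffleSum_zero, Prod.fst_add, Pi.add_apply, i.1.2.1.mul,
      smul_eq_mul]
    ring
  · intro i
    ext v
    simp only [pre, mul, unshuffleSum_zero, Prod.snd_add, Pi.add_apply,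
      LinearMap.add_apply, LinearMap.comp_apply, LinearMap.smul_apply, map_add, i.1.2.2.1.mul,
      SymMult.op_smul]
    module
  · rintro a ⟨D, C, E⟩
    refine ⟨[(⟨ins a D.1, ins_mem D.2 a⟩, C, E), (D, ins a C, E), (D, C, ins a E)], ?_, ?_⟩
    · simp only [ins_pre, ins_mul, pre_add (SymMult.additive D), List.map_cons, List.map_nil,
        List.sum_cons, List.sum_nil]
      abel
    · simp only [ins_add, ins_pre, ins_mul, add_mul, mul_add, List.map_cons, List.map_nil,
        List.sum_cons, List.sum_nil]
      abel

end RawMult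

namespace SymMult

/-- The bracket is a derivation of the product. -/
theorem lie_mul (D C E : SymMult A Γ) : ⁅D, C * E⁆ = C * ⁅D, E⁆ + ⁅D, C⁆ * E := by
  refine Subtype.ext ?_
  have hs : ∀ X Y Z : RawMult A Γ, RawMult.mul X (Y - Z) = RawMult.mul X Y - RawMult.mul X Z :=
    fun X Y Z => by rw [eq_sub_iff_add_eq, ← RawMult.mul_add, sub_add_cancel]
  have hs' : ∀ X Y Z : RawMult A Γ, RawMult.mul (X - Y) Z = RawMult.mul X Z - RawMult.mul Y Z :=
    fun X Y Z => by rw [eq_sub_iff_add_eq, ← RawMult.add_mul, sub_add_cancel]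
  simp only [coe_lie, coe_mul, Submodule.coe_add, RawMult.pre_mul_right D.2,
    RawMult.pre_mul_left, hs, hs']
  abel

theorem ext_iff' {D E : SymMult A Γ} :
    D = E ↔ (∀ S, D.1.1 S = E.1.1 S) ∧ ∀ S v, D.1.2 S v = E.1.2 S v :=
  ⟨fun h => h ▸ ⟨fun _ => rfl, fun _ _ => rfl⟩, fun h => Subtype.ext (Prod.ext (funext h.1)
    (funext fun S => LinearMap.ext (h.2 S)))⟩

/-- The multivector of degree `0` defined by an element of `A`. -/
def ofFn : A →ₗ[ℝ] SymMult A Γ where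
  toFun a := ⟨(fun S => if S.card = 0 then a else 0, 0), ⟨by simp, by simp, by simp, 1, fun S hS => by
    simp [show S.card ≠ 0 by omega]⟩, ⟨by simp, by simp, by simp, 0, by simp⟩, by simp⟩
  map_add' a b := by
    refine Subtype.ext (Prod.ext (funext fun S => ?_) (by simp))
    simp only [Submodule.coe_add, Prod.fst_add, Pi.add_apply]
    split_ifs <;> simp
  map_smul' r a := by
    refine Subtype.ext (Prod.ext (funext fun S => ?_) (by simp))
    simp only [Submodule.coe_smul, Prod.smul_fst, Pi.smul_apply, RingHom.id_apply]
    split_ifs <;> simp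

theorem ofFn_fst (a : A) (S : Multiset A) :
    (ofFn a : SymMult A Γ).1.1 S = if S.card = 0 then a else 0 := rfl
@[simp] theorem ofFn_zero (a : A) : (ofFn a : SymMult A Γ).1.1 0 = a := rfl
@[simp] theorem ofFn_cons (a b : A) (S : Multiset A) : (ofFn a : SymMult A Γ).1.1 (b ::ₘ S) = 0 := by
  simp [ofFn_fst]
@[simp] theorem ofFn_snd (a : A) (S : Multiset A) : (ofFn a : SymMult A Γ).1.2 S = 0 := rfl

theorem ofFn_one : (ofFn (1 : A) : SymMult A Γ) = 1 := rfl

theorem ofFn_mul (a b : A) : (ofFn (a * b) : SymMult A Γ) = ofFn a * ofFn b := by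
  have hins : ∀ a x : A, RawMult.ins x (ofFn a : SymMult A Γ).1 = 0 := fun a x =>
    Prod.ext (funext fun S => by simp [RawMult.ins]) (funext fun S => rfl)
  have h : ∀ x, RawMult.ins x (RawMult.mul (ofFn a : SymMult A Γ).1 (ofFn b : SymMult A Γ).1) = 0 := by
    intro x
    rw [RawMult.ins_mul, hins, hins, RawMult.mul_comm (ofFn a).1, zero_raw_mul, zero_raw_mul,
      add_zero]
  refine ext_iff'.2 ⟨fun S => ?_, fun S v => ?_⟩
  · induction S using Multiset.induction_on with
    | empty => simp [coe_mul, RawMult.mul, unshuffleSum_zero]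
    | cons x S _ =>
      have := congrFun (congrArg Prod.fst (h x)) S
      simpa [RawMult.ins, coe_mul] using this.symm
  · simp only [coe_mul, RawMult.mul, ofFn_snd, smul_zero, add_zero]
    simp [unshuffleSum]

/-- `ofFn a` vanishes on nonempty multisets, so only the splitting that leaves all of `S` to `G`
contributes. -/
theorem unshuffleSum_ofFn {N : Type*} [AddCommGroup N] [Module A N] (a : A)
    (G : Multiset A → N) (S : Multiset A) :
    unshuffleSum (fun x y => (ofFn a : SymMult A Γ).1.1 x • G y) S = a • G S := by
  induction S using Multiset.induction_on generalizing G with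
  | empty => simp [unshuffleSum_zero]
  | cons b S ih =>
    rw [unshuffleSum_cons]
    simp only [ofFn_cons, zero_smul, zero_add]
    exact ih (fun y => G (b ::ₘ y))

theorem ofFn_mul_fst (a : A) (D : SymMult A Γ) (S : Multiset A) :
    (ofFn a * D).1.1 S = a * D.1.1 S := by
  simpa [coe_mul, RawMult.mul] using unshuffleSum_ofFn (Γ := Γ) a D.1.1 S

theorem ofFn_mul_snd (a : A) (D : SymMult A Γ) (S : Multiset A) (v : Γ) :
    (ofFn a * D).1.2 S v = a • D.1.2 S v := by
  have := unshuffleSum_ofFn (Γ := Γ) a D.1.2 S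
  simp only [coe_mul, RawMult.mul, ofFn_snd, smul_zero, add_zero]
  rw [this, LinearMap.smul_apply]

/-- Insertion of a first argument into a multivector. -/
def ins (a : A) (D : SymMult A Γ) : SymMult A Γ := ⟨RawMult.ins a D.1, RawMult.ins_mem D.2 a⟩

@[simp] theorem ins_fst (a : A) (D : SymMult A Γ) (S) : (ins a D).1.1 S = D.1.1 (a ::ₘ S) := rfl
@[simp] theorem ins_snd (a : A) (D : SymMult A Γ) (S) : (ins a D).1.2 S = D.1.2 (a ::ₘ S) := rfl

theorem fst_zero_cons (D : SymMult A Γ) (S : Multiset A) : D.1.1 (0 ::ₘ S) = 0 :=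
  ((additive D).zero S).1
theorem snd_zero_cons (D : SymMult A Γ) (S : Multiset A) : D.1.2 (0 ::ₘ S) = 0 :=
  ((additive D).zero S).2

/-- The variant in which the value of `ofFn a` is inserted as an argument instead of multiplied;
`h0` removes the other splittings. -/
theorem unshuffleSum_ofFn_left {N : Type*} [AddCommGroup N] (a : A)
    (G : A → Multiset A → N) (h0 : ∀ S, G 0 S = 0) (S : Multiset A) :
    unshuffleSum (fun x y => G ((ofFn a : SymMult A Γ).1.1 x) y) S = G a S := by
  induction S using Multiset.induction_on generalizing G with
  | empty => simp [unshuffleSum_zero]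
  | cons b S ih =>
    rw [unshuffleSum_cons]
    simp only [ofFn_cons, h0, zero_add]
    exact ih (fun c y => G c (b ::ₘ y)) (fun _ => h0 _)

/-- The bracket with a function is the insertion. -/
theorem lie_ofFn (D : SymMult A Γ) (a : A) : ⁅D, ofFn a⁆ = ins a D := by
  -- A multivector of degree `0` has no slot into which `D` could be inserted.
  have h2 : RawMult.pre (ofFn a : SymMult A Γ).1 D.1 = 0 := by
    refine Prod.ext (funext fun S => ?_) (funext fun S => ?_)
    · simp [RawMult.pre, unshuffleSum]
    · simp [RawMult.pre, unshuffleSum]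
  have h1 : RawMult.pre D.1 (ofFn a : SymMult A Γ).1 = RawMult.ins a D.1 := by
    refine Prod.ext (funext fun S => ?_) (funext fun S => ?_)
    · exact unshuffleSum_ofFn_left (Γ := Γ) a (fun c y => D.1.1 (c ::ₘ y)) (fst_zero_cons D) S
    · simp only [RawMult.pre, ofFn_snd, LinearMap.comp_zero, zero_add]
      rw [unshuffleSum_swap fun y x => D.1.2 ((ofFn a : SymMult A Γ).1.1 y ::ₘ x)]
      exact unshuffleSum_ofFn_left (Γ := Γ) a (fun c y => D.1.2 (c ::ₘ y)) (snd_zero_cons D) S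
  refine Subtype.ext ?_
  rw [coe_lie, h1, h2, sub_zero]; rfl

/-- The symmetric multivectors of integer degree `m`. -/
def zdegree (m : ℤ) : Submodule ℝ (SymMult A Γ) where
  carrier := {D | ∀ S : Multiset A, ((S.card : ℤ) ≠ m → D.1.1 S = 0) ∧
    ((S.card : ℤ) + 1 ≠ m → D.1.2 S = 0)}
  add_mem' {D E} hD hE S := by
    refine ⟨fun h => ?_, fun h => ?_⟩
    · rw [Submodule.coe_add, Prod.fst_add, Pi.add_apply, (hD S).1 h, (hE S).1 h, add_zero]
    · rw [Submodule.coe_add, Prod.snd_add, Pi.add_apply, (hD S).2 h, (hE S).2 h, add_zero]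
  zero_mem' S := ⟨fun _ => rfl, fun _ => rfl⟩
  smul_mem' r D hD S := by
    refine ⟨fun h => ?_, fun h => ?_⟩
    · rw [Submodule.coe_smul, Prod.smul_fst, Pi.smul_apply, (hD S).1 h, smul_zero]
    · rw [Submodule.coe_smul, Prod.smul_snd, Pi.smul_apply, (hD S).2 h, smul_zero]

/-- Degrees are taken in `ℤ` because the bracket has degree `m + n - 1` and derivations may have
degree `-1`; by `zdegree_neg` the negative degrees contribute nothing. -/
theorem mem_degree_iff {k : ℕ} {D : SymMult A Γ} : D ∈ degree k ↔ D ∈ zdegree (k : ℤ) := by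
  refine forall_congr' fun S => ?_
  rw [Ne, Ne, Ne, Ne, Nat.cast_inj]
  norm_cast

theorem zdegree_neg {m : ℤ} (hm : m < 0) {D : SymMult A Γ} (hD : D ∈ zdegree m) : D = 0 := by
  refine ext_iff'.2 ⟨fun S => (hD S).1 (by omega), fun S v => ?_⟩
  rw [(hD S).2 (by omega)]; rfl

theorem zdegree_mul {m n : ℤ} {D E : SymMult A Γ} (hD : D ∈ zdegree m) (hE : E ∈ zdegree n) :
    D * E ∈ zdegree (m + n) := fun S => by
  refine ⟨fun h => ?_, fun h => ?_⟩
  · simp only [coe_mul, RawMult.mul]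
    refine unshuffleSum_eq_zero fun x y hxy => ?_
    have := congrArg Multiset.card hxy
    rw [Multiset.card_add] at this
    by_cases hx : (x.card : ℤ) = m
    · rw [(hE y).1 (by omega), mul_zero]
    · rw [(hD x).1 hx, zero_mul]
  · simp only [coe_mul, RawMult.mul]
    refine unshuffleSum_eq_zero fun x y hxy => ?_
    have := congrArg Multiset.card hxy
    rw [Multiset.card_add] at this
    have h1 : D.1.1 x • E.1.2 y = 0 := by
      by_cases hx : (x.card : ℤ) = m
      · rw [(hE y).2 (by omega), smul_zero]
      · rw [(hD x).1 hx, zero_smul]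
    have h2 : E.1.1 x • D.1.2 y = 0 := by
      by_cases hx : (x.card : ℤ) = n
      · rw [(hD y).2 (by omega), smul_zero]
      · rw [(hE x).1 hx, zero_smul]
    rw [h1, h2, add_zero]

theorem zdegree_pre {m n : ℤ} {D E : SymMult A Γ} (hD : D ∈ zdegree m) (hE : E ∈ zdegree n)
    (S : Multiset A) : ((S.card : ℤ) ≠ m + n - 1 → (RawMult.pre D.1 E.1).1 S = 0) ∧
    ((S.card : ℤ) + 1 ≠ m + n - 1 → (RawMult.pre D.1 E.1).2 S = 0) := by
  refine ⟨fun h => ?_, fun h => ?_⟩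
  · simp only [RawMult.pre]
    refine unshuffleSum_eq_zero fun x y hxy => ?_
    have := congrArg Multiset.card hxy
    rw [Multiset.card_add] at this
    by_cases hx : (x.card : ℤ) = n
    · rw [(hD _).1 (by rw [Multiset.card_cons]; push_cast; omega)]
    · rw [(hE x).1 hx, fst_zero_cons]
  · simp only [RawMult.pre]
    refine unshuffleSum_eq_zero fun x y hxy => ?_
    have := congrArg Multiset.card hxy
    rw [Multiset.card_add] at this
    have h1 : D.1.2 x ∘ₗ E.1.2 y = 0 := by
      by_cases hx : (x.card : ℤ) + 1 = m
      · rw [(hE y).2 (by omega), LinearMap.comp_zero]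
      · rw [(hD x).2 hx, LinearMap.zero_comp]
    have h2 : D.1.2 (E.1.1 y ::ₘ x) = 0 := by
      by_cases hx : (y.card : ℤ) = n
      · rw [(hD _).2 (by rw [Multiset.card_cons]; push_cast; omega)]
      · rw [(hE y).1 hx, snd_zero_cons]
    rw [h1, h2, add_zero]

theorem zdegree_lie {m n : ℤ} {D E : SymMult A Γ} (hD : D ∈ zdegree m) (hE : E ∈ zdegree n) :
    ⁅D, E⁆ ∈ zdegree (m + n - 1) := fun S => by
  have h1 := zdegree_pre hD hE S
  have h2 := zdegree_pre hE hD S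
  rw [add_comm n m] at h2
  refine ⟨fun h => ?_, fun h => ?_⟩
  · rw [coe_lie, Prod.fst_sub, Pi.sub_apply, h1.1 h, h2.1 h, sub_zero]
  · rw [coe_lie, Prod.snd_sub, Pi.sub_apply, h1.2 h, h2.2 h, sub_zero]

theorem ofFn_mem (a : A) : (ofFn a : SymMult A Γ) ∈ zdegree 0 := fun S =>
  ⟨fun h => by rw [ofFn_fst, if_neg (by exact_mod_cast h)], fun _ => rfl⟩

/-- The component of degree `k`. -/
def comp (k : ℕ) (D : SymMult A Γ) : SymMult A Γ :=
  ⟨(fun S => if S.card = k then D.1.1 S else 0, fun S => if S.card + 1 = k then D.1.2 S else 0), by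
    obtain ⟨⟨a1, a2, a3, m, a4⟩, ⟨b1, b2, b3, n, b4⟩, c⟩ := D.2
    refine ⟨⟨?_, ?_, ?_, m, ?_⟩, ⟨?_, ?_, ?_, n, ?_⟩, ?_⟩
    · intro S x y; simp only [Multiset.card_cons]; split_ifs <;> simp [a1]
    · intro S x y; simp only [Multiset.card_cons]; split_ifs <;> simp [a2]
    · intro S x y; simp only [Multiset.card_cons]; split_ifs <;> simp [a3]
    · intro S hS; simp only [a4 S hS, ite_self]
    · intro S x y; simp only [Multiset.card_cons]; split_ifs <;> simp [b1]
    · intro S x y; simp only [Multiset.card_cons]; split_ifs <;> simp [b2]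
    · intro S x y; simp only [Multiset.card_cons]; split_ifs <;> simp [b3]
    · intro S hS; simp only [b4 S hS, ite_self]
    · intro S x v; simp only [Multiset.card_cons]; split_ifs <;> simp [c]⟩

theorem comp_fst (k : ℕ) (D : SymMult A Γ) (S) :
    (comp k D).1.1 S = if S.card = k then D.1.1 S else 0 := rfl
theorem comp_snd (k : ℕ) (D : SymMult A Γ) (S) :
    (comp k D).1.2 S = if S.card + 1 = k then D.1.2 S else 0 := rfl

theorem comp_mem (k : ℕ) (D : SymMult A Γ) : comp k D ∈ degree k := fun _ =>
  ⟨fun h => if_neg h, fun h => if_neg h⟩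

theorem fst_sum {ι : Type*} (s : Finset ι) (D : ι → SymMult A Γ) (S : Multiset A) :
    (∑ i ∈ s, D i).1.1 S = ∑ i ∈ s, (D i).1.1 S := by
  classical
  induction s using Finset.induction_on with
  | empty => simp
  | insert i s hi ih => rw [Finset.sum_insert hi, Finset.sum_insert hi, ← ih]; rfl

theorem snd_sum {ι : Type*} (s : Finset ι) (D : ι → SymMult A Γ) (S : Multiset A) (v : Γ) :
    (∑ i ∈ s, D i).1.2 S v = ∑ i ∈ s, (D i).1.2 S v := by
  classical
  induction s using Finset.induction_on with
  | empty => simp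
  | insert i s hi ih => rw [Finset.sum_insert hi, Finset.sum_insert hi, ← ih]; rfl

theorem exists_bound (D : SymMult A Γ) :
    ∃ n : ℕ, ∀ S : Multiset A, n ≤ S.card → D.1.1 S = 0 ∧ D.1.2 S = 0 := by
  obtain ⟨m, hm⟩ := D.2.1.bounded
  obtain ⟨n, hn⟩ := D.2.2.1.bounded
  exact ⟨m + n, fun S hS => ⟨hm S (by omega), hn S (by omega)⟩⟩

theorem exists_eq_sum_comp (D : SymMult A Γ) : ∃ n : ℕ, D = ∑ k ∈ Finset.range n, comp k D := by
  obtain ⟨n, hn⟩ := exists_bound D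
  -- The operator part on `S` belongs to degree `S.card + 1`, so the components up to degree `n` are
  -- needed.
  refine ⟨n + 1, ext_iff'.2 ⟨fun S => ?_, fun S v => ?_⟩⟩
  · simp only [fst_sum, comp_fst, Finset.sum_ite_eq, Finset.mem_range]
    split_ifs with h
    · rfl
    · exact (hn S (by omega)).1
  · simp only [snd_sum, comp_snd]
    rw [Finset.sum_congr rfl (g := fun k => if S.card + 1 = k then D.1.2 S v else 0)
      (fun k _ => by split_ifs <;> rfl), Finset.sum_ite_eq]
    split_ifs with h
    · rfl
    · rw [(hn S (by simp at h; omega)).2]; rfl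

end SymMult

end Poisson
end
end FWL

namespace FWL
noncomputable section

/-! ### Exponential sums over repeated arguments -/

section ExpSum
variable {A N : Type*} [AddCommGroup N] [Module ℝ N]

/-- The exponential sum `∑ 1 / k! • G(a, …, a)`, where `G` vanishes on many arguments. -/
def expSum (G : Multiset A → N) (a : A) : N :=
  ∑ᶠ k : ℕ, ((k.factorial : ℝ)⁻¹) • G (Multiset.replicate k a)

/-- `G` vanishes on many arguments. -/
def VanishesLarge (G : Multiset A → N) : Prop := ∃ n : ℕ, ∀ S, n ≤ S.card → G S = 0

/-- The bound need not be sharp, so several exponentials can be written as sums over a common range.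
-/
theorem expSum_eq {G : Multiset A → N} {n : ℕ} (hG : ∀ S, n ≤ S.card → G S = 0) (a : A) :
    expSum G a = ∑ k ∈ Finset.range n, ((k.factorial : ℝ)⁻¹) • G (Multiset.replicate k a) := by
  refine finsum_eq_sum_of_support_subset _ fun k hk => ?_
  rw [Finset.coe_range, Set.mem_Iio]
  by_contra h
  refine hk ?_
  simp only
  rw [hG _ (by rw [Multiset.card_replicate]; omega), smul_zero]

theorem expSum_map {N' : Type*} [AddCommGroup N'] [Module ℝ N'] (f : N →ₗ[ℝ] N')
    {G : Multiset A → N} (hG : VanishesLarge G) (a : A) :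
    f (expSum G a) = expSum (fun S => f (G S)) a := by
  obtain ⟨n, hn⟩ := hG
  rw [expSum_eq hn, expSum_eq (n := n) (fun S hS => by rw [hn S hS, map_zero]), map_sum]
  simp only [map_smul]

theorem expSum_add {G G' : Multiset A → N} (hG : VanishesLarge G) (hG' : VanishesLarge G') (a : A) :
    expSum (fun S => G S + G' S) a = expSum G a + expSum G' a := by
  obtain ⟨n, hn⟩ := hG
  obtain ⟨m, hm⟩ := hG'
  rw [expSum_eq (n := n + m) fun S hS => hn S (by omega), expSum_eq (n := n + m) fun S hS =>
    hm S (by omega), expSum_eq (n := n + m) fun S hS => by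
      rw [hn S (by omega), hm S (by omega), add_zero], ← Finset.sum_add_distrib]
  simp only [smul_add]

theorem expSum_zero (a : A) : expSum (fun _ => (0 : N)) a = 0 := by
  simp [expSum]

/-- Among equal arguments only the sizes of the two parts matter; the induction is Pascal's rule. -/
theorem unshuffleSum_replicate (G : Multiset A → Multiset A → N) (a : A) (k : ℕ) :
    unshuffleSum G (Multiset.replicate k a) = ∑ ij ∈ Finset.HasAntidiagonal.antidiagonal k,
      k.choose ij.1 • G (Multiset.replicate ij.1 a) (Multiset.replicate ij.2 a) := by
  induction k generalizing G with
  | zero => simp [unshuffleSum_zero]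
  | succ k ih =>
    rw [Multiset.replicate_succ, unshuffleSum_cons, unshuffleSum_add, ih, ih,
      Finset.sum_antidiagonal_choose_succ_nsmul
        (fun i j => G (Multiset.replicate i a) (Multiset.replicate j a)) k, add_comm]
    congr 1
    refine Finset.sum_congr rfl fun ij hij => ?_
    rw [← Multiset.replicate_succ, Nat.choose_symm_of_eq_add (Finset.HasAntidiagonal.mem_antidiagonal.1 hij).symm]

/-- The binomial coefficient that counts the splittings of `k` equal arguments turns `1 / k!` into
`1 / (i! j!)`. So an exponential converts a sum over unshuffles into a double sum, which factors
when `G` is bilinear in its two parts. -/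
theorem expSum_unshuffleSum {G : Multiset A → Multiset A → N} {n : ℕ}
    (hG : ∀ x y, n ≤ x.card ∨ n ≤ y.card → G x y = 0) (a : A) :
    expSum (unshuffleSum G) a = ∑ i ∈ Finset.range n, ∑ j ∈ Finset.range n,
      ((i.factorial : ℝ)⁻¹) • ((j.factorial : ℝ)⁻¹) •
        G (Multiset.replicate i a) (Multiset.replicate j a) := by
  -- Of two parts with at least `2 * n` elements together, one has at least `n`.
  rw [expSum_eq (n := 2 * n) fun S hS => unshuffleSum_eq_zero fun x y hxy => hG x y (by
    have := congrArg Multiset.card hxy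
    rw [Multiset.card_add] at this
    omega), ← Finset.sum_product',
    ← Finset.sum_fiberwise_of_maps_to (g := fun p : ℕ × ℕ => p.1 + p.2)
      (t := Finset.range (2 * n)) (fun p hp => by
        simp only [Finset.mem_product, Finset.mem_range] at hp ⊢; omega)]
  refine Finset.sum_congr rfl fun k _ => ?_
  rw [unshuffleSum_replicate, Finset.smul_sum]
  symm
  -- On the diagonal `i + j = k`, the pairs outside the square `i, j < n` contribute zero and the
  -- others have equal coefficients on both sides.
  refine Finset.sum_subset_zero_on_sdiff (fun p hp => ?_) (fun p hp => ?_) (fun p hp => ?_)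
  · exact Finset.HasAntidiagonal.mem_antidiagonal.2 (Finset.mem_filter.1 hp).2
  · simp only [Finset.mem_sdiff, Finset.HasAntidiagonal.mem_antidiagonal, Finset.mem_filter, Finset.mem_product,
      Finset.mem_range] at hp
    rw [hG _ _ (by rw [Multiset.card_replicate, Multiset.card_replicate]; omega), smul_zero,
      smul_zero]
  · have h := (Finset.mem_filter.1 hp).2
    rw [← Nat.cast_smul_eq_nsmul ℝ, smul_smul, smul_smul, ← h, Nat.choose_symm_add, Nat.add_choose]
    congr 1
    have h1 := Nat.factorial_ne_zero p.1
    have h2 := Nat.factorial_ne_zero p.2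
    have h3 := Nat.factorial_ne_zero (p.1 + p.2)
    rw [Nat.cast_div (Nat.factorial_mul_factorial_dvd_factorial_add _ _) (by positivity)]
    push_cast
    field_simp

theorem expSum_unshuffleSum_bilin {N₁ N₂ : Type*} [AddCommGroup N₁] [Module ℝ N₁]
    [AddCommGroup N₂] [Module ℝ N₂] (B : N₁ →ₗ[ℝ] N₂ →ₗ[ℝ] N) {G₁ : Multiset A → N₁}
    {G₂ : Multiset A → N₂} (h₁ : VanishesLarge G₁) (h₂ : VanishesLarge G₂) (a : A) :
    expSum (unshuffleSum fun x y => B (G₁ x) (G₂ y)) a = B (expSum G₁ a) (expSum G₂ a) := by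
  obtain ⟨n, hn⟩ := h₁
  obtain ⟨m, hm⟩ := h₂
  rw [expSum_unshuffleSum (n := n + m) (fun x y h => by
    rcases h with h | h
    · rw [hn x (by omega), map_zero, LinearMap.zero_apply]
    · rw [hm y (by omega), map_zero]), expSum_eq (n := n + m) (fun S hS => hn S (by omega)),
    expSum_eq (n := n + m) (fun S hS => hm S (by omega)), map_sum B, LinearMap.sum_apply]
  refine Finset.sum_congr rfl fun i _ => ?_
  rw [map_smul, LinearMap.smul_apply, map_sum, Finset.smul_sum]
  simp only [map_smul]

end ExpSum

/-! ### Exponentials of products and brackets of multivectors -/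

section ExpMult
variable {A Γ : Type*} [CommRing A] [Algebra ℝ A] [AddCommGroup Γ] [Module ℝ Γ] [Module A Γ]
  [IsScalarTower ℝ A Γ]

namespace SymMult

/-- `∑ 1 / k! • L(a, …, a)` for the symbol `L` of `D`. -/
def expF (D : SymMult A Γ) (a : A) : A := expSum D.1.1 a

/-- `∑ 1 / k! • D(a, …, a | v)`. -/
def expS (D : SymMult A Γ) (a : A) (v : Γ) : Γ := expSum (fun S => D.1.2 S v) a

theorem vanishes_fst (D : SymMult A Γ) : VanishesLarge D.1.1 := D.2.1.bounded

theorem vanishes_snd (D : SymMult A Γ) (v : Γ) : VanishesLarge fun S => D.1.2 S v := by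
  obtain ⟨n, hn⟩ := D.2.2.1.bounded
  exact ⟨n, fun S hS => by simp only [hn S hS, LinearMap.zero_apply]⟩

theorem expF_add (D E : SymMult A Γ) (a : A) : expF (D + E) a = expF D a + expF E a :=
  expSum_add (vanishes_fst D) (vanishes_fst E) a

theorem expF_smul (r : ℝ) (D : SymMult A Γ) (a : A) : expF (r • D) a = r • expF D a :=
  (expSum_map (LinearMap.lsmul ℝ A r) (vanishes_fst D) a).symm

theorem expF_zero (a : A) : expF (0 : SymMult A Γ) a = 0 := by
  rw [← zero_smul ℝ (0 : SymMult A Γ), expF_smul, zero_smul]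

theorem expS_add (D E : SymMult A Γ) (a : A) (v : Γ) :
    expS (D + E) a v = expS D a v + expS E a v :=
  expSum_add (vanishes_snd D v) (vanishes_snd E v) a

theorem expS_smul (r : ℝ) (D : SymMult A Γ) (a : A) (v : Γ) : expS (r • D) a v = r • expS D a v :=
  (expSum_map (LinearMap.lsmul ℝ Γ r) (vanishes_snd D v) a).symm

theorem expS_zero (a : A) (v : Γ) : expS (0 : SymMult A Γ) a v = 0 := by
  rw [← zero_smul ℝ (0 : SymMult A Γ), expS_smul, zero_smul]

theorem expF_sum {ι : Type*} (s : Finset ι) (D : ι → SymMult A Γ) (a : A) :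
    expF (∑ i ∈ s, D i) a = ∑ i ∈ s, expF (D i) a := by
  classical
  induction s using Finset.induction_on with
  | empty => exact expF_zero a
  | insert i s hi ih => rw [Finset.sum_insert hi, Finset.sum_insert hi, expF_add, ih]

theorem expS_add_arg (D : SymMult A Γ) (a : A) (v w : Γ) :
    expS D a (v + w) = expS D a v + expS D a w := by
  rw [expS, expS, expS, ← expSum_add (vanishes_snd D v) (vanishes_snd D w) a]
  simp only [map_add]

/-- The Leibniz rules of the operators `D(a, …, a | -)` add up. For fixed `a`, `expS D a` is thus a
derivation of `Γ` with symbol `f ↦ expF (ins f D) a`, which makes it local and computable in frames.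
-/
theorem expS_op_smul (D : SymMult A Γ) (a f : A) (v : Γ) :
    expS D a (f • v) = f • expS D a v + expF (ins f D) a • v := by
  have h1 := expSum_map (Module.toModuleEnd ℝ (S := A) Γ f) (vanishes_snd D v) a
  have h2 := expSum_map ((LinearMap.toSpanSingleton A Γ v).restrictScalars ℝ)
    (vanishes_fst (ins f D)) a
  simp only [Module.toModuleEnd_apply, DistribSMul.toLinearMap_apply, LinearMap.restrictScalars_apply,
    LinearMap.toSpanSingleton_apply] at h1 h2
  rw [expS, expS, expF, h1, h2, ← expSum_add]
  · simp only [op_smul, ins_fst]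
  · obtain ⟨n, hn⟩ := vanishes_snd D v
    exact ⟨n, fun S hS => by simp only at hn ⊢; rw [hn S hS, smul_zero]⟩
  · obtain ⟨n, hn⟩ := vanishes_fst (ins f D)
    exact ⟨n, fun S hS => by simp only at hn ⊢; rw [hn S hS, zero_smul]⟩

/-- The reason why `j` is multiplicative. -/
theorem expF_mul (C E : SymMult A Γ) (a : A) : expF (C * E) a = expF C a * expF E a :=
  expSum_unshuffleSum_bilin (LinearMap.mul ℝ A) (vanishes_fst C) (vanishes_fst E) a

/-- Scalar multiplication as a bilinear map. -/
def smulBilin : A →ₗ[ℝ] Γ →ₗ[ℝ] Γ :=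
  LinearMap.mk₂ ℝ (fun a v => a • v) (fun _ _ _ => add_smul _ _ _) (fun _ _ _ => smul_assoc _ _ _)
    (fun _ _ _ => smul_add _ _ _) (fun c a v => smul_comm a c v)

theorem expS_mul (C E : SymMult A Γ) (a : A) (v : Γ) :
    expS (C * E) a v = expF C a • expS E a v + expF E a • expS C a v := by
  have h1 := expSum_unshuffleSum_bilin smulBilin (vanishes_fst C) (vanishes_snd E v) a
  have h2 := expSum_unshuffleSum_bilin smulBilin (vanishes_fst E) (vanishes_snd C v) a
  simp only [smulBilin, LinearMap.mk₂_apply] at h1 h2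
  rw [expF, expF, expS, expS, expS, ← h1, ← h2, ← expSum_add]
  · congr 1
    funext S
    rw [coe_mul, RawMult.mul]
    simp only [unshuffleSum_apply, ← unshuffleSum_add]
    rfl
  all_goals
    obtain ⟨n, hn⟩ := exists_bound C
    obtain ⟨m, hm⟩ := exists_bound E
    refine ⟨2 * (n + m), fun S hS => unshuffleSum_eq_zero fun x y hxy => ?_⟩
    have := congrArg Multiset.card hxy
    rw [Multiset.card_add] at this
    rcases le_or_gt (n + m) x.card with h | h
    · simp only [(hn x (by omega)).1, (hm x (by omega)).1, zero_smul]
    · simp only [(hn y (by omega)).2, (hm y (by omega)).2, LinearMap.zero_apply, smul_zero]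

theorem expF_ins (D : SymMult A Γ) (b a : A) :
    expF (ins b D) a = expSum (fun S => D.1.1 (b ::ₘ S)) a := rfl

theorem fst_sum_cons (D : SymMult A Γ) {ι : Type*} (s : Finset ι) (f : ι → A) (S : Multiset A) :
    D.1.1 ((∑ i ∈ s, f i) ::ₘ S) = ∑ i ∈ s, D.1.1 (f i ::ₘ S) := by
  classical
  induction s using Finset.induction_on with
  | empty => exact fst_zero_cons D S
  | insert i s hi ih => rw [Finset.sum_insert hi, Finset.sum_insert hi, D.2.1.add, ih]

theorem snd_sum_cons (D : SymMult A Γ) {ι : Type*} (s : Finset ι) (f : ι → A) (S : Multiset A) :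
    D.1.2 ((∑ i ∈ s, f i) ::ₘ S) = ∑ i ∈ s, D.1.2 (f i ::ₘ S) := by
  classical
  induction s using Finset.induction_on with
  | empty => exact snd_zero_cons D S
  | insert i s hi ih => rw [Finset.sum_insert hi, Finset.sum_insert hi, D.2.2.1.add, ih]

/-- A bound on each part of the splitting separately, as required by `expSum_unshuffleSum`. One part
is long for `E`, the other for `D`, whence the sum of the two bounds. -/
theorem vanishes_pre (D E : SymMult A Γ) : ∃ n : ℕ, ∀ x y : Multiset A, n ≤ x.card ∨ n ≤ y.card →
    D.1.1 (E.1.1 x ::ₘ y) = 0 ∧ D.1.2 x ∘ₗ E.1.2 y = 0 ∧ D.1.2 (E.1.1 y ::ₘ x) = 0 := by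
  obtain ⟨n, hn⟩ := exists_bound D
  obtain ⟨m, hm⟩ := exists_bound E
  have hc : ∀ (a : A) (S : Multiset A), n ≤ S.card → n ≤ (a ::ₘ S).card := fun a S h => by
    rw [Multiset.card_cons]; omega
  refine ⟨n + m, fun x y h => ?_⟩
  rcases h with h | h
  · rw [(hm x (by omega)).1, fst_zero_cons, (hn x (by omega)).2, LinearMap.zero_comp,
      (hn _ (hc _ x (by omega))).2]
    exact ⟨rfl, rfl, rfl⟩
  · rw [(hm y (by omega)).1, (hn _ (hc _ y (by omega))).1, (hm y (by omega)).2,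
      LinearMap.comp_zero, snd_zero_cons]
    exact ⟨rfl, rfl, rfl⟩

/-- By linearity in the inserted argument, the sum over the copies of `a` that go to `E` can be
carried out inside `D`, where it becomes the single argument `expF E a`. -/
theorem expSum_pre_fst (D E : SymMult A Γ) (a : A) :
    expSum (RawMult.pre D.1 E.1).1 a = expF (ins (expF E a) D) a := by
  obtain ⟨n, hn⟩ := vanishes_pre D E
  obtain ⟨m, hm⟩ := exists_bound D
  obtain ⟨l, hl⟩ := exists_bound E
  rw [RawMult.pre, expSum_unshuffleSum (n := n + m + l) (fun x y h => (hn x y (by omega)).1), expF_ins,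
    expSum_eq (n := n + m + l) (fun S hS => (hm _ (by rw [Multiset.card_cons]; omega)).1), Finset.sum_comm]
  refine Finset.sum_congr rfl fun j _ => ?_
  rw [expF, expSum_eq (n := n + m + l) (fun S hS => (hl _ (by omega)).1), fst_sum_cons,
    Finset.smul_sum]
  refine Finset.sum_congr rfl fun i _ => ?_
  rw [D.2.1.smul, smul_comm]

theorem expSum_pre_snd (D E : SymMult A Γ) (a : A) (v : Γ) :
    expSum (fun S => (RawMult.pre D.1 E.1).2 S v) a =
      expS D a (expS E a v) + expS (ins (expF E a) D) a v := by
  obtain ⟨n, hn⟩ := vanishes_pre D E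
  obtain ⟨m, hm⟩ := exists_bound D
  obtain ⟨l, hl⟩ := exists_bound E
  have e : (fun S => (RawMult.pre D.1 E.1).2 S v) = unshuffleSum fun x y =>
      D.1.2 x (E.1.2 y v) + D.1.2 (E.1.1 y ::ₘ x) v := by
    funext S
    simp only [RawMult.pre, unshuffleSum_apply]
    rfl
  rw [e, expSum_unshuffleSum (n := n + m + l) (fun x y h => by
    have h1 := LinearMap.congr_fun (hn x y (by omega)).2.1 v
    rw [LinearMap.comp_apply, LinearMap.zero_apply] at h1
    rw [h1, (hn x y (by omega)).2.2, LinearMap.zero_apply, add_zero])]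
  simp only [smul_add, Finset.sum_add_distrib]
  congr 1
  · rw [expS, expSum_eq (n := n + m + l) (fun S hS => by
      rw [(hm _ (by omega)).2, LinearMap.zero_apply])]
    refine Finset.sum_congr rfl fun i _ => ?_
    rw [expS, expSum_eq (n := n + m + l) (fun S hS => by
      rw [(hl _ (by omega)).2, LinearMap.zero_apply]), map_sum, Finset.smul_sum]
    simp only [map_smul]
  · rw [expS, expSum_eq (n := n + m + l) (fun S hS => by
      rw [ins_snd, (hm _ (by rw [Multiset.card_cons]; omega)).2, LinearMap.zero_apply])]
    refine Finset.sum_congr rfl fun i _ => ?_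
    rw [ins_snd, expF, expSum_eq (n := n + m + l) (fun S hS => (hl _ (by omega)).1), snd_sum_cons,
      LinearMap.sum_apply, Finset.smul_sum]
    refine Finset.sum_congr rfl fun j _ => ?_
    rw [D.2.2.1.smul, LinearMap.smul_apply]

theorem expF_lie (D E : SymMult A Γ) (a : A) :
    expF (⁅D, E⁆) a = expF (ins (expF E a) D) a - expF (ins (expF D a) E) a := by
  rw [eq_sub_iff_add_eq, ← expSum_pre_fst, ← expSum_pre_fst, expF, ← expSum_add
    (vanishes_fst _) (let ⟨n, hn⟩ := pre_bounded E D; ⟨n, fun S hS => (hn S hS).1⟩)]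
  congr 1
  funext S
  rw [coe_lie, Prod.fst_sub, Pi.sub_apply, sub_add_cancel]

theorem expS_lie (D E : SymMult A Γ) (a : A) (v : Γ) :
    expS (⁅D, E⁆) a v = expS D a (expS E a v) + expS (ins (expF E a) D) a v -
      (expS E a (expS D a v) + expS (ins (expF D a) E) a v) := by
  rw [eq_sub_iff_add_eq, ← expSum_pre_snd, ← expSum_pre_snd, expS, ← expSum_add
    (vanishes_snd _ v) (let ⟨n, hn⟩ := pre_bounded E D; ⟨n, fun S hS => by
      rw [(hn S hS).2, LinearMap.zero_apply]⟩)]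
  congr 1
  funext S
  rw [coe_lie, Prod.snd_sub, Pi.sub_apply, LinearMap.sub_apply, sub_add_cancel]

theorem expF_ofFn (f a : A) : expF (ofFn f : SymMult A Γ) a = f := by
  rw [expF, expSum_eq (n := 1) fun S hS => by rw [ofFn_fst, if_neg (by omega)]]
  simp

theorem expS_ofFn (f a : A) (v : Γ) : expS (ofFn f : SymMult A Γ) a v = 0 := by
  simp [expS, expSum_zero]

end SymMult
end ExpMult
end
end FWL

namespace FWL
noncomputable section

/-! ### Weights, evaluation at points, gluing, and the notion of a local frame -/

section OneSide
variable {A Γ : Type*} [CommRing A] [Algebra ℝ A] [AddCommGroup Γ] [Module ℝ Γ] [Module A Γ]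
  [IsScalarTower ℝ A Γ]

namespace Dilation
variable (h : Dilation A Γ)

/-- Functions that are homogeneous of integer degree `m`, away from `t = 0`. -/
def zhom (m : ℤ) : Submodule ℝ A where
  carrier := {a | ∀ t : ℝ, t ≠ 0 → h.fn t a = t ^ m • a}
  add_mem' ha hb t ht := by rw [map_add, ha t ht, hb t ht, smul_add]
  zero_mem' t _ := by rw [map_zero, smul_zero]
  smul_mem' r a ha t ht := by rw [map_smul, ha t ht, smul_comm]

/-- A nonzero function of negative degree would be unbounded near the zero section. All vanishing
statements for reasons of weight come down to this. -/
theorem zhom_neg {m : ℤ} (hm : m < 0) {a : A} (ha : a ∈ h.zhom m) : a = 0 := by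
  rcases h.regular m a ha with h0 | ⟨k, hk, _⟩
  · exact h0
  · omega

theorem mem_zhom_natCast {k : ℕ} {a : A} : a ∈ h.zhom k ↔ a ∈ h.homFn k := by
  refine ⟨fun ha => ?_, fun ha t _ => by rw [ha t, zpow_natCast]⟩
  rcases h.regular k a ha with h0 | ⟨j, hj, hj'⟩
  · rw [h0]; exact Submodule.zero_mem _
  · obtain rfl : k = j := by exact_mod_cast hj
    exact hj'

theorem zhom_zero {a : A} : a ∈ h.zhom 0 ↔ a ∈ h.homFn 0 := h.mem_zhom_natCast (k := 0)
theorem zhom_one {a : A} : a ∈ h.zhom 1 ↔ a ∈ h.homFn 1 := h.mem_zhom_natCast (k := 1)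

theorem fn_homFn_zero {a : A} (ha : a ∈ h.homFn 0) (t : ℝ) : h.fn t a = a := by
  rw [ha t, pow_zero, one_smul]

/-- Base functions are invariant under `h_t`, and each fibre-linear argument contributes one factor
`t`. -/
theorem map_fn_args {N : Type*} [AddCommGroup N] [Module ℝ N] {G : Multiset A → N}
    (hG : ∀ S (c : ℝ) a, G ((c • a) ::ₘ S) = c • G (a ::ₘ S)) (t : ℝ)
    {S T : Multiset A} (hS : ∀ a ∈ S, a ∈ h.homFn 0) (hT : ∀ a ∈ T, a ∈ h.homFn 1) :
    G ((S + T).map (h.fn t)) = t ^ T.card • G (S + T) := by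
  have key : ∀ (T S' : Multiset A), (∀ a ∈ T, a ∈ h.homFn 1) →
      G (S' + T.map (h.fn t)) = t ^ T.card • G (S' + T) := by
    intro T
    induction T using Multiset.induction_on with
    | empty => intro S' _; simp
    | cons a T ih =>
      intro S' hT
      rw [Multiset.map_cons, Multiset.add_cons, hT a (Multiset.mem_cons_self a T), pow_one, hG,
        ← Multiset.cons_add, ih _ fun b hb => hT b (Multiset.mem_cons_of_mem hb), smul_smul,
        Multiset.card_cons, pow_succ', Multiset.cons_add, Multiset.add_cons]
  rw [Multiset.map_add, key T _ hT]
  congr 3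
  exact (Multiset.map_congr rfl fun a ha => h.fn_homFn_zero (hS a ha) t).trans (Multiset.map_id S)

/-- The linear arguments cancel against the weight: `w - (|S| + |T|) + |T| = w - |S|`. So the symbol
of a core multivector vanishes as soon as a base function is among such arguments, and that of a
linear one as soon as two are. -/
theorem weight_fst {w : ℤ} {D : SymMult A Γ} (hD : D ∈ h.weight w) {S T : Multiset A}
    (hS : ∀ a ∈ S, a ∈ h.homFn 0) (hT : ∀ a ∈ T, a ∈ h.homFn 1) :
    D.1.1 (S + T) ∈ h.zhom (w - S.card) := fun t ht => by
  rw [(hD t ht _).1, h.map_fn_args D.2.1.smul t hS hT, smul_smul, ← zpow_natCast,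
    ← zpow_add₀ ht]
  congr 2
  push_cast [Multiset.card_add]; ring

/-- One degree less than for the symbol, since the section counts as an argument: the degree is `-1
- |S|` for core and `-|S|` for linear multivectors. -/
theorem weight_snd {w : ℤ} {D : SymMult A Γ} (hD : D ∈ h.weight w) {S T : Multiset A}
    (hS : ∀ a ∈ S, a ∈ h.homFn 0) (hT : ∀ a ∈ T, a ∈ h.homFn 1) {v : Γ}
    (hv : ∀ t, h.sec t v = v) (t : ℝ) (ht : t ≠ 0) :
    h.sec t (D.1.2 (S + T) v) = t ^ (w - S.card - 1) • D.1.2 (S + T) v := by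
  rw [(hD t ht _).2, h.map_fn_args D.2.2.1.smul t hS hT, hv, LinearMap.smul_apply, smul_smul,
    ← zpow_natCast, ← zpow_add₀ ht]
  congr 2
  push_cast [Multiset.card_add]; ring

end Dilation

variable {M : Type*} [TopologicalSpace M]

/-- Elements of `A` and `Γ` are functions on the total space of a family of vector spaces `B x`,
`x ∈ M`, and sections of the pull-back of a family `W x`, `x ∈ M`. Both can be glued from local
pieces. -/
structure Realization (h : Dilation A Γ) (B W : M → Type*) [∀ x, AddCommGroup (B x)]
    [∀ x, Module ℝ (B x)] [∀ x, AddCommGroup (W x)] [∀ x, Module ℝ (W x)] where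
  /-- evaluation of functions -/
  ev : ∀ x, B x → A →ₐ[ℝ] ℝ
  /-- evaluation of sections -/
  evS : ∀ x, B x → Γ →ₗ[ℝ] W x
  evS_smul : ∀ x b a v, evS x b (a • v) = ev x b a • evS x b v
  ev_fn : ∀ x b t a, ev x b (h.fn t a) = ev x (t • b) a
  evS_sec : ∀ x b t v, evS x b (h.sec t v) = evS x (t • b) v
  ext : ∀ a a', (∀ x b, ev x b a = ev x b a') → a = a'
  extS : ∀ v v', (∀ x b, evS x b v = evS x b v') → v = v'
  glue : ∀ a : M → A, (∀ x₀, ∀ᶠ x in nhds x₀, ∀ b, ev x b (a x) = ev x b (a x₀)) →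
    ∃ a', ∀ x b, ev x b a' = ev x b (a x)
  glueS : ∀ v : M → Γ, (∀ x₀, ∀ᶠ x in nhds x₀, ∀ b, evS x b (v x) = evS x b (v x₀)) →
    ∃ v', ∀ x b, evS x b v' = evS x b (v x)

/-- Symmetric multilinear maps that are derivations at a point in each argument. -/
structure IsMultiDerAt {N : Type*} [AddCommGroup N] [Module ℝ N] (e : A →ₐ[ℝ] ℝ)
    (G : Multiset A → N) : Prop where
  add : ∀ S a b, G ((a + b) ::ₘ S) = G (a ::ₘ S) + G (b ::ₘ S)
  smul : ∀ S (c : ℝ) a, G ((c • a) ::ₘ S) = c • G (a ::ₘ S)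
  mul : ∀ S a b, G ((a * b) ::ₘ S) = e a • G (b ::ₘ S) + e b • G (a ::ₘ S)

/-- Derivations at a point vanish on the square of the ideal of functions vanishing there. -/
theorem pointDer_sq {N : Type*} [AddCommGroup N] [Module ℝ N] {e : A →ₐ[ℝ] ℝ} {δ : A →ₗ[ℝ] N}
    (hδ : ∀ a b, δ (a * b) = e a • δ b + e b • δ a) {f : A} (hf : f ∈ (RingHom.ker e) ^ 2) :
    δ f = 0 := by
  rw [pow_two] at hf
  induction hf using Submodule.mul_induction_on' with
  | mem_mul_mem a ha b hb => rw [hδ, (RingHom.mem_ker).1 ha, (RingHom.mem_ker).1 hb]; simp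
  | add a _ b _ iha ihb => rw [map_add, iha, ihb, add_zero]

theorem pointDer_algebraMap {N : Type*} [AddCommGroup N] [Module ℝ N] {e : A →ₐ[ℝ] ℝ}
    {δ : A →ₗ[ℝ] N} (hδ : ∀ a b, δ (a * b) = e a • δ b + e b • δ a) (r : ℝ) :
    δ (algebraMap ℝ A r) = 0 := by
  have h := hδ 1 1
  rw [mul_one, map_one e, one_smul, left_eq_add] at h
  rw [Algebra.algebraMap_eq_smul_one, map_smul, h, smul_zero]

variable {h : Dilation A Γ} {B W : M → Type*} [∀ x, AddCommGroup (B x)]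
    [∀ x, Module ℝ (B x)] [∀ x, AddCommGroup (W x)] [∀ x, Module ℝ (W x)]

/-- A local frame over an open set `U`: cut-offs of coordinates on `U` and on the fibres, with the
corresponding partial derivatives, and of a frame of the second family of vector spaces. -/
structure Frame (R : Realization h B W) (U : Set M) (ι κ l : Type*) [Fintype ι] [Fintype κ]
    [Fintype l] [DecidableEq ι] [DecidableEq κ] [DecidableEq l] where
  /-- a bump function whose support is over `U` -/
  bump : A
  /-- a bump function equal to one over `U` -/
  cut : A
  bump_mem : bump ∈ h.homFn 0
  cut_mem : cut ∈ h.homFn 0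
  -- As `bump` is nonzero exactly over `U`, identities over `U` become global after multiplication
  -- by it, and it can be cancelled at points over `U`.
  bump_ne : ∀ x b, R.ev x b bump ≠ 0 ↔ x ∈ U
  cut_eq : ∀ x ∈ U, ∀ b, R.ev x b cut = 1
  /-- base coordinates -/
  crd : ι → A
  crd_mem : ∀ i, crd i ∈ h.homFn 0
  /-- fibre coordinates -/
  fib : κ → A
  fib_mem : ∀ c, fib c ∈ h.homFn 1
  /-- derivatives in base directions -/
  dcrd : ι → Derivation ℝ A A
  dcrd_hom : ∀ i t a, t ≠ 0 → h.fn t (dcrd i a) = dcrd i (h.fn t a)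
  /-- derivatives in fibre directions -/
  dfib : κ → Derivation ℝ A A
  dfib_hom : ∀ c t a, t ≠ 0 → h.fn t (dfib c a) = t⁻¹ • dfib c (h.fn t a)
  /-- frame of sections -/
  sec : l → Γ
  sec_hom : ∀ α t, h.sec t (sec α) = sec α
  /-- coefficients of sections with respect to the frame -/
  coeff : l → Γ →ₗ[A] A
  coeff_hom : ∀ α t v, coeff α (h.sec t v) = h.fn t (coeff α v)
  coeff_zero : ∀ α v x b, R.evS x b v = 0 → R.ev x b (coeff α v) = 0
  -- Coefficients and frame sections are defined globally by cutting them off, so the expansion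
  -- holds globally only up to `cut`, which is one over `U`.
  expand : ∀ v, cut • v = ∑ α, coeff α v • sec α
  coeff_sec : ∀ α β, ∀ x ∈ U, ∀ b, R.ev x b (coeff α (sec β)) = if α = β then 1 else 0
  dcrd_crd : ∀ i j, ∀ x ∈ U, ∀ b, R.ev x b (dcrd i (crd j)) = if i = j then 1 else 0
  dcrd_fib : ∀ i c, ∀ x ∈ U, ∀ b, R.ev x b (dcrd i (fib c)) = 0
  dfib_crd : ∀ c i, ∀ x ∈ U, ∀ b, R.ev x b (dfib c (crd i)) = 0
  dfib_fib : ∀ c d, ∀ x ∈ U, ∀ b, R.ev x b (dfib c (fib d)) = if c = d then 1 else 0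
  -- The remainder of the first-order Taylor expansion, in the form in which derivations at the
  -- point annihilate it (`pointDer_sq`).
  hadamard : ∀ f, ∀ x ∈ U, ∀ b, f - algebraMap ℝ A (R.ev x b f) -
    ∑ i, R.ev x b (dcrd i f) • (crd i - algebraMap ℝ A (R.ev x b (crd i))) -
    ∑ c, R.ev x b (dfib c f) • (fib c - algebraMap ℝ A (R.ev x b (fib c))) ∈
      (RingHom.ker (R.ev x b)) ^ 2
  euler : ∀ (k : ℕ), ∀ f ∈ h.homFn k, ∀ x ∈ U, ∀ b,
    ∑ c, R.ev x b (dfib c f) * R.ev x b (fib c) = k * R.ev x b f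

namespace Realization
variable (R : Realization h B W)

theorem ev_homFn_zero {a : A} (ha : a ∈ h.homFn 0) (x : M) (b : B x) :
    R.ev x b a = R.ev x 0 a := by
  conv_lhs => rw [← h.fn_homFn_zero ha 0, R.ev_fn, zero_smul]

theorem mul_ext {a a' : A} (U : Set M) (r : A) (hr : ∀ x ∉ U, ∀ b, R.ev x b r = 0)
    (ha : ∀ x ∈ U, ∀ b, R.ev x b a = R.ev x b a') : r * a = r * a' :=
  R.ext _ _ fun x b => by
    rw [map_mul, map_mul]
    by_cases hx : x ∈ U
    · rw [ha x hx b]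
    · rw [hr x hx b, zero_mul, zero_mul]

theorem isMultiDerAt_fst {L : Multiset A → A} (hL : IsMultiDer L) (x : M) (b : B x) :
    IsMultiDerAt (R.ev x b) fun S => R.ev x b (L S) where
  add S a b := by rw [hL.add, map_add]
  smul S a b := by rw [hL.smul, map_smul]
  mul S a b := by rw [hL.mul, map_add, smul_eq_mul, smul_eq_mul, map_mul, map_mul, smul_eq_mul, smul_eq_mul]

theorem isMultiDerAt_snd {P : Multiset A → Module.End ℝ Γ} (hP : IsMultiDer P) (v : Γ) (x : M)
    (b : B x) : IsMultiDerAt (R.ev x b) fun S => R.evS x b (P S v) where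
  add S a b := by rw [hP.add, LinearMap.add_apply, map_add]
  smul S a b := by rw [hP.smul, LinearMap.smul_apply, map_smul]
  mul S a b := by
    rw [hP.mul, LinearMap.add_apply, map_add, LinearMap.smul_apply, LinearMap.smul_apply,
      R.evS_smul, R.evS_smul]

/-- Two multivectors agree over the point `x`. -/
def AgreeAt (x : M) (D E : SymMult A Γ) : Prop :=
  (∀ S b, R.ev x b (D.1.1 S) = R.ev x b (E.1.1 S)) ∧
    ∀ S v b, R.evS x b (D.1.2 S v) = R.evS x b (E.1.2 S v)

theorem agreeAt_ext {D E : SymMult A Γ} (hDE : ∀ x, R.AgreeAt x D E) : D = E :=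
  SymMult.ext_iff'.2 ⟨fun S => R.ext _ _ fun x b => (hDE x).1 S b,
    fun S v => R.extS _ _ fun x b => (hDE x).2 S v b⟩

/-- Multivectors of a given degree and weight can be glued from local pieces. -/
theorem glueMult (D : M → SymMult A Γ) (hD : ∀ x₀, ∀ᶠ x in nhds x₀, R.AgreeAt x (D x) (D x₀))
    {m w : ℤ} (hm : ∀ x, D x ∈ SymMult.zdegree m) (hw : ∀ x, D x ∈ h.weight w) :
    ∃ D' : SymMult A Γ, D' ∈ SymMult.zdegree m ∧ D' ∈ h.weight w ∧ ∀ x, R.AgreeAt x D' (D x) := by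
  -- For each fixed tuple of arguments the values are glued separately; the algebraic identities and
  -- the weight are then checked at points.
  have hL : ∀ S, ∃ a', ∀ x b, R.ev x b a' = R.ev x b ((D x).1.1 S) := fun S =>
    R.glue (fun x => (D x).1.1 S) fun x₀ => (hD x₀).mono fun x hx b => hx.1 S b
  have hP : ∀ S v, ∃ v', ∀ x b, R.evS x b v' = R.evS x b ((D x).1.2 S v) := fun S v =>
    R.glueS (fun x => (D x).1.2 S v) fun x₀ => (hD x₀).mono fun x hx b => hx.2 S v b
  choose L hL using hL
  choose P hP using hP
  let P' : Multiset A → Module.End ℝ Γ := fun S =>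
    { toFun := P S
      map_add' := fun v v' => R.extS _ _ fun x b => by rw [hP, map_add, map_add, map_add, hP, hP]
      map_smul' := fun r v => R.extS _ _ fun x b => by
        rw [hP, map_smul, map_smul, RingHom.id_apply, map_smul, hP] }
  have hP' : ∀ S v x b, R.evS x b (P' S v) = R.evS x b ((D x).1.2 S v) := hP
  have hLm : ∀ S : Multiset A, (S.card : ℤ) ≠ m → L S = 0 := fun S hS => R.ext _ _ fun x b => by
    rw [hL, (hm x S).1 hS]
  have hPm : ∀ S : Multiset A, (S.card : ℤ) + 1 ≠ m → P' S = 0 := fun S hS =>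
    LinearMap.ext fun v => R.extS _ _ fun x b => by rw [hP', (hm x S).2 hS]
  -- The common degree `m` supplies a vanishing bound that is uniform in the point; the bounds of
  -- arbitrary local pieces need not have a common one.
  refine ⟨⟨(L, P'), ⟨?_, ?_, ?_, m.natAbs + 1, fun S hS => hLm S (by omega)⟩,
    ⟨?_, ?_, ?_, m.natAbs + 1, fun S hS => hPm S (by omega)⟩, ?_⟩,
    fun S => ⟨hLm S, hPm S⟩, fun t ht S => ⟨?_, fun v => ?_⟩, fun x =>
      ⟨fun S b => hL S x b, fun S v b => hP S v x b⟩⟩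
  · exact fun S a a' => R.ext _ _ fun x b => by rw [map_add, hL, hL, hL, (D x).2.1.add, map_add]
  · exact fun S r a => R.ext _ _ fun x b => by rw [map_smul, hL, hL, (D x).2.1.smul, map_smul]
  · exact fun S a a' => R.ext _ _ fun x b => by
      rw [hL, (D x).2.1.mul]; simp only [smul_eq_mul, map_add, map_mul, hL]
  · exact fun S a a' => LinearMap.ext fun v => R.extS _ _ fun x b => by
      rw [LinearMap.add_apply, map_add, hP', hP', hP', (D x).2.2.1.add, LinearMap.add_apply, map_add]
  · exact fun S r a => LinearMap.ext fun v => R.extS _ _ fun x b => by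
      rw [LinearMap.smul_apply, map_smul, hP', hP', (D x).2.2.1.smul, LinearMap.smul_apply, map_smul]
  · exact fun S a a' => LinearMap.ext fun v => R.extS _ _ fun x b => by
      rw [hP', (D x).2.2.1.mul]
      simp only [LinearMap.add_apply, LinearMap.smul_apply, map_add, R.evS_smul, hP']
  · exact fun S a v => R.extS _ _ fun x b => by
      rw [hP', SymMult.op_smul]; simp only [map_add, R.evS_smul, hP', hL]
  · refine R.ext _ _ fun x b => ?_
    rw [R.ev_fn, map_smul, hL, hL, ← R.ev_fn, (hw x t ht S).1, map_smul]
  · refine R.extS _ _ fun x b => ?_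
    rw [R.evS_sec, map_smul, hP', hP', ← R.evS_sec, (hw x t ht S).2, map_smul]

/-- Two derivations agree over the point `x`. -/
def AgreeDerAt (x : M) (T T' : ModDer A Γ) : Prop :=
  (∀ a b, R.ev x b (ModDer.symbol T a) = R.ev x b (ModDer.symbol T' a)) ∧
    ∀ v b, R.evS x b (ModDer.op T v) = R.evS x b (ModDer.op T' v)

theorem agreeDerAt_ext {D E : ModDer A Γ} (hDE : ∀ x, R.AgreeDerAt x D E) : D = E :=
  ModDer.ext (fun S => R.ext _ _ fun x b => (hDE x).1 S b)
    (fun v => R.extS _ _ fun x b => (hDE x).2 v b)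

/-- Homogeneous derivations can be glued from local pieces. -/
theorem glueDer (D : M → ModDer A Γ) (hD : ∀ x₀, ∀ᶠ x in nhds x₀, R.AgreeDerAt x (D x) (D x₀))
    {m : ℤ} (hm : ∀ x, D x ∈ h.homDer m) :
    ∃ D' : ModDer A Γ, D' ∈ h.homDer m ∧ ∀ x, R.AgreeDerAt x D' (D x) := by
  have hL : ∀ S, ∃ a', ∀ x b, R.ev x b a' = R.ev x b (ModDer.symbol (D x) S) := fun S =>
    R.glue (fun x => ModDer.symbol (D x) S) fun x₀ => (hD x₀).mono fun x hx b => hx.1 S b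
  have hP : ∀ v, ∃ v', ∀ x b, R.evS x b v' = R.evS x b (ModDer.op (D x) v) := fun v =>
    R.glueS (fun x => ModDer.op (D x) v) fun x₀ => (hD x₀).mono fun x hx b => hx.2 v b
  choose L hL using hL
  choose P hP using hP
  let L' : Derivation ℝ A A := Derivation.mk'
    { toFun := L
      map_add' := fun v v' => R.ext _ _ fun x b => by rw [hL, map_add, map_add, map_add, hL, hL]
      map_smul' := fun r v => R.ext _ _ fun x b => by
        rw [hL, Derivation.map_smul, map_smul, RingHom.id_apply, map_smul, hL] }
    fun a a' => R.ext _ _ fun x b => by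
      simp only [LinearMap.coe_mk, AddHom.coe_mk, smul_eq_mul, map_add, map_mul, hL,
        Derivation.leibniz]
  let P' : Module.End ℝ Γ :=
    { toFun := P
      map_add' := fun v v' => R.extS _ _ fun x b => by rw [hP, map_add, map_add, map_add, hP, hP]
      map_smul' := fun r v => R.extS _ _ fun x b => by
        rw [hP, map_smul, map_smul, RingHom.id_apply, map_smul, hP] }
  have hP' : ∀ v x b, R.evS x b (P' v) = R.evS x b (ModDer.op (D x) v) := hP
  have hL' : ∀ v x b, R.ev x b (L' v) = R.ev x b (ModDer.symbol (D x) v) := hL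
  refine ⟨⟨(L', P'), fun a v => ?_⟩, fun t ht => ⟨fun a => ?_, fun v => ?_⟩, fun x =>
    ⟨fun a b => hL a x b, fun v b => hP v x b⟩⟩
  · refine R.extS _ _ fun x b => ?_
    simp only [hP', ModDer.op_smul, map_add, R.evS_smul, hL']
  · refine R.ext _ _ fun x b => ?_
    change R.ev x b (h.fn t (L' a)) = R.ev x b (_ • L' (h.fn t a))
    rw [R.ev_fn, map_smul, hL', hL', ← R.ev_fn, (hm x t ht).1, map_smul]
  · refine R.extS _ _ fun x b => ?_
    change R.evS x b (h.sec t (P' v)) = R.evS x b (_ • P' (h.sec t v))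
    rw [R.evS_sec, map_smul, hP', hP', ← R.evS_sec, (hm x t ht).2, map_smul]

end Realization

end OneSide
end
end FWL

namespace FWL
noncomputable section

/-! ### Locality, expansion in a frame, and the elementary multivectors and derivations -/

section OneSide
variable {A Γ : Type*} [CommRing A] [Algebra ℝ A] [AddCommGroup Γ] [Module ℝ Γ] [Module A Γ]
  [IsScalarTower ℝ A Γ]

namespace IsMultiDerAt
variable {N : Type*} [AddCommGroup N] [Module ℝ N] {e : A →ₐ[ℝ] ℝ} {G : Multiset A → N}

/-- The derivation obtained by fixing all arguments but one. -/
def toDer (hG : IsMultiDerAt e G) (S : Multiset A) : A →ₗ[ℝ] N where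
  toFun a := G (a ::ₘ S)
  map_add' := hG.add S
  map_smul' := hG.smul S

end IsMultiDerAt

variable {M : Type*} [TopologicalSpace M]
variable {h : Dilation A Γ} {B W : M → Type*} [∀ x, AddCommGroup (B x)]
    [∀ x, Module ℝ (B x)] [∀ x, AddCommGroup (W x)] [∀ x, Module ℝ (W x)]
variable {R : Realization h B W} {U : Set M} {ι κ l : Type*} [Fintype ι] [Fintype κ]
    [Fintype l] [DecidableEq ι] [DecidableEq κ] [DecidableEq l]

namespace Frame
variable (fr : Frame R U ι κ l)

theorem bump_eq_zero {x : M} (hx : x ∉ U) (b : B x) : R.ev x b fr.bump = 0 := by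
  by_contra h
  exact hx ((fr.bump_ne x b).1 h)

section PointDer
variable {N : Type*} [AddCommGroup N] [Module ℝ N] {x : M} {b : B x} {δ : A →ₗ[ℝ] N}

/-- `bump * f` is identically zero, and `δ` maps it to the multiple of `δ f` by the nonzero value of
`bump` at the point. -/
theorem pointDer_local (fr : Frame R U ι κ l) (hδ : ∀ a a', δ (a * a') = R.ev x b a • δ a' + R.ev x b a' • δ a)
    (hx : x ∈ U) {f : A} (hf : ∀ x ∈ U, ∀ b, R.ev x b f = 0) : δ f = 0 := by
  have h0 : fr.bump * f = 0 := by
    rw [← mul_zero fr.bump]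
    exact R.mul_ext U _ (fun x hx b => fr.bump_eq_zero hx b) fun x hx b => by
      rw [hf x hx b, map_zero]
  have h1 := hδ fr.bump f
  rw [h0, map_zero δ, hf x hx b, zero_smul, add_zero] at h1
  exact (smul_eq_zero.1 h1.symm).resolve_left ((fr.bump_ne x b).2 hx)

theorem pointDer_congr (fr : Frame R U ι κ l) (hδ : ∀ a a', δ (a * a') = R.ev x b a • δ a' + R.ev x b a' • δ a)
    (hx : x ∈ U) {f g : A} (hf : ∀ x ∈ U, ∀ b, R.ev x b f = R.ev x b g) : δ f = δ g := by
  rw [← sub_eq_zero, ← map_sub]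
  exact fr.pointDer_local hδ hx fun x hx b => by rw [map_sub, hf x hx b, sub_self]

theorem pointDer_const (fr : Frame R U ι κ l) (hδ : ∀ a a', δ (a * a') = R.ev x b a • δ a' + R.ev x b a' • δ a)
    (hx : x ∈ U) {f : A} (r : ℝ) (hf : ∀ x ∈ U, ∀ b, R.ev x b f = r) : δ f = 0 := by
  rw [fr.pointDer_congr hδ hx (g := algebraMap ℝ A r) fun x hx b => by
    rw [hf x hx b]; exact ((R.ev x b).commutes r).symm]
  exact pointDer_algebraMap hδ r

/-- `δ` annihilates constants and, by `pointDer_sq`, the Taylor remainder of `hadamard`. -/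
theorem pointDer_expand (hδ : ∀ a a', δ (a * a') = R.ev x b a • δ a' + R.ev x b a' • δ a)
    (hx : x ∈ U) (f : A) : δ f = ∑ i, R.ev x b (fr.dcrd i f) • δ (fr.crd i) +
      ∑ c, R.ev x b (fr.dfib c f) • δ (fr.fib c) := by
  have h1 := pointDer_sq hδ (fr.hadamard f x hx b)
  simp only [map_sub, map_sum, map_smul, pointDer_algebraMap hδ, sub_zero] at h1
  rw [sub_sub, sub_eq_zero] at h1
  exact h1

end PointDer

section Multi
variable {N : Type*} [AddCommGroup N] [Module ℝ N] {x : M} {b : B x} {G : Multiset A → N}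

theorem multi_congr (fr : Frame R U ι κ l) (hG : IsMultiDerAt (R.ev x b) G) (hx : x ∈ U) {f g : A} (S : Multiset A)
    (hf : ∀ x ∈ U, ∀ b, R.ev x b f = R.ev x b g) : G (f ::ₘ S) = G (g ::ₘ S) :=
  fr.pointDer_congr (δ := hG.toDer S) (hG.mul S) hx hf

theorem multi_const (fr : Frame R U ι κ l) (hG : IsMultiDerAt (R.ev x b) G) (hx : x ∈ U) {f : A} (S : Multiset A) (r : ℝ)
    (hf : ∀ x ∈ U, ∀ b, R.ev x b f = r) : G (f ::ₘ S) = 0 :=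
  fr.pointDer_const (δ := hG.toDer S) (hG.mul S) hx r hf

theorem multi_expand (hG : IsMultiDerAt (R.ev x b) G) (hx : x ∈ U) (f : A) (S : Multiset A) :
    G (f ::ₘ S) = ∑ i, R.ev x b (fr.dcrd i f) • G (fr.crd i ::ₘ S) +
      ∑ c, R.ev x b (fr.dfib c f) • G (fr.fib c ::ₘ S) :=
  fr.pointDer_expand (δ := hG.toDer S) (hG.mul S) hx f

/-- A multiderivation vanishes at a point if it does on the coordinate functions. -/
theorem multi_vanish (hG : IsMultiDerAt (R.ev x b) G) (hx : x ∈ U)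
    (h0 : ∀ (X : Multiset ι) (Y : Multiset κ), G (X.map fr.crd + Y.map fr.fib) = 0)
    (S : Multiset A) : G S = 0 := by
  -- The arguments are peeled off one at a time and expanded in coordinate functions, which
  -- accumulate in `X` and `Y`.
  have key : ∀ (S : Multiset A) (X : Multiset ι) (Y : Multiset κ),
      G (S + (X.map fr.crd + Y.map fr.fib)) = 0 := by
    intro S
    induction S using Multiset.induction_on with
    | empty => intro X Y; rw [zero_add]; exact h0 X Y
    | cons f S ih =>
      intro X Y
      rw [Multiset.cons_add, fr.multi_expand hG hx,
        Finset.sum_eq_zero, Finset.sum_eq_zero, add_zero]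
      · intro c _
        have := ih X (c ::ₘ Y)
        rw [Multiset.map_cons, Multiset.add_cons, Multiset.add_cons] at this
        rw [this, smul_zero]
      · intro i _
        have := ih (i ::ₘ X) Y
        rw [Multiset.map_cons, Multiset.cons_add, Multiset.add_cons] at this
        rw [this, smul_zero]
  simpa using key S 0 0

end Multi

theorem ev_sec_expand {x : M} (hx : x ∈ U) (b : B x) (v : Γ) :
    R.evS x b v = ∑ α, R.ev x b (fr.coeff α v) • R.evS x b (fr.sec α) := by
  have := congrArg (R.evS x b) (fr.expand v)
  rw [R.evS_smul, fr.cut_eq x hx, one_smul, map_sum] at this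
  simpa only [R.evS_smul] using this

/-- The argument of `pointDer_local` for sections: `bump • v = 0`, and the symbol term of `P (bump •
v)` is a multiple of `v`, which vanishes at the point. -/
theorem evS_op_local (fr : Frame R U ι κ l) {x : M} (hx : x ∈ U) (b : B x) (P : Module.End ℝ Γ) (L : A → A)
    (hP : ∀ a v, P (a • v) = a • P v + L a • v) {v : Γ} (hv : ∀ x ∈ U, ∀ b, R.evS x b v = 0) :
    R.evS x b (P v) = 0 := by
  have h0 : fr.bump • v = 0 := R.extS _ _ fun x b => by
    rw [R.evS_smul, map_zero]
    by_cases hx : x ∈ U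
    · rw [hv x hx b, smul_zero]
    · rw [fr.bump_eq_zero hx, zero_smul]
  have h1 := congrArg (R.evS x b) (hP fr.bump v)
  rw [h0, map_zero, map_zero, map_add, R.evS_smul, R.evS_smul, hv x hx b, smul_zero,
    add_zero] at h1
  exact (smul_eq_zero.1 h1.symm).resolve_left ((fr.bump_ne x b).2 hx)

/-- `v` agrees over `U` with its expansion in the frame, and by locality `P` may be applied to the
latter. -/
theorem evS_op_expand {x : M} (hx : x ∈ U) (b : B x) (P : Module.End ℝ Γ) (L : A → A)
    (hP : ∀ a v, P (a • v) = a • P v + L a • v) (v : Γ) :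
    R.evS x b (P v) = ∑ α, (R.ev x b (fr.coeff α v) • R.evS x b (P (fr.sec α)) +
      R.ev x b (L (fr.coeff α v)) • R.evS x b (fr.sec α)) := by
  have h0 := fr.evS_op_local hx b P L hP (v := v - ∑ α, fr.coeff α v • fr.sec α) fun x hx b => by
    rw [map_sub, fr.ev_sec_expand hx b v, map_sum, sub_eq_zero]
    simp only [R.evS_smul]
  rw [map_sub, map_sub, sub_eq_zero] at h0
  rw [h0, map_sum, map_sum]
  simp only [hP, map_add, R.evS_smul]

theorem evS_snd_expand {x : M} (hx : x ∈ U) (b : B x) (D : SymMult A Γ) (S : Multiset A) (v : Γ) :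
    R.evS x b (D.1.2 S v) = ∑ α, (R.ev x b (fr.coeff α v) • R.evS x b (D.1.2 S (fr.sec α)) +
      R.ev x b (D.1.1 (fr.coeff α v ::ₘ S)) • R.evS x b (fr.sec α)) :=
  fr.evS_op_expand hx b _ (fun a => D.1.1 (a ::ₘ S)) (SymMult.op_smul D S) v

/-- Over `U`, a section that is homogeneous of negative degree vanishes. -/
theorem evS_neg (fr : Frame R U ι κ l) {x : M} (hx : x ∈ U) (b : B x) {m : ℤ} (hm : m < 0) {v : Γ}
    (hv : ∀ t : ℝ, t ≠ 0 → h.sec t v = t ^ m • v) : R.evS x b v = 0 := by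
  rw [fr.ev_sec_expand hx b v]
  refine Finset.sum_eq_zero fun α _ => ?_
  have : fr.coeff α v ∈ h.zhom m := fun t ht => by
    rw [← fr.coeff_hom, hv t ht]
    exact map_smul ((fr.coeff α).restrictScalars ℝ) _ _
  rw [h.zhom_neg hm this, map_zero, zero_smul]

theorem crd_map_mem (X : Multiset ι) : ∀ a ∈ X.map fr.crd, a ∈ h.homFn 0 := by
  intro a ha
  obtain ⟨i, _, rfl⟩ := Multiset.mem_map.1 ha
  exact fr.crd_mem i

theorem fib_map_mem (Y : Multiset κ) : ∀ a ∈ Y.map fr.fib, a ∈ h.homFn 1 := by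
  intro a ha
  obtain ⟨i, _, rfl⟩ := Multiset.mem_map.1 ha
  exact fr.fib_mem i

/-- Agreement over a point can be checked on coordinates. -/
theorem vanish_of {x : M} (hx : x ∈ U) (D : SymMult A Γ)
    (h1 : ∀ (X : Multiset ι) (Y : Multiset κ) b, R.ev x b (D.1.1 (X.map fr.crd + Y.map fr.fib)) = 0)
    (h2 : ∀ (X : Multiset ι) (Y : Multiset κ) α b,
      R.evS x b (D.1.2 (X.map fr.crd + Y.map fr.fib) (fr.sec α)) = 0) : R.AgreeAt x D 0 := by
  have e1 : ∀ S b, R.ev x b (D.1.1 S) = 0 := fun S b =>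
    fr.multi_vanish (R.isMultiDerAt_fst D.2.1 x b) hx (fun X Y => h1 X Y b) S
  have e2 : ∀ S α b, R.evS x b (D.1.2 S (fr.sec α)) = 0 := fun S α b =>
    fr.multi_vanish (R.isMultiDerAt_snd D.2.2.1 (fr.sec α) x b) hx (fun X Y => h2 X Y α b) S
  refine ⟨fun S b => (e1 S b).trans (map_zero _).symm, fun S v b => ?_⟩
  rw [fr.evS_snd_expand hx b D S v]
  simp only [e1, e2, smul_zero, zero_smul, add_zero, Finset.sum_const_zero]
  exact (map_zero _).symm

/-- A multivector of weight at most `0` vanishes at a point over `U` if its symbol does. -/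
theorem vanish_of_symbol {x : M} (hx : x ∈ U) {w : ℤ} (hw : w ≤ 0) {D : SymMult A Γ}
    (hD : D ∈ h.weight w)
    (h1 : ∀ Y : Multiset κ, ∀ b, R.ev x b (D.1.1 (Y.map fr.fib)) = 0) : R.AgreeAt x D 0 := by
  -- Every base coordinate among the arguments lowers the degree by one, and so does the section.
  -- With `w ≤ 0` this leaves only the symbol on fibre coordinates.
  refine fr.vanish_of hx D (fun X Y b => ?_) (fun X Y α b => ?_)
  · by_cases hX : X = 0
    · rw [hX, Multiset.map_zero, zero_add]; exact h1 Y b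
    · rw [h.zhom_neg (m := w - (X.map fr.crd).card) (by
        rw [Multiset.card_map]
        have := Multiset.card_pos.2 hX
        omega) (h.weight_fst hD (fr.crd_map_mem X) (fr.fib_map_mem Y)), map_zero]
  · refine fr.evS_neg hx b (m := w - (X.map fr.crd).card - 1) (by omega)
      (h.weight_snd hD (fr.crd_map_mem X) (fr.fib_map_mem Y) (fr.sec_hom α))

/-! ### Lifts of multiderivations -/

/-- The multivector with a given symbol that is flat with respect to the frame. -/
def lift (L : Multiset A → A) (hL : IsMultiDer L) : SymMult A Γ :=
  ⟨(fun S => fr.cut * L S, fun S =>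
    { toFun := fun v => ∑ α, L (fr.coeff α v ::ₘ S) • fr.sec α
      map_add' := fun v v' => by
        simp only [map_add, hL.add, add_smul, Finset.sum_add_distrib]
      map_smul' := fun r v => by
        have : ∀ α, fr.coeff α (r • v) = r • fr.coeff α v := fun α =>
          map_smul ((fr.coeff α).restrictScalars ℝ) r v
        simp only [this, hL.smul, smul_assoc, Finset.smul_sum, RingHom.id_apply] }), by
    obtain ⟨a1, a2, a3, n, a4⟩ := hL
    refine ⟨⟨?_, ?_, ?_, n, ?_⟩, ⟨?_, ?_, ?_, n, ?_⟩, ?_⟩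
    · intro S a b; simp only [a1]; ring
    · intro S r a; simp only [a2, mul_smul_comm]
    · intro S a b; simp only [a3, smul_eq_mul]; ring
    · intro S hS; simp only [a4 S hS, mul_zero]
    · intro S a b; ext v
      simp only [LinearMap.coe_mk, AddHom.coe_mk, LinearMap.add_apply, Multiset.cons_swap _ (a + b),
        Multiset.cons_swap _ a, Multiset.cons_swap _ b, a1, add_smul, Finset.sum_add_distrib]
    · intro S r a; ext v
      simp only [LinearMap.coe_mk, AddHom.coe_mk, LinearMap.smul_apply, Multiset.cons_swap _ (r • a),
        Multiset.cons_swap _ a, a2, smul_assoc, Finset.smul_sum]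
    · intro S a b; ext v
      simp only [LinearMap.coe_mk, AddHom.coe_mk, LinearMap.add_apply, LinearMap.smul_apply,
        Multiset.cons_swap _ (a * b), Multiset.cons_swap _ a, Multiset.cons_swap _ b, a3, add_smul,
        Finset.sum_add_distrib, Finset.smul_sum, smul_eq_mul, mul_smul]
    · intro S hS; ext v
      simp only [LinearMap.coe_mk, AddHom.coe_mk, LinearMap.zero_apply]
      exact Finset.sum_eq_zero fun α _ => by rw [a4 _ (by rw [Multiset.card_cons]; omega), zero_smul]
    -- The terms in which `a` is differentiated add up to `L(a, …) • ∑ coeff α v • sec α`, which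
    -- `expand` turns into `(cut * L(a, …)) • v`; hence the factor `cut` in the symbol.
    · intro S a v
      simp only [LinearMap.coe_mk, AddHom.coe_mk, map_smul, smul_eq_mul, a3, add_smul,
        Finset.sum_add_distrib]
      rw [mul_comm fr.cut, mul_smul, fr.expand, Finset.smul_sum, Finset.smul_sum]
      simp only [mul_smul]
      congr 1
      exact Finset.sum_congr rfl fun α _ => smul_comm _ _ _⟩

theorem lift_fst (L : Multiset A → A) (hL : IsMultiDer L) (S : Multiset A) :
    (fr.lift L hL).1.1 S = fr.cut * L S := rfl

theorem lift_snd (L : Multiset A → A) (hL : IsMultiDer L) (S : Multiset A) (v : Γ) :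
    (fr.lift L hL).1.2 S v = ∑ α, L (fr.coeff α v ::ₘ S) • fr.sec α := rfl

theorem ev_lift (L : Multiset A → A) (hL : IsMultiDer L) (S : Multiset A) {x : M} (hx : x ∈ U)
    (b : B x) : R.ev x b ((fr.lift L hL).1.1 S) = R.ev x b (L S) := by
  rw [lift_fst, map_mul, fr.cut_eq x hx, one_mul]

/-- Flatness of the lift: over `U` the coefficients of a frame section are constants, which a
multiderivation annihilates. -/
theorem evS_lift_sec (L : Multiset A → A) (hL : IsMultiDer L) (S : Multiset A) {x : M} (hx : x ∈ U)
    (b : B x) (β : l) : R.evS x b ((fr.lift L hL).1.2 S (fr.sec β)) = 0 := by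
  rw [lift_snd, map_sum]
  refine Finset.sum_eq_zero fun α _ => ?_
  rw [R.evS_smul, fr.multi_const (R.isMultiDerAt_fst hL x b) hx S _ (fr.coeff_sec α β), zero_smul]

theorem lift_mem_zdegree (L : Multiset A → A) (hL : IsMultiDer L) {m : ℤ}
    (hm : ∀ S : Multiset A, (S.card : ℤ) ≠ m → L S = 0) : fr.lift L hL ∈ SymMult.zdegree m := by
  refine fun S => ⟨fun hS => by rw [lift_fst, hm S hS, mul_zero], fun hS => ?_⟩
  ext v
  rw [lift_snd]
  exact Finset.sum_eq_zero fun α _ => by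
    rw [hm _ (by rw [Multiset.card_cons]; push_cast; exact hS), zero_smul]

theorem lift_mem_weight (L : Multiset A → A) (hL : IsMultiDer L) {w : ℤ}
    (hw : ∀ t : ℝ, t ≠ 0 → ∀ S : Multiset A, h.fn t (L S) = t ^ (w - S.card) • L (S.map (h.fn t))) :
    fr.lift L hL ∈ h.weight w := by
  refine fun t ht S => ⟨?_, fun v => ?_⟩
  · rw [lift_fst, lift_fst, map_mul, hw t ht, h.fn_homFn_zero fr.cut_mem, mul_smul_comm]
  · rw [lift_snd, lift_snd, map_sum, Finset.smul_sum]
    refine Finset.sum_congr rfl fun α _ => ?_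
    rw [h.sec_smul, hw t ht, fr.sec_hom, Multiset.card_cons, Multiset.map_cons, fr.coeff_hom,
      smul_assoc]
    push_cast
    rfl

end Frame

/-- The multiderivation of degree `1` defined by a derivation. -/
def derMult (X : Derivation ℝ A A) (S : Multiset A) : A := if S.card = 1 then (S.map X).sum else 0

/-- The sum in `derMult` merely reads off the element of a singleton. -/
theorem derMult_cons (X : Derivation ℝ A A) (a : A) (S : Multiset A) :
    derMult X (a ::ₘ S) = if S.card = 0 then X a else 0 := by
  rw [derMult, Multiset.card_cons]
  by_cases h : S.card = 0
  · rw [if_pos (by omega), if_pos h, Multiset.card_eq_zero.1 h]; simp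
  · rw [if_neg (by omega), if_neg h]

theorem isMultiDer_der (X : Derivation ℝ A A) : IsMultiDer (derMult X) := by
  refine ⟨fun S a b => ?_, fun S r a => ?_, fun S a b => ?_, 2, fun S hS => if_neg (by omega)⟩ <;>
    simp only [derMult_cons] <;> split_ifs <;> simp

namespace Frame
variable (fr : Frame R U ι κ l)

theorem der_weight (X : Derivation ℝ A A) {w : ℤ}
    (hX : ∀ t : ℝ, t ≠ 0 → ∀ a, h.fn t (X a) = t ^ (w - 1) • X (h.fn t a)) (t : ℝ) (ht : t ≠ 0)
    (S : Multiset A) : h.fn t (derMult X S) =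
      t ^ (w - S.card) • derMult X (S.map (h.fn t)) := by
  rw [derMult, derMult, Multiset.card_map]
  split_ifs with hS
  · obtain ⟨a, rfl⟩ := Multiset.card_eq_one.1 hS
    simpa using hX t ht a
  · rw [map_zero, smul_zero]

/-- Derivative in a fibre direction, as a core multivector of degree `1`. -/
def par (c : κ) : h.core := ⟨fr.lift _ (isMultiDer_der (fr.dfib c)),
  fr.lift_mem_weight _ (isMultiDer_der (fr.dfib c)) (der_weight (fr.dfib c) fun t ht a => by
    rw [fr.dfib_hom c t a ht, zero_sub, zpow_neg_one])⟩

/-- Derivative in a base direction, as a fibre-wise linear multivector of degree `1`. -/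
def nab (i : ι) : h.lin := ⟨fr.lift _ (isMultiDer_der (fr.dcrd i)),
  fr.lift_mem_weight _ (isMultiDer_der (fr.dcrd i)) (der_weight (fr.dcrd i) fun t ht a => by
    rw [fr.dcrd_hom i t a ht, sub_self, zpow_zero, one_smul])⟩

theorem par_mem (c : κ) : (fr.par c).1 ∈ SymMult.zdegree 1 :=
  fr.lift_mem_zdegree _ (isMultiDer_der (fr.dfib c)) fun S hS => if_neg (by exact_mod_cast hS)

theorem nab_mem (i : ι) : (fr.nab i).1 ∈ SymMult.zdegree 1 :=
  fr.lift_mem_zdegree _ (isMultiDer_der (fr.dcrd i)) fun S hS => if_neg (by exact_mod_cast hS)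

theorem coeff_rsmul (α : l) (r : ℝ) (v : Γ) : fr.coeff α (r • v) = r • fr.coeff α v :=
  map_smul ((fr.coeff α).restrictScalars ℝ) r v

/-- Elementary endomorphisms of the second bundle. -/
def matEnd (α β : l) : Module.End ℝ Γ where
  toFun v := fr.coeff β v • fr.sec α
  map_add' v w := by rw [map_add, add_smul]
  map_smul' r v := by rw [coeff_rsmul, smul_assoc]; rfl

/-- Elementary endomorphisms of the second bundle, as fibre-wise linear multivectors. -/
def mat (α β : l) : h.lin :=
  ⟨⟨(0, fun S => if S.card = 0 then fr.matEnd α β else 0), by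
    refine ⟨⟨by simp, by simp, by simp, 0, by simp⟩, ⟨by simp, by simp, by simp, 1, fun S hS =>
      if_neg (by omega)⟩, fun S a v => ?_⟩
    change (if S.card = 0 then fr.matEnd α β else 0) (a • v) =
      a • (if S.card = 0 then fr.matEnd α β else 0) v + (0 : A) • v
    split_ifs <;> simp [matEnd, mul_smul]⟩, fun t ht S => ⟨by simp, fun v => by
    change h.sec t ((if S.card = 0 then fr.matEnd α β else 0) v) = _ •
      ((if (S.map (h.fn t)).card = 0 then fr.matEnd α β else 0) (h.sec t v))
    rw [Multiset.card_map]
    split_ifs with hS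
    · simp [matEnd, hS, h.sec_smul, fr.sec_hom, fr.coeff_hom]
    · simp⟩⟩

theorem mat_fst (α β : l) (S : Multiset A) : (fr.mat α β).1.1.1 S = 0 := rfl
theorem mat_snd (α β : l) (S : Multiset A) (v : Γ) : (fr.mat α β).1.1.2 S v =
    if S.card = 0 then fr.coeff β v • fr.sec α else 0 := by
  change (if S.card = 0 then fr.matEnd α β else 0) v = _
  split_ifs <;> rfl

theorem mat_mem (α β : l) : (fr.mat α β).1 ∈ SymMult.zdegree 1 := fun S =>
  ⟨fun _ => rfl, fun hS => if_neg (by intro h; rw [h] at hS; simp at hS)⟩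

/-- A fibre coordinate as a fibre-wise linear multivector of degree `0`. -/
def linMult {f : A} (hf : f ∈ h.homFn 1) : h.lin := ⟨SymMult.ofFn f, fun t ht S => by
  refine ⟨?_, fun v => by simp⟩
  rw [SymMult.ofFn_fst, SymMult.ofFn_fst, Multiset.card_map]
  split_ifs with hS
  · rw [hf t, hS]; simp
  · simp⟩

/-- A base function as a core multivector of degree `0`. -/
def baseMult {f : A} (hf : f ∈ h.homFn 0) : h.core := ⟨SymMult.ofFn f, fun t ht S => by
  refine ⟨?_, fun v => by simp⟩
  rw [SymMult.ofFn_fst, SymMult.ofFn_fst, Multiset.card_map]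
  split_ifs with hS
  · rw [hf t, hS]; simp
  · simp⟩

/-! ### Lifts of derivations -/

/-- The derivation with a given symbol that is flat with respect to the frame. -/
def liftDer (X : Derivation ℝ A A) : ModDer A Γ :=
  ⟨(fr.cut • X, 
    { toFun := fun v => ∑ α, X (fr.coeff α v) • fr.sec α
      map_add' := fun v v' => by simp only [map_add, add_smul, Finset.sum_add_distrib]
      map_smul' := fun r v => by
        simp only [coeff_rsmul, Derivation.map_smul, smul_assoc, Finset.smul_sum, RingHom.id_apply] }),
    fun a v => by
      simp only [LinearMap.coe_mk, AddHom.coe_mk, map_smul, smul_eq_mul, Derivation.leibniz, add_smul,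
        Finset.sum_add_distrib, Derivation.smul_apply]
      rw [mul_comm fr.cut, mul_smul, fr.expand, Finset.smul_sum, Finset.smul_sum]
      simp only [mul_smul]
      congr 1
      exact Finset.sum_congr rfl fun α _ => smul_comm _ _ _⟩

theorem liftDer_symbol (X : Derivation ℝ A A) (a : A) :
    ModDer.symbol (fr.liftDer X) a = fr.cut * X a := rfl
theorem liftDer_op (X : Derivation ℝ A A) (v : Γ) :
    ModDer.op (fr.liftDer X) v = ∑ α, X (fr.coeff α v) • fr.sec α := rfl

theorem ev_liftDer (X : Derivation ℝ A A) (a : A) {x : M} (hx : x ∈ U) (b : B x) :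
    R.ev x b (ModDer.symbol (fr.liftDer X) a) = R.ev x b (X a) := by
  rw [liftDer_symbol, map_mul, fr.cut_eq x hx, one_mul]

/-- A derivation, followed by the evaluation at a point. -/
theorem der_point (X : Derivation ℝ A A) (x : M) (b : B x) (a a' : A) :
    ((R.ev x b).toLinearMap ∘ₗ X.toLinearMap) (a * a') =
      R.ev x b a • ((R.ev x b).toLinearMap ∘ₗ X.toLinearMap) a' +
      R.ev x b a' • ((R.ev x b).toLinearMap ∘ₗ X.toLinearMap) a := by
  simp

theorem evS_liftDer_sec (X : Derivation ℝ A A) {x : M} (hx : x ∈ U) (b : B x) (β : l) :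
    R.evS x b (ModDer.op (fr.liftDer X) (fr.sec β)) = 0 := by
  rw [liftDer_op, map_sum]
  refine Finset.sum_eq_zero fun α _ => ?_
  have := fr.pointDer_const (der_point X x b) hx _ (fr.coeff_sec α β)
  rw [R.evS_smul]
  change (((R.ev x b).toLinearMap ∘ₗ X.toLinearMap) _) • _ = _
  rw [this, zero_smul]

theorem liftDer_mem (X : Derivation ℝ A A) {m : ℤ}
    (hX : ∀ t : ℝ, t ≠ 0 → ∀ a, h.fn t (X a) = t ^ m • X (h.fn t a)) :
    fr.liftDer X ∈ h.homDer m := fun t ht => by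
  refine ⟨fun a => ?_, fun v => ?_⟩
  · rw [liftDer_symbol, liftDer_symbol, map_mul, hX t ht, h.fn_homFn_zero fr.cut_mem, mul_smul_comm]
  · rw [liftDer_op, liftDer_op, map_sum, Finset.smul_sum]
    refine Finset.sum_congr rfl fun α _ => ?_
    rw [h.sec_smul, hX t ht, fr.sec_hom, fr.coeff_hom, smul_assoc]

theorem liftDer_dfib_mem (c : κ) : fr.liftDer (fr.dfib c) ∈ h.homDer (-1) :=
  fr.liftDer_mem _ fun t ht a => by rw [fr.dfib_hom c t a ht, zpow_neg_one]

theorem liftDer_dcrd_mem (i : ι) : fr.liftDer (fr.dcrd i) ∈ h.homDer 0 :=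
  fr.liftDer_mem _ fun t ht a => by rw [fr.dcrd_hom i t a ht, zpow_zero, one_smul]

/-- Elementary endomorphisms of the second bundle, as derivations. -/
def matDer (α β : l) : ModDer A Γ := ⟨(0, fr.matEnd α β), fun a v => by simp [matEnd, mul_smul]⟩

theorem matDer_symbol (α β : l) : ModDer.symbol (fr.matDer α β) = 0 := rfl
theorem matDer_op (α β : l) (v : Γ) : ModDer.op (fr.matDer α β) v = fr.coeff β v • fr.sec α := rfl

theorem matDer_mem (α β : l) : fr.matDer α β ∈ h.homDer 0 := fun t ht => by
  refine ⟨fun a => by simp [matDer_symbol], fun v => ?_⟩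
  rw [matDer_op, matDer_op, h.sec_smul, fr.sec_hom, fr.coeff_hom, zpow_zero, one_smul]

end Frame

end OneSide
end
end FWL

namespace FWL
noncomputable section

/-! ### Euler's relation for core multivectors -/

section OneSide
variable {A Γ : Type*} [CommRing A] [Algebra ℝ A] [AddCommGroup Γ] [Module ℝ Γ] [Module A Γ]
  [IsScalarTower ℝ A Γ]

namespace SymMult

theorem expF_of_mem {k : ℕ} {D : SymMult A Γ} (hD : D ∈ zdegree (k : ℤ)) (a : A) :
    expF D a = ((k.factorial : ℝ)⁻¹) • D.1.1 (Multiset.replicate k a) := by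
  rw [expF, expSum, finsum_eq_single _ k]
  intro j hj
  rw [(hD _).1 (by rw [Multiset.card_replicate]; exact_mod_cast hj), smul_zero]

theorem eq_ofFn_of_mem {D : SymMult A Γ} (hD : D ∈ zdegree 0) : D = ofFn (D.1.1 0) := by
  refine ext_iff'.2 ⟨fun S => ?_, fun S v => ?_⟩
  · rw [ofFn_fst]
    split_ifs with h
    · rw [Multiset.card_eq_zero.1 h]
    · exact (hD S).1 (by exact_mod_cast h)
  · rw [(hD S).2 (by omega)]; rfl

theorem comp_mem_weight {h : Dilation A Γ} {w : ℤ} {D : SymMult A Γ} (hD : D ∈ h.weight w) (k : ℕ) :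
    comp k D ∈ h.weight w := fun t ht S => by
  refine ⟨?_, fun v => ?_⟩
  · rw [comp_fst, comp_fst, Multiset.card_map]
    split_ifs
    · exact (hD t ht S).1
    · simp
  · rw [comp_snd, comp_snd, Multiset.card_map]
    split_ifs
    · exact (hD t ht S).2 v
    · simp

theorem unshuffleSum_single {N : Type*} [AddCommGroup N] (g : Multiset A → N) (S : Multiset A) :
    unshuffleSum (fun x y => if y.card = 0 then g x else 0) S = g S := by
  induction S using Multiset.induction_on generalizing g with
  | empty => simp [unshuffleSum_zero]
  | cons b S ih =>
    rw [unshuffleSum_cons]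
    simp only [Multiset.card_cons, Nat.succ_ne_zero, if_false, add_zero]
    exact ih fun x => g (b ::ₘ x)

end SymMult

open SymMult

namespace Dilation
variable (h : Dilation A Γ)

/-- Insertion is the bracket with a function (`lie_ofFn`), so the weight is `0 + 1 - 1`; in the next
lemma it is `1 + 0 - 1`. -/
theorem ins_mem_core {C : SymMult A Γ} (hC : C ∈ h.core) {f : A} (hf : f ∈ h.homFn 1) :
    ins f C ∈ h.core := by
  rw [← lie_ofFn]
  simpa using! h.weight_lie hC (Frame.linMult hf).2

theorem ins_mem_core_of_lin {D : SymMult A Γ} (hD : D ∈ h.lin) {f : A} (hf : f ∈ h.homFn 0) :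
    ins f D ∈ h.core := by
  rw [← lie_ofFn]
  simpa using! h.weight_lie hD (Frame.baseMult hf).2

theorem ins_zdegree {D : SymMult A Γ} {m : ℤ} (hD : D ∈ zdegree (m + 1)) (f : A) :
    ins f D ∈ zdegree m := by
  rw [← lie_ofFn]
  simpa using zdegree_lie hD (ofFn_mem f)

end Dilation

variable {M : Type*} [TopologicalSpace M]
variable {h : Dilation A Γ} {B W : M → Type*} [∀ x, AddCommGroup (B x)]
    [∀ x, Module ℝ (B x)] [∀ x, AddCommGroup (W x)] [∀ x, Module ℝ (W x)]
variable {R : Realization h B W} {U : Set M} {ι κ l : Type*} [Fintype ι] [Fintype κ]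
    [Fintype l] [DecidableEq ι] [DecidableEq κ] [DecidableEq l]

namespace Realization

theorem AgreeAt.symm {x : M} {D E : SymMult A Γ} (hDE : R.AgreeAt x D E) : R.AgreeAt x E D :=
  ⟨fun S b => (hDE.1 S b).symm, fun S v b => (hDE.2 S v b).symm⟩

theorem agreeAt_sub {x : M} {D E : SymMult A Γ} (hDE : R.AgreeAt x (D - E) 0) : R.AgreeAt x D E := by
  refine ⟨fun S b => ?_, fun S v b => ?_⟩
  · have := hDE.1 S b
    rw [← sub_eq_zero, ← map_sub]
    exact this.trans (map_zero _)
  · have := hDE.2 S v b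
    rw [← sub_eq_zero, ← map_sub]
    exact this.trans (map_zero _)

theorem ev_expF_congr {x : M} {D E : SymMult A Γ} (hDE : R.AgreeAt x D E) (b : B x) (a : A) :
    R.ev x b (expF D a) = R.ev x b (expF E a) := by
  have h1 := expSum_map (R.ev x b).toLinearMap (vanishes_fst D) a
  have h2 := expSum_map (R.ev x b).toLinearMap (vanishes_fst E) a
  simp only [AlgHom.toLinearMap_apply] at h1 h2
  rw [expF, expF, h1, h2]
  congr 1
  exact funext fun S => hDE.1 S b

theorem ev_expF (D : SymMult A Γ) (x : M) (b : B x) (a : A) :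
    R.ev x b (expF D a) = expSum (fun S => R.ev x b (D.1.1 S)) a :=
  expSum_map (R.ev x b).toLinearMap (vanishes_fst D) a

theorem evS_expS (D : SymMult A Γ) (x : M) (b : B x) (a : A) (v : Γ) :
    R.evS x b (expS D a v) = expSum (fun S => R.evS x b (D.1.2 S v)) a :=
  expSum_map (R.evS x b) (vanishes_snd D v) a

/-- Equality after multiplication by a function vanishing outside `U`. -/
theorem base_mul_eq {r : A} (hr : ∀ x ∉ U, ∀ b, R.ev x b r = 0) {D E : SymMult A Γ}
    (hDE : ∀ x ∈ U, R.AgreeAt x D E) : ofFn r * D = ofFn r * E := by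
  refine R.agreeAt_ext fun x => ⟨fun S b => ?_, fun S v b => ?_⟩
  · rw [ofFn_mul_fst, ofFn_mul_fst, map_mul, map_mul]
    by_cases hx : x ∈ U
    · rw [(hDE x hx).1]
    · rw [hr x hx, zero_mul, zero_mul]
  · rw [ofFn_mul_snd, ofFn_mul_snd, R.evS_smul, R.evS_smul]
    by_cases hx : x ∈ U
    · rw [(hDE x hx).2]
    · rw [hr x hx, zero_smul, zero_smul]

/-- A converse of `base_mul_eq`; together they pass between identities over `U` and global ones. -/
theorem agreeAt_of_base_mul {r : A} {x : M} (hr : ∀ b, R.ev x b r ≠ 0) {D E : SymMult A Γ}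
    (hDE : ofFn r * D = ofFn r * E) : R.AgreeAt x D E := by
  have h' := ext_iff'.1 hDE
  refine ⟨fun S b => ?_, fun S v b => ?_⟩
  · have := congrArg (R.ev x b) (h'.1 S)
    rw [ofFn_mul_fst, ofFn_mul_fst, map_mul, map_mul] at this
    exact mul_left_cancel₀ (hr b) this
  · have := congrArg (R.evS x b) (h'.2 S v)
    rw [ofFn_mul_snd, ofFn_mul_snd, R.evS_smul, R.evS_smul] at this
    exact smul_right_injective _ (hr b) this

end Realization

namespace Frame
variable (fr : Frame R U ι κ l)

theorem ev_par_cons (c : κ) (f : A) (S : Multiset A) {x : M} (hx : x ∈ U) (b : B x) :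
    R.ev x b ((fr.par c).1.1.1 (f ::ₘ S)) = if S.card = 0 then R.ev x b (fr.dfib c f) else 0 := by
  refine (fr.ev_lift _ (isMultiDer_der (fr.dfib c)) _ hx b).trans ?_
  rw [derMult_cons]
  split_ifs
  · rfl
  · exact map_zero _

theorem ev_nab_cons (i : ι) (f : A) (S : Multiset A) {x : M} (hx : x ∈ U) (b : B x) :
    R.ev x b ((fr.nab i).1.1.1 (f ::ₘ S)) = if S.card = 0 then R.ev x b (fr.dcrd i f) else 0 := by
  refine (fr.ev_lift _ (isMultiDer_der (fr.dcrd i)) _ hx b).trans ?_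
  rw [derMult_cons]
  split_ifs
  · rfl
  · exact map_zero _

theorem ev_unshuffleSum (x : M) (b : B x) (G : Multiset A → Multiset A → A) (S : Multiset A) :
    R.ev x b (unshuffleSum G S) = unshuffleSum (fun y z => R.ev x b (G y z)) S :=
  unshuffleSum_map (map_add (R.ev x b)) G S

/-- The Euler identity for multivectors: each argument is expanded in fibre coordinates. -/
theorem euler_mult (D : SymMult A Γ) {x : M} (hx : x ∈ U) (b : B x) (Y : Multiset κ) :
    ∑ c, R.ev x b ((ins (fr.fib c) D * (fr.par c).1).1.1 (Y.map fr.fib)) =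
      Y.card * R.ev x b (D.1.1 (Y.map fr.fib)) := by
  have e : ∀ (D : SymMult A Γ) c S, R.ev x b ((ins (fr.fib c) D * (fr.par c).1).1.1 S) =
      unshuffleSum (fun y z => R.ev x b (D.1.1 (fr.fib c ::ₘ y)) * R.ev x b ((fr.par c).1.1.1 z)) S := by
    intro D c S
    rw [coe_mul, RawMult.mul]
    simp only [ev_unshuffleSum, map_mul, ins_fst]
  induction Y using Multiset.induction_on generalizing D with
  | empty =>
    rw [Multiset.card_zero, Nat.cast_zero, zero_mul]
    refine Finset.sum_eq_zero fun c _ => ?_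
    rw [e, Multiset.map_zero, unshuffleSum_zero, (fr.par_mem c 0).1 (by simp), map_zero, mul_zero]
  | cons d Y ih =>
    simp only [e, Multiset.map_cons, unshuffleSum_cons, unshuffleSum_add, Finset.sum_add_distrib]
    -- Terms in which the coordinate `d` becomes an argument of `D`: the induction hypothesis for
    -- `ins (fib d) D` contributes `Y.card` copies.
    have h1 := ih (ins (fr.fib d) D)
    simp only [e, ins_fst] at h1
    simp only [Multiset.cons_swap (fr.fib d)] at h1
    rw [h1]
    -- Terms in which `d` goes to the derivative `par c`: they require `c = d` and no further
    -- argument there, and contribute one more copy.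
    have h2 : ∀ c, unshuffleSum (fun y z => R.ev x b (D.1.1 (fr.fib c ::ₘ y)) *
        R.ev x b ((fr.par c).1.1.1 (fr.fib d ::ₘ z))) (Y.map fr.fib) =
        (if c = d then R.ev x b (D.1.1 (fr.fib c ::ₘ Y.map fr.fib)) else 0) := by
      intro c
      rw [← unshuffleSum_single (fun y => if c = d then R.ev x b (D.1.1 (fr.fib c ::ₘ y)) else 0)]
      refine unshuffleSum_congr fun y z _ => ?_
      rw [fr.ev_par_cons c _ _ hx b, fr.dfib_fib c d x hx b]
      split_ifs <;> simp
    simp only [h2, Finset.sum_ite_eq', Finset.mem_univ, if_true, Multiset.card_cons, Nat.cast_add,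
      Nat.cast_one]
    ring

/-- A polynomial of degree `k + 1` is recovered from its first derivatives. Both sides have weight
`0`, so `vanish_of_symbol` reduces the claim to symbols on fibre coordinates, where it is
`euler_mult`. Inductions on the degree of core multivectors rest on it. -/
theorem core_decomp {C : SymMult A Γ} (hC : C ∈ h.core) {k : ℕ} (hk : C ∈ zdegree ((k + 1 : ℕ) : ℤ))
    {x : M} (hx : x ∈ U) : R.AgreeAt x C
      (((k + 1 : ℝ)⁻¹) • ∑ c, ins (fr.fib c) C * (fr.par c).1) := by
  have hmem : ∀ c, ins (fr.fib c) C * (fr.par c).1 ∈ h.weight 0 := fun c => by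
    simpa using! h.weight_mul (h.ins_mem_core hC (fr.fib_mem c)) (fr.par c).2
  refine R.agreeAt_sub (fr.vanish_of_symbol hx le_rfl (Submodule.sub_mem _ hC
    (Submodule.smul_mem _ _ (Submodule.sum_mem _ fun c _ => hmem c))) fun Y b => ?_)
  change R.ev x b (C.1.1 _ - ((k + 1 : ℝ)⁻¹) • (∑ c, ins (fr.fib c) C * (fr.par c).1).1.1 _) = 0
  rw [map_sub, map_smul, fst_sum, map_sum, fr.euler_mult C hx b Y]
  by_cases hY : Y.card = k + 1
  · rw [hY, smul_eq_mul]
    push_cast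
    rw [inv_mul_cancel_left₀ (by positivity), sub_self]
  · rw [(hk _).1 (by rw [Multiset.card_map]; exact_mod_cast hY)]
    simp

end Frame

end OneSide
end
end FWL

namespace FWL
noncomputable section

/-! ### Core multivectors as polynomial functions on the dual bundle -/

section TwoSides
open SymMult
variable {A Γ : Type*} [CommRing A] [Algebra ℝ A] [AddCommGroup Γ] [Module ℝ Γ] [Module A Γ]
  [IsScalarTower ℝ A Γ]
variable {A' Γ' : Type*} [CommRing A'] [Algebra ℝ A'] [AddCommGroup Γ'] [Module ℝ Γ'] [Module A' Γ']
  [IsScalarTower ℝ A' Γ']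
variable {M : Type*} [TopologicalSpace M]
variable {h : Dilation A Γ} {h' : Dilation A' Γ'} {B B' W : M → Type*} [∀ x, AddCommGroup (B x)]
    [∀ x, Module ℝ (B x)] [∀ x, AddCommGroup (B' x)]
    [∀ x, Module ℝ (B' x)] [∀ x, AddCommGroup (W x)] [∀ x, Module ℝ (W x)]
variable {R : Realization h B W} {R' : Realization h' B' W}

/-- The duality between functions on a bundle `B` and on its dual bundle `B'`: every `φ : Φ` is a
section of `B'` and a fibre-wise linear function on `B`. Elements of `Γ₀` are sections of `W`. -/
structure DualData (R : Realization h B W) (R' : Realization h' B' W) (Φ Γ₀ : Type*) where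
  /-- the values of a section of the dual bundle -/
  val : Φ → ∀ x, B' x
  /-- the fibre-wise linear function of a section of the dual bundle -/
  lin : Φ → A
  lin_mem : ∀ φ, lin φ ∈ h.homFn 1
  surj : ∀ x b', ∃ φ, val φ x = b'
  toDual : ∀ a : A, ∃ a' : A', ∀ x b', R'.ev x b' a' = R.ev x 0 a
  ofDual : ∀ a' : A', ∃ a : A, ∀ x b, R.ev x b a = R'.ev x 0 a'
  /-- pull-back of sections -/
  pull : Γ₀ → Γ
  /-- pull-back of sections to the dual bundle -/
  pull' : Γ₀ → Γ'
  evS_pull : ∀ v x b b', R.evS x b (pull v) = R'.evS x b' (pull' v)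

/-- Frames of a bundle and of its dual that are dual to each other. -/
structure PairedFrame {Φ Γ₀ : Type*} (d : DualData R R' Φ Γ₀) (U : Set M) (ι κ l : Type*) [Fintype ι]
    [Fintype κ] [Fintype l] [DecidableEq ι] [DecidableEq κ] [DecidableEq l] where
  /-- the frame -/
  fr : Frame R U ι κ l
  /-- the dual frame -/
  fr' : Frame R' U ι κ l
  crd_eq : ∀ i x b b', R.ev x b (fr.crd i) = R'.ev x b' (fr'.crd i)
  /-- the frame of sections on the base -/
  sec₀ : l → Γ₀
  sec_eq : ∀ α, fr.sec α = d.pull (sec₀ α)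
  sec_eq' : ∀ α, fr'.sec α = d.pull' (sec₀ α)
  dlin_eq : ∀ c φ, ∀ x ∈ U, R.ev x 0 (fr.dfib c (d.lin φ)) = R'.ev x (d.val φ x) (fr'.fib c)

/-- Dual frames exist near every point. -/
def DualData.HasFrames {Φ Γ₀ : Type*} (d : DualData R R' Φ Γ₀) (ι κ l : Type*) [Fintype ι]
    [Fintype κ] [Fintype l] [DecidableEq ι] [DecidableEq κ] [DecidableEq l] : Prop :=
  ∀ x₀, ∃ U ∈ nhds x₀, Nonempty (PairedFrame d U ι κ l)

namespace Realization

theorem mem_homFn_of_ev {k : ℕ} {f : A} {g : M → A} (hg : ∀ x, g x ∈ h.homFn k)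
    (hf : ∀ x b, R.ev x b f = R.ev x b (g x)) : f ∈ h.homFn k := fun t => R.ext _ _ fun x b => by
  rw [R.ev_fn, map_smul, hf, hf, ← R.ev_fn, hg x t, map_smul]

theorem mem_homFn_zero_of_ev {f : A} {g : ∀ _ : M, ℝ}
    (hf : ∀ x b, R.ev x b f = g x) : f ∈ h.homFn 0 := fun t => R.ext _ _ fun x b => by
  rw [R.ev_fn, map_smul, hf, hf, pow_zero, one_smul]

theorem fn_zero_mem (R : Realization h B W) (f : A) : h.fn 0 f ∈ h.homFn 0 :=
  R.mem_homFn_zero_of_ev (g := fun x => R.ev x 0 f) fun x b => by rw [R.ev_fn, zero_smul]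

/-- Homogeneous functions of different degrees are linearly independent. -/
theorem eq_zero_of_sum (R : Realization h B W) {n : ℕ} {f : ℕ → A} (hf : ∀ k, f k ∈ h.homFn k)
    (hs : ∑ k ∈ Finset.range n, f k = 0) {k : ℕ} (hk : k < n) : f k = 0 := by
  refine R.ext _ _ fun x b => ?_
  -- On the line `t • b` the sum of the `f k` is a polynomial in `t` whose coefficients are their
  -- values at `b`.
  let p : Polynomial ℝ := ∑ k ∈ Finset.range n, Polynomial.monomial k (R.ev x b (f k))
  have hp : p = 0 := by
    refine Polynomial.funext fun t => ?_
    have := congrArg (R.ev x (t • b)) hs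
    rw [map_sum, map_zero] at this
    rw [Polynomial.eval_zero, ← this, Polynomial.eval_finsetSum]
    refine Finset.sum_congr rfl fun k _ => ?_
    rw [Polynomial.eval_monomial, ← R.ev_fn, hf k t, map_smul, smul_eq_mul, mul_comm]
  have := congrArg (fun q => Polynomial.coeff q k) hp
  simp only [p, Polynomial.finsetSum_coeff, Polynomial.coeff_monomial, Polynomial.coeff_zero] at this
  rw [Finset.sum_ite_eq' (Finset.range n) k, if_pos (Finset.mem_range.2 hk)] at this
  rw [this, map_zero]

end Realization

namespace Dilation

theorem fst_zero_mem {C : SymMult A Γ} (hC : C ∈ h.core) : C.1.1 0 ∈ h.homFn 0 :=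
  h.zhom_zero.1 fun t ht => by simpa using (hC t ht 0).1

theorem baseMult_fst_zero {C : SymMult A Γ} (hC : C ∈ h.core) (hk : C ∈ zdegree 0) :
    (⟨C, hC⟩ : h.core) = Frame.baseMult (fst_zero_mem hC) := Subtype.ext (eq_ofFn_of_mem hk)

/-- A core multivector is the sum of its components. -/
theorem core_eq_sum (C : h.core) : ∃ n, C = ∑ k ∈ Finset.range n,
    (⟨comp k C.1, comp_mem_weight C.2 k⟩ : h.core) := by
  obtain ⟨n, hn⟩ := exists_eq_sum_comp C.1
  refine ⟨n, Subtype.ext ?_⟩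
  rw [AddSubmonoidClass.coe_finsetSum]
  exact hn

theorem comp_mem_z (k : ℕ) (D : SymMult A Γ) : comp k D ∈ zdegree (k : ℤ) :=
  mem_degree_iff.1 (comp_mem k D)

end Dilation

section OneFrame
variable {U : Set M} {ι κ l : Type*} [Fintype ι] [Fintype κ]
    [Fintype l] [DecidableEq ι] [DecidableEq κ] [DecidableEq l]

namespace Frame
variable (fr : Frame R U ι κ l)

/-- The derivative is homogeneous of degree `-1`. -/
theorem dfib_homFn_zero (c : κ) {f : A} (hf : f ∈ h.homFn 0) : fr.dfib c f = 0 :=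
  h.zhom_neg (m := -1) (by norm_num) fun t ht => by
    rw [fr.dfib_hom c t f ht, h.fn_homFn_zero hf, zpow_neg_one]

theorem ev_der_congr (fr : Frame R U ι κ l) (X : Derivation ℝ A A) {x : M} (hx : x ∈ U) {b : B x}
    {f g : A} (hf : ∀ x ∈ U, ∀ b, R.ev x b f = R.ev x b g) : R.ev x b (X f) = R.ev x b (X g) :=
  fr.pointDer_congr (Frame.der_point X x b) hx hf

/-- Insertion of fibre coordinates in core multivectors. -/
def insFib (c : κ) (C : h.core) : h.core := ⟨ins (fr.fib c) C.1, h.ins_mem_core C.2 (fr.fib_mem c)⟩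

/-- The right hand side of the Euler identity. -/
def eulerSum (k : ℕ) (C : h.core) : h.core := ((k + 1 : ℝ)⁻¹) • ∑ c, fr.insFib c C * fr.par c

theorem coe_eulerSum (k : ℕ) (C : h.core) : (fr.eulerSum k C).1 =
    ((k + 1 : ℝ)⁻¹) • ∑ c, ins (fr.fib c) C.1 * (fr.par c).1 := by
  rw [eulerSum, Submodule.coe_smul, AddSubmonoidClass.coe_finsetSum]
  rfl

/-- `core_decomp` as an identity in the ring `h.core`, to which algebra maps and derivations can be
applied. -/
theorem bump_mul_euler (fr : Frame R U ι κ l) {k : ℕ} {C : h.core} (hk : C.1 ∈ zdegree ((k + 1 : ℕ) : ℤ)) :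
    baseMult fr.bump_mem * C = baseMult fr.bump_mem * fr.eulerSum k C := by
  refine Subtype.ext (R.base_mul_eq (U := U) (fun x hx b => fr.bump_eq_zero hx b) fun x hx => ?_)
  rw [fr.coe_eulerSum]
  exact fr.core_decomp C.2 hk hx

/-- A derivation of the core multivectors at a point is determined by its values on functions on
the base and on fibre derivatives. -/
theorem coreDer_eq_zero {N : Type*} [AddCommGroup N] [Module ℝ N] (e : h.core →ₐ[ℝ] ℝ)
    (he : e (baseMult fr.bump_mem) ≠ 0) (δ : h.core →ₗ[ℝ] N)
    (hδ : ∀ C C', δ (C * C') = e C • δ C' + e C' • δ C)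
    (h0 : ∀ (f : A) (hf : f ∈ h.homFn 0), δ (baseMult hf) = 0) (h1 : ∀ c, δ (fr.par c) = 0)
    (C : h.core) : δ C = 0 := by
  have key : ∀ (k : ℕ) (C : h.core), C.1 ∈ zdegree (k : ℤ) → δ C = 0 := by
    intro k
    induction k with
    | zero =>
      intro C hC
      have := Dilation.baseMult_fst_zero C.2 hC
      rw [show C = baseMult _ from this, h0]
    | succ k ih =>
      intro C hC
      have e1 := fr.bump_mul_euler hC
      have e2 := congrArg e e1
      rw [map_mul, map_mul] at e2
      have e3 := congrArg δ e1
      -- The derivative of the bump function occurs on both sides of `e3`, with coefficients that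
      -- agree by `e2`. What remains is the equality of `δ C` and `δ (eulerSum k C)`, multiplied by
      -- the nonzero value of `e` on the bump function.
      rw [hδ, hδ, ← mul_left_cancel₀ he e2, add_left_inj] at e3
      rw [smul_right_injective _ he e3, eulerSum, map_smul, map_sum, Finset.sum_eq_zero, smul_zero]
      intro c _
      rw [hδ, h1, ih _ (Dilation.ins_zdegree (by exact_mod_cast hC) _), smul_zero, smul_zero, add_zero]
  obtain ⟨n, hn⟩ := h.core_eq_sum C
  rw [hn, map_sum]
  exact Finset.sum_eq_zero fun k _ => key k _ (Dilation.comp_mem_z k _)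

end Frame
end OneFrame

namespace DualData
variable {Φ Γ₀ : Type*} (d : DualData R R' Φ Γ₀)

/-- The function `f` corresponds to the core multivector `C` over `x`. -/
def CoreAt (x : M) (C : SymMult A Γ) (f : A') : Prop :=
  ∀ φ, R'.ev x (d.val φ x) f = R.ev x 0 (expF C (d.lin φ))

variable {d}

/-- Sections of the dual bundle pass through every covector, so the points `φ x` exhaust the fibre.
-/
theorem CoreAt.unique {x : M} {C : SymMult A Γ} {f g : A'} (hf : d.CoreAt x C f)
    (hg : d.CoreAt x C g) (b' : B' x) : R'.ev x b' f = R'.ev x b' g := by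
  obtain ⟨φ, rfl⟩ := d.surj x b'
  rw [hf φ, hg φ]

theorem CoreAt.congr_left {x : M} {C C' : SymMult A Γ} {f : A'} (hf : d.CoreAt x C f)
    (hC : R.AgreeAt x C C') : d.CoreAt x C' f := fun φ => by
  rw [hf φ, R.ev_expF_congr hC]

theorem CoreAt.congr_right {x : M} {C : SymMult A Γ} {f g : A'} (hf : d.CoreAt x C f)
    (hg : ∀ b', R'.ev x b' f = R'.ev x b' g) : d.CoreAt x C g := fun φ => by
  rw [← hg, hf φ]

theorem CoreAt.add {x : M} {C C' : SymMult A Γ} {f g : A'} (hf : d.CoreAt x C f)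
    (hg : d.CoreAt x C' g) : d.CoreAt x (C + C') (f + g) := fun φ => by
  rw [map_add, expF_add, map_add, hf, hg]

theorem CoreAt.smul {x : M} {C : SymMult A Γ} {f : A'} (r : ℝ) (hf : d.CoreAt x C f) :
    d.CoreAt x (r • C) (r • f) := fun φ => by
  rw [map_smul, expF_smul, map_smul, hf]

theorem CoreAt.sum {x : M} {ι : Type*} {s : Finset ι} {C : ι → SymMult A Γ} {f : ι → A'}
    (hf : ∀ i ∈ s, d.CoreAt x (C i) (f i)) : d.CoreAt x (∑ i ∈ s, C i) (∑ i ∈ s, f i) := fun φ => by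
  rw [map_sum, expF_sum, map_sum]
  exact Finset.sum_congr rfl fun i hi => hf i hi φ

theorem CoreAt.mul {x : M} {C C' : SymMult A Γ} {f g : A'} (hf : d.CoreAt x C f)
    (hg : d.CoreAt x C' g) : d.CoreAt x (C * C') (f * g) := fun φ => by
  rw [map_mul, expF_mul, map_mul, hf, hg]

theorem CoreAt.ofFn {x : M} {a : A} {f : A'} (hf : ∀ b', R'.ev x b' f = R.ev x 0 a) :
    d.CoreAt x (ofFn a) f := fun φ => by rw [expF_ofFn, hf]

variable {U : Set M} {ι κ l : Type*} [Fintype ι] [Fintype κ]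
    [Fintype l] [DecidableEq ι] [DecidableEq κ] [DecidableEq l]

/-- The exponential of a derivation is its value on `ℓ_φ`, here the component of `φ` in direction
`c`: fibre derivatives of a bundle are the linear coordinates of its dual. -/
theorem coreAt_par (pf : PairedFrame d U ι κ l) {x : M} (hx : x ∈ U) (c : κ) :
    d.CoreAt x (pf.fr.par c).1 (pf.fr'.fib c) := fun φ => by
  rw [expF_of_mem (k := 1) (pf.fr.par_mem c), ← pf.dlin_eq c φ x hx, map_smul,
    Multiset.replicate_one, ← Multiset.cons_zero, pf.fr.ev_par_cons c _ _ hx 0]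
  simp

theorem coreAt_eulerSum (pf : PairedFrame d U ι κ l) {x : M} (hx : x ∈ U) {k : ℕ}
    (C : κ → h.core) {f : κ → A'} (hf : ∀ c, d.CoreAt x (C c).1 (f c)) :
    d.CoreAt x (((k + 1 : ℝ)⁻¹) • ∑ c, C c * pf.fr.par c : h.core).1
      (((k + 1 : ℝ)⁻¹) • ∑ c, f c * pf.fr'.fib c) := by
  rw [Submodule.coe_smul, AddSubmonoidClass.coe_finsetSum]
  exact .smul _ (.sum fun c _ => (hf c).mul (coreAt_par pf hx c))

variable (d) in
/-- Every homogeneous core multivector corresponds to a homogeneous function. -/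
theorem exists_coreAt (hd : d.HasFrames ι κ l) (k : ℕ) :
    ∀ C : h.core, C.1 ∈ zdegree (k : ℤ) → ∃ f ∈ h'.homFn k, ∀ x, d.CoreAt x C.1 f := by
  induction k with
  | zero =>
    intro C hC
    obtain ⟨f, hf⟩ := d.toDual (C.1.1.1 0)
    refine ⟨f, R'.mem_homFn_zero_of_ev hf, fun x => ?_⟩
    rw [eq_ofFn_of_mem hC]
    exact CoreAt.ofFn fun b' => hf x b'
  | succ k ih =>
    intro C hC
    choose U hU hF using hd
    let F := fun x => (hF x).some
    -- The insertions of cut-off coordinates are global core multivectors of degree `k`, to which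
    -- the induction hypothesis applies. Only the Euler sums formed from them are local and have to
    -- be glued.
    have ih' : ∀ x c, ∃ f ∈ h'.homFn k, ∀ y, d.CoreAt y ((F x).fr.insFib c C).1 f := fun x c =>
      ih _ (Dilation.ins_zdegree (by exact_mod_cast hC) _)
    choose f hf hf' using ih'
    let g := fun x => ((k + 1 : ℝ)⁻¹) • ∑ c, f x c * (F x).fr'.fib c
    have hg : ∀ x, ∀ y ∈ U x, d.CoreAt y C.1 (g x) := fun x y hy => by
      refine (coreAt_eulerSum (F x) hy _ fun c => hf' x c y).congr_left ?_
      change R.AgreeAt y ((F x).fr.eulerSum k C).1 _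
      rw [Frame.coe_eulerSum]
      exact ((F x).fr.core_decomp C.2 hC hy).symm
    obtain ⟨a, ha⟩ := R'.glue g fun x₀ => by
      filter_upwards [hU x₀] with y hy b'
      exact (hg y y (mem_of_mem_nhds (hU y))).unique (hg x₀ y hy) b'
    refine ⟨a, R'.mem_homFn_of_ev (g := g) (fun x => ?_) ha, fun x =>
      (hg x x (mem_of_mem_nhds (hU x))).congr_right fun b' => (ha x b').symm⟩
    exact Submodule.smul_mem _ _ (Submodule.sum_mem _ fun c _ =>
      h'.homFn_mul (hf x c) ((F x).fr'.fib_mem c))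

variable (d) in
theorem exists_coreAt_poly (hd : d.HasFrames ι κ l) (C : h.core) :
    ∃ f : A', f ∈ h'.polyFn ∧ ∀ x, d.CoreAt x C.1 f := by
  choose f hf hf' using fun k => d.exists_coreAt hd k (⟨comp k C.1, comp_mem_weight C.2 k⟩ : h.core)
    (Dilation.comp_mem_z k _)
  obtain ⟨n, hn⟩ := exists_eq_sum_comp C.1
  refine ⟨∑ k ∈ Finset.range n, f k, Submodule.sum_mem (⨆ k, h'.homFn k) fun k _ =>
    Submodule.mem_iSup_of_mem k (hf k), fun x => ?_⟩
  rw [hn]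
  exact .sum fun k _ => hf' k x

/-- The function on the dual bundle corresponding to a core multivector. -/
def coreFn (hd : d.HasFrames ι κ l) : h.core →ₐ[ℝ] h'.polyFn :=
  -- By uniqueness the chosen function equals any function corresponding to `C`, so the axioms of an
  -- algebra map reduce to the closure properties of `CoreAt`.
  have key {C : h.core} {f : A'} (hf : ∀ x, d.CoreAt x C.1 f) :
      (d.exists_coreAt_poly hd C).choose = f := R'.ext _ _ fun x b' =>
    ((d.exists_coreAt_poly hd C).choose_spec.2 x).unique (hf x) b'
  have spec (C : h.core) := (d.exists_coreAt_poly hd C).choose_spec.2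
  AlgHom.ofLinearMap
    { toFun := fun C => ⟨(d.exists_coreAt_poly hd C).choose, (d.exists_coreAt_poly hd C).choose_spec.1⟩
      map_add' := fun C C' => Subtype.ext (key fun x => (spec C x).add (spec C' x))
      map_smul' := fun r C => Subtype.ext (key fun x => (spec C x).smul r) }
    (Subtype.ext (key fun x => by
      change d.CoreAt x (1 : SymMult A Γ) 1
      rw [← ofFn_one]
      exact .ofFn fun b' => by rw [map_one, map_one]))
    (fun C C' => Subtype.ext (key fun x => (spec C x).mul (spec C' x)))

variable (hd : d.HasFrames ι κ l)

theorem coreAt_coreFn (C : h.core) (x : M) : d.CoreAt x C.1 (coreFn hd C).1 :=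
  (d.exists_coreAt_poly hd C).choose_spec.2 x

theorem coreFn_eq {C : h.core} {f : A'} (hf : ∀ x, d.CoreAt x C.1 f) : (coreFn hd C).1 = f :=
  R'.ext _ _ fun x b' => (coreAt_coreFn hd C x).unique (hf x) b'

theorem ev_coreFn {C : h.core} {f : A'} {x : M} (hf : d.CoreAt x C.1 f) (b' : B' x) :
    R'.ev x b' (coreFn hd C).1 = R'.ev x b' f := (coreAt_coreFn hd C x).unique hf b'

theorem ev_coreFn_congr {C C' : h.core} {x : M} (hC : R.AgreeAt x C.1 C'.1) (b' : B' x) :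
    R'.ev x b' (coreFn hd C).1 = R'.ev x b' (coreFn hd C').1 :=
  ev_coreFn hd ((coreAt_coreFn hd C' x).congr_left hC.symm) b'

theorem ev_coreFn_base {f : A} (hf : f ∈ h.homFn 0) (x : M) (b' : B' x) :
    R'.ev x b' (coreFn hd (Frame.baseMult hf)).1 = R.ev x 0 f := by
  obtain ⟨φ, rfl⟩ := d.surj x b'
  rw [coreAt_coreFn hd _ x φ]
  exact congrArg _ (expF_ofFn _ _)

theorem ev_coreFn_par (pf : PairedFrame d U ι κ l) {x : M} (hx : x ∈ U) (c : κ) (b' : B' x) :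
    R'.ev x b' (coreFn hd (pf.fr.par c)).1 = R'.ev x b' (pf.fr'.fib c) :=
  ev_coreFn hd (coreAt_par pf hx c) b'

theorem coreFn_crd (pf : PairedFrame d U ι κ l) (i : ι) :
    (coreFn hd (Frame.baseMult (pf.fr.crd_mem i))).1 = pf.fr'.crd i :=
  R'.ext _ _ fun x b' => by rw [ev_coreFn_base, ← pf.crd_eq]

theorem coreFn_mem_homFn {k : ℕ} {C : h.core} (hC : C.1 ∈ zdegree (k : ℤ)) :
    (coreFn hd C).1 ∈ h'.homFn k := by
  obtain ⟨f, hf, hf'⟩ := d.exists_coreAt hd k C hC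
  rw [coreFn_eq hd hf']
  exact hf

theorem coreFn_mem_zhom {m : ℤ} {C : h.core} (hC : C.1 ∈ zdegree m) :
    (coreFn hd C).1 ∈ h'.zhom m := by
  rcases lt_or_ge m 0 with hm | hm
  · have : C = 0 := Subtype.ext (zdegree_neg hm hC)
    rw [this, map_zero]
    exact Submodule.zero_mem _
  · obtain ⟨k, rfl⟩ := Int.eq_ofNat_of_zero_le hm
    exact h'.mem_zhom_natCast.2 (coreFn_mem_homFn hd hC)

/-- Insertion of a fibre coordinate corresponds to a derivative in the dual direction. -/
theorem ev_coreFn_ins (pf : PairedFrame d U ι κ l) {x : M} (hx : x ∈ U) (c : κ) (C : h.core)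
    (b' : B' x) : R'.ev x b' (coreFn hd (pf.fr.insFib c C)).1 =
      R'.ev x b' (pf.fr'.dfib c (coreFn hd C).1) := by
  let e : h.core →ₐ[ℝ] ℝ := ((R'.ev x b').comp h'.polyFn.val).comp (coreFn hd)
  let i : h.core →ₗ[ℝ] h.core :=
    { toFun := pf.fr.insFib c
      map_add' := fun C C' => Subtype.ext rfl
      map_smul' := fun r C => Subtype.ext rfl }
  -- The difference of both sides is a derivation, at the point `b'`, of the algebra of core
  -- multivectors. On base functions both terms vanish; on `par c'` both are one or zero according
  -- to whether `c' = c`.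
  let δ : h.core →ₗ[ℝ] ℝ := e.toLinearMap ∘ₗ i - (R'.ev x b').toLinearMap ∘ₗ
    (pf.fr'.dfib c).toLinearMap ∘ₗ (h'.polyFn.val.comp (coreFn hd)).toLinearMap
  have hδ : ∀ C, δ C = R'.ev x b' (coreFn hd (pf.fr.insFib c C)).1 -
      R'.ev x b' (pf.fr'.dfib c (coreFn hd C).1) := fun _ => rfl
  have hi : ∀ C C', pf.fr.insFib c (C * C') = C * pf.fr.insFib c C' + pf.fr.insFib c C * C' :=
    fun C C' => Subtype.ext (by
      have e1 : ins (pf.fr.fib c) (C.1 * C'.1) =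
        ins (pf.fr.fib c) C.1 * C'.1 + C.1 * ins (pf.fr.fib c) C'.1 :=
          Subtype.ext (RawMult.ins_mul (pf.fr.fib c) C.1.1 C'.1.1)
      exact e1.trans (add_comm _ _))
  refine sub_eq_zero.1 ((hδ C).symm.trans (pf.fr.coreDer_eq_zero e ?_ δ ?_ ?_ ?_ C))
  · change R'.ev x b' (coreFn hd _).1 ≠ 0
    rw [ev_coreFn_base]
    exact (pf.fr.bump_ne x 0).2 hx
  · intro C C'
    simp only [hδ, hi, map_add, map_mul, Subalgebra.coe_mul, Subalgebra.coe_add, Derivation.leibniz,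
      smul_eq_mul]
    change _ = R'.ev x b' (coreFn hd C).1 * _ + R'.ev x b' (coreFn hd C').1 * _
    ring
  · intro f hf
    have h1 : pf.fr.insFib c (Frame.baseMult hf) = 0 := Subtype.ext (ext_iff'.2
      ⟨fun S => by
        change (SymMult.ofFn (Γ := Γ) f).1.1 (_ ::ₘ S) = _
        rw [ofFn_cons]; rfl, fun S v => rfl⟩)
    rw [hδ, h1, map_zero, Subalgebra.coe_zero, map_zero, zero_sub, neg_eq_zero]
    rw [pf.fr'.dfib_homFn_zero c, map_zero]
    exact coreFn_mem_homFn hd (ofFn_mem f)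
  · intro c'
    rw [hδ, sub_eq_zero]
    have h1 : (pf.fr.insFib c (pf.fr.par c')).1 =
        SymMult.ofFn ((pf.fr.par c').1.1.1 (pf.fr.fib c ::ₘ 0)) :=
      eq_ofFn_of_mem (Dilation.ins_zdegree (pf.fr.par_mem c') _)
    rw [ev_coreFn hd (f := algebraMap ℝ A' (if c' = c then 1 else 0)), AlgHom.commutes]
    · rw [pf.fr'.ev_der_congr (pf.fr'.dfib c) hx fun y hy b => ev_coreFn_par hd pf hy c' b]
      refine Eq.trans ?_ (pf.fr'.dfib_fib c c' x hx b').symm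
      simp only [eq_comm, Algebra.algebraMap_self, RingHom.id_apply]
    · rw [h1]
      refine .ofFn fun b => ?_
      rw [AlgHom.commutes, pf.fr.ev_par_cons c' _ _ hx 0, pf.fr.dfib_fib c' c x hx 0]
      simp

/-- A homogeneous core multivector is determined by its function on the dual bundle. -/
theorem eq_zero_of_coreFn (k : ℕ) : ∀ C : h.core, C.1 ∈ zdegree (k : ℤ) → coreFn hd C = 0 → C = 0 := by
  induction k with
  | zero =>
    intro C hC h0
    have hC0 : C = Frame.baseMult (h.fst_zero_mem C.2) := h.baseMult_fst_zero C.2 hC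
    rw [hC0] at h0
    have h1 : C.1.1.1 0 = 0 := R.ext _ _ fun x b => by
      rw [R.ev_homFn_zero (h.fst_zero_mem C.2), ← ev_coreFn_base hd (h.fst_zero_mem C.2) x 0, h0,
        Subalgebra.coe_zero, map_zero, map_zero]
    refine Subtype.ext ((eq_ofFn_of_mem hC).trans ?_)
    rw [h1, map_zero]; rfl
  | succ k ih =>
    intro C hC h0
    refine Subtype.ext (R.agreeAt_ext fun x₀ => ?_)
    obtain ⟨U, hU, ⟨pf⟩⟩ := hd x₀
    have hx := mem_of_mem_nhds hU
    -- Over `U` the insertion corresponds to a derivative of zero, and outside `U` the bump function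
    -- vanishes. So the product has zero image under `coreFn` and is zero by induction.
    have h1 : ∀ c, Frame.baseMult pf.fr.bump_mem * pf.fr.insFib c C = 0 := fun c => by
      refine ih _ ?_ (Subtype.ext (R'.ext _ _ fun x b' => ?_))
      · have := zdegree_mul (ofFn_mem (Γ := Γ) pf.fr.bump)
          (Dilation.ins_zdegree (m := (k : ℤ)) (by exact_mod_cast hC) (pf.fr.fib c))
        rw [zero_add] at this
        exact this
      · rw [map_mul, Subalgebra.coe_mul, map_mul, ev_coreFn_base]
        by_cases hx : x ∈ U
        · rw [ev_coreFn_ins hd pf hx, h0, Subalgebra.coe_zero, map_zero, map_zero, mul_zero]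
        · rw [pf.fr.bump_eq_zero hx, zero_mul, Subalgebra.coe_zero, map_zero]
    have h2 : Frame.baseMult pf.fr.bump_mem * C = 0 := by
      rw [pf.fr.bump_mul_euler hC, Frame.eulerSum, mul_smul_comm, Finset.mul_sum,
        Finset.sum_eq_zero, smul_zero]
      intro c _
      rw [← mul_assoc, h1, zero_mul]
    refine R.agreeAt_of_base_mul (r := pf.fr.bump) (fun b => (pf.fr.bump_ne x₀ b).2 hx) ?_
    refine (congrArg Subtype.val h2).trans ?_
    rw [SymMult.mul_comm']
    exact (SymMult.zero_mul' _).symm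

/-- The components of a multivector in the kernel have homogeneous images of distinct degrees with
sum zero, so each image is zero. -/
theorem coreFn_injective : Function.Injective (coreFn hd) := by
  refine (injective_iff_map_eq_zero _).2 fun C hC => ?_
  obtain ⟨n, hn⟩ := exists_eq_sum_comp C.1
  have hn' : C = ∑ k ∈ Finset.range n, (⟨comp k C.1, comp_mem_weight C.2 k⟩ : h.core) :=
    Subtype.ext (by rw [AddSubmonoidClass.coe_finsetSum]; exact hn)
  let f : ℕ → A' := fun k => (coreFn hd (⟨comp k C.1, comp_mem_weight C.2 k⟩ : h.core)).1
  have hf : ∀ k, f k ∈ h'.homFn k := fun k => coreFn_mem_homFn hd (Dilation.comp_mem_z k _)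
  have hs : ∑ k ∈ Finset.range n, f k = 0 := by
    rw [← AddSubmonoidClass.coe_finsetSum, ← map_sum, ← hn', hC]
    rfl
  rw [hn']
  exact Finset.sum_eq_zero fun k hk => eq_zero_of_coreFn hd k _ (Dilation.comp_mem_z k _)
    (Subtype.ext (R'.eq_zero_of_sum hf hs (Finset.mem_range.1 hk)))

/-- Local injectivity, needed to glue: multiplied by both bump functions, the two multivectors have
the same function everywhere. -/
theorem agreeAt_of_coreAt (hd : d.HasFrames ι κ l) {U U' : Set M} (pf : PairedFrame d U ι κ l) (pf' : PairedFrame d U' ι κ l)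
    {C C' : h.core} {f : A'} (hC : ∀ x ∈ U, d.CoreAt x C.1 f) (hC' : ∀ x ∈ U', d.CoreAt x C'.1 f)
    {x : M} (hx : x ∈ U) (hx' : x ∈ U') : R.AgreeAt x C.1 C'.1 := by
  have hm : pf.fr.bump * pf'.fr.bump ∈ h.homFn 0 := h.homFn_mul pf.fr.bump_mem pf'.fr.bump_mem
  have e : Frame.baseMult hm * C = Frame.baseMult hm * C' := by
    refine coreFn_injective hd (Subtype.ext (R'.ext _ _ fun y b' => ?_))
    rw [map_mul, map_mul, Subalgebra.coe_mul, Subalgebra.coe_mul, map_mul, map_mul, ev_coreFn_base,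
      map_mul]
    by_cases hy : y ∈ U
    · by_cases hy' : y ∈ U'
      · rw [ev_coreFn hd (hC y hy), ev_coreFn hd (hC' y hy')]
      · rw [pf'.fr.bump_eq_zero hy', mul_zero, zero_mul, zero_mul]
    · rw [pf.fr.bump_eq_zero hy, zero_mul, zero_mul, zero_mul]
  refine R.agreeAt_of_base_mul (r := pf.fr.bump * pf'.fr.bump) (fun b => ?_) (congrArg Subtype.val e)
  rw [map_mul]
  exact mul_ne_zero ((pf.fr.bump_ne x b).2 hx) ((pf'.fr.bump_ne x b).2 hx')

/-- Every homogeneous function on the dual bundle comes from a core multivector. -/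
theorem exists_of_homFn (k : ℕ) : ∀ f ∈ h'.homFn k,
    ∃ C : h.core, C.1 ∈ zdegree (k : ℤ) ∧ (coreFn hd C).1 = f := by
  induction k with
  | zero =>
    intro f hf
    obtain ⟨a, ha⟩ := d.ofDual f
    have ha' : a ∈ h.homFn 0 := R.mem_homFn_zero_of_ev ha
    refine ⟨Frame.baseMult ha', ofFn_mem a, R'.ext _ _ fun x b' => ?_⟩
    rw [ev_coreFn_base, ha, ← R'.ev_homFn_zero hf]
  | succ k ih =>
    intro f hf
    choose U hU hF using id hd
    let F := fun x => (hF x).some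
    -- The fibre derivatives of `f` have degree `k` and come from core multivectors by induction.
    -- Euler's relation for `f` then shows that the Euler sum `D x` corresponds to `f` over the
    -- domain of the frame.
    have ih' : ∀ x c, ∃ C : h.core, C.1 ∈ zdegree (k : ℤ) ∧ (coreFn hd C).1 = (F x).fr'.dfib c f := by
      intro x c
      refine ih _ (h'.mem_zhom_natCast.1 fun t ht => ?_)
      rw [(F x).fr'.dfib_hom c t f ht, hf t, Derivation.map_smul, smul_smul]
      congr 1
      rw [pow_succ, zpow_natCast]
      field_simp
    choose C hC hC' using ih'
    let D : M → h.core := fun x => ((k + 1 : ℝ)⁻¹) • ∑ c, C x c * (F x).fr.par c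
    have hD : ∀ x, ∀ y ∈ U x, d.CoreAt y (D x).1 f := fun x y hy => by
      refine (coreAt_eulerSum (F x) hy _ fun c => coreAt_coreFn hd (C x c) y).congr_right
        fun b' => ?_
      rw [map_smul, map_sum]
      simp only [hC', map_mul]
      rw [(F x).fr'.euler (k + 1) f hf y hy b', smul_eq_mul]
      push_cast
      rw [inv_mul_cancel_left₀ (by positivity)]
    obtain ⟨E, hE1, hE2, hE3⟩ := R.glueMult (m := (k + 1 : ℕ)) (w := 0) (fun x => (D x).1)
      (fun x₀ => by
        filter_upwards [hU x₀] with y hy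
        exact agreeAt_of_coreAt hd (F y) (F x₀) (hD y) (hD x₀) (mem_of_mem_nhds (hU y)) hy)
      (fun x => by
        change (D x).1 ∈ _
        rw [Submodule.coe_smul, AddSubmonoidClass.coe_finsetSum]
        exact Submodule.smul_mem _ _ (Submodule.sum_mem _ fun c _ => by
          simpa using! zdegree_mul (hC x c) ((F x).fr.par_mem c)))
      (fun x => (D x).2)
    exact ⟨⟨E, hE2⟩, hE1, coreFn_eq hd fun x =>
      (hD x x (mem_of_mem_nhds (hU x))).congr_left (hE3 x).symm⟩

theorem coreFn_surjective : Function.Surjective (coreFn hd) := by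
  rintro ⟨f, hf⟩
  have key : ∀ f ∈ ⨆ k, h'.homFn k, ∃ C : h.core, (coreFn hd C).1 = f := by
    intro f hf
    induction hf using Submodule.iSup_induction' with
    | mem k f hf =>
      obtain ⟨C, _, hC⟩ := exists_of_homFn hd k f hf
      exact ⟨C, hC⟩
    | zero => exact ⟨0, by rw [map_zero]; rfl⟩
    | add f g _ _ hf hg =>
      obtain ⟨C, rfl⟩ := hf
      obtain ⟨C', rfl⟩ := hg
      exact ⟨C + C', by rw [map_add]; rfl⟩
  obtain ⟨C, hC⟩ := key f hf
  exact ⟨C, Subtype.ext hC⟩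

/-- Core multivectors are polynomial functions on the dual bundle. -/
def coreEquiv : h.core ≃ₐ[ℝ] h'.polyFn :=
  AlgEquiv.ofBijective (coreFn hd) ⟨coreFn_injective hd, coreFn_surjective hd⟩

theorem mem_zdegree_iff (k : ℕ) (C : h.core) :
    C.1 ∈ zdegree (k : ℤ) ↔ (coreFn hd C).1 ∈ h'.homFn k := by
  refine ⟨coreFn_mem_homFn hd, fun hC => ?_⟩
  obtain ⟨C', h1, h2⟩ := exists_of_homFn hd k _ hC
  rwa [← coreFn_injective hd (Subtype.ext h2)]

theorem exists_of_zhom {m : ℤ} {f : A'} (hf : f ∈ h'.zhom m) :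
    ∃ C : h.core, C.1 ∈ zdegree m ∧ (coreFn hd C).1 = f := by
  rcases lt_or_ge m 0 with hm | hm
  · exact ⟨0, Submodule.zero_mem _, by rw [h'.zhom_neg hm hf, map_zero]; rfl⟩
  · obtain ⟨k, rfl⟩ := Int.eq_ofNat_of_zero_le hm
    exact exists_of_homFn hd k f (h'.mem_zhom_natCast.1 hf)

end DualData
end TwoSides
end
end FWL

namespace FWL
noncomputable section

/-! ### Derivations and fibre-wise linear multivectors in a frame -/

section FrameDerivations
variable {A Γ : Type*} [CommRing A] [Algebra ℝ A] [AddCommGroup Γ] [Module ℝ Γ] [Module A Γ]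
  [IsScalarTower ℝ A Γ]
variable {M : Type*} [TopologicalSpace M]
variable {h : Dilation A Γ} {B W : M → Type*} [∀ x, AddCommGroup (B x)]
    [∀ x, Module ℝ (B x)] [∀ x, AddCommGroup (W x)] [∀ x, Module ℝ (W x)]
variable {R : Realization h B W} {U : Set M} {ι κ l : Type*} [Fintype ι] [Fintype κ]
    [Fintype l] [DecidableEq ι] [DecidableEq κ] [DecidableEq l]
open SymMult

theorem ModDer.symbol_sum {σ : Type*} (s : Finset σ) (T : σ → ModDer A Γ) (a : A) :
    ModDer.symbol (∑ i ∈ s, T i) a = ∑ i ∈ s, ModDer.symbol (T i) a := by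
  classical
  induction s using Finset.induction_on with
  | empty => simp
  | insert i s hi ih => rw [Finset.sum_insert hi, Finset.sum_insert hi, ModDer.symbol_add,
      Derivation.add_apply, ih]

theorem ModDer.op_sum {σ : Type*} (s : Finset σ) (T : σ → ModDer A Γ) (v : Γ) :
    ModDer.op (∑ i ∈ s, T i) v = ∑ i ∈ s, ModDer.op (T i) v := by
  classical
  induction s using Finset.induction_on with
  | empty => simp
  | insert i s hi ih => rw [Finset.sum_insert hi, Finset.sum_insert hi, ModDer.op_add,
      LinearMap.add_apply, ih]

theorem Dilation.zhom_smul_homDer {m n : ℤ} {a : A} {D : ModDer A Γ} (ha : a ∈ h.zhom m)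
    (hD : D ∈ h.homDer n) : a • D ∈ h.homDer (m + n) := fun t ht => by
  refine ⟨fun b => ?_, fun v => ?_⟩
  · simp [((hD t ht).1 _), zpow_add₀ ht, ha t ht, smul_smul, mul_comm]
  · simp [((hD t ht).2 _), zpow_add₀ ht, ha t ht, smul_smul, h.sec_smul, smul_comm a]

theorem ins_ofFn (a b : A) : ins a (ofFn b : SymMult A Γ) = 0 :=
  ext_iff'.2 ⟨fun S => by rw [ins_fst, ofFn_cons]; rfl, fun S v => rfl⟩

namespace Frame

/-- Derivations over a frame domain are determined by their values on coordinates and sections of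
the frame. -/
theorem agreeDerAt_of_coords (fr : Frame R U ι κ l) {x : M} (hx : x ∈ U) {T T' : ModDer A Γ}
    (h1 : ∀ i b, R.ev x b (ModDer.symbol T (fr.crd i)) = R.ev x b (ModDer.symbol T' (fr.crd i)))
    (h2 : ∀ c b, R.ev x b (ModDer.symbol T (fr.fib c)) = R.ev x b (ModDer.symbol T' (fr.fib c)))
    (h3 : ∀ α b, R.evS x b (ModDer.op T (fr.sec α)) = R.evS x b (ModDer.op T' (fr.sec α))) :
    R.AgreeDerAt x T T' := by
  have hs : ∀ a b, R.ev x b (ModDer.symbol T a) = R.ev x b (ModDer.symbol T' a) := fun a b => by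
    have e1 := fr.pointDer_expand (Frame.der_point (R := R) (ModDer.symbol T) x b) hx a
    have e2 := fr.pointDer_expand (Frame.der_point (R := R) (ModDer.symbol T') x b) hx a
    refine e1.trans (Eq.trans ?_ e2.symm)
    congr 1
    · exact Finset.sum_congr rfl fun i _ => congrArg _ (h1 i b)
    · exact Finset.sum_congr rfl fun i _ => congrArg _ (h2 i b)
  refine ⟨hs, fun v b => ?_⟩
  rw [fr.evS_op_expand hx b _ _ (ModDer.op_smul T) v, fr.evS_op_expand hx b _ _ (ModDer.op_smul T') v]
  exact Finset.sum_congr rfl fun α _ => by rw [h3, hs]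

/-- The derivation with given coefficients in a frame. -/
def derOf (fr : Frame R U ι κ l) (p : κ → A) (q : ι → A) (r : l → l → A) : ModDer A Γ :=
  ∑ c, p c • fr.liftDer (fr.dfib c) + ∑ i, q i • fr.liftDer (fr.dcrd i) +
    ∑ α, ∑ β, r α β • fr.matDer α β

variable (fr : Frame R U ι κ l) (p : κ → A) (q : ι → A) (r : l → l → A) {x : M} (hx : x ∈ U)
  (b : B x)

/-- Derivatives in fibre directions have degree `-1`, so their coefficients need one degree more. -/
theorem derOf_mem {m : ℤ} (hp : ∀ c, p c ∈ h.zhom (m + 1)) (hq : ∀ i, q i ∈ h.zhom m)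
    (hr : ∀ α β, r α β ∈ h.zhom m) : fr.derOf p q r ∈ h.homDer m := by
  refine add_mem (add_mem (sum_mem fun c _ => ?_) (sum_mem fun i _ => ?_))
    (sum_mem fun α _ => sum_mem fun β _ => ?_)
  · simpa using h.zhom_smul_homDer (hp c) (fr.liftDer_dfib_mem c)
  · simpa using h.zhom_smul_homDer (hq i) (fr.liftDer_dcrd_mem i)
  · simpa using h.zhom_smul_homDer (hr α β) (fr.matDer_mem α β)

theorem ev_derOf (hx : x ∈ U) (a : A) : R.ev x b (ModDer.symbol (fr.derOf p q r) a) =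
    ∑ c, R.ev x b (p c) * R.ev x b (fr.dfib c a) + ∑ i, R.ev x b (q i) * R.ev x b (fr.dcrd i a) := by
  simp only [derOf, ModDer.symbol_add, Derivation.add_apply, ModDer.symbol_sum, map_add, map_sum,
    ModDer.symbol_smul, Derivation.smul_apply, smul_eq_mul, map_mul, fr.ev_liftDer _ _ hx b,
    matDer_symbol, Derivation.zero_apply, mul_zero, Finset.sum_const_zero, add_zero]

theorem ev_derOf_crd (hx : x ∈ U) (i : ι) :
    R.ev x b (ModDer.symbol (fr.derOf p q r) (fr.crd i)) = R.ev x b (q i) := by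
  simp [fr.ev_derOf p q r b hx, fr.dfib_crd _ _ x hx b, fr.dcrd_crd _ _ x hx b]

theorem ev_derOf_fib (hx : x ∈ U) (c : κ) :
    R.ev x b (ModDer.symbol (fr.derOf p q r) (fr.fib c)) = R.ev x b (p c) := by
  simp [fr.ev_derOf p q r b hx, fr.dfib_fib _ _ x hx b, fr.dcrd_fib _ _ x hx b]

theorem evS_derOf_sec (hx : x ∈ U) (β : l) :
    R.evS x b (ModDer.op (fr.derOf p q r) (fr.sec β)) =
      ∑ α, R.ev x b (r α β) • R.evS x b (fr.sec α) := by
  simp [derOf, ModDer.op_sum, R.evS_smul, fr.evS_liftDer_sec _ hx b, matDer_op,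
    fr.coeff_sec _ _ x hx b]

theorem agreeDerAt_derOf (hx : x ∈ U) (T : ModDer A Γ) : R.AgreeDerAt x (fr.derOf
    (fun c => ModDer.symbol T (fr.fib c)) (fun i => ModDer.symbol T (fr.crd i))
    (fun α β => fr.coeff α (ModDer.op T (fr.sec β)))) T :=
  fr.agreeDerAt_of_coords hx (fun i b => fr.ev_derOf_crd _ _ _ b hx i)
    (fun c b => fr.ev_derOf_fib _ _ _ b hx c)
    (fun α b => (fr.evS_derOf_sec _ _ _ b hx α).trans (fr.ev_sec_expand hx b _).symm)

/-- The fibre-wise linear multivector with given coefficients in a frame. -/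
def linOf (P : κ → h.core) (Q : ι → h.core) (S : l → l → h.core) : h.lin :=
  -- The sign makes the bracket of the generator `c` with a core multivector the insertion of `fib
  -- c`, that is, the derivative in the dual direction.
  ∑ c, P c • (-linMult (fr.fib_mem c) : h.lin) + ∑ i, Q i • fr.nab i + ∑ α, ∑ β, S α β • fr.mat α β

theorem linOf_mem {P : κ → h.core} {Q : ι → h.core} {S : l → l → h.core} {m : ℤ}
    (hP : ∀ c, (P c).1 ∈ zdegree (m + 1)) (hQ : ∀ i, (Q i).1 ∈ zdegree m)
    (hS : ∀ α β, (S α β).1 ∈ zdegree m) : (fr.linOf P Q S).1 ∈ zdegree (m + 1) := by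
  let N : Submodule ℝ h.lin := (zdegree (m + 1)).comap (h.lin.incl : h.lin →ₗ[ℝ] SymMult A Γ)
  change fr.linOf P Q S ∈ N
  refine add_mem (add_mem (sum_mem fun c _ => ?_) (sum_mem fun i _ => ?_))
    (sum_mem fun α _ => sum_mem fun β _ => ?_)
  · change (P c).1 * (-ofFn (fr.fib c)) ∈ zdegree (m + 1)
    simpa using zdegree_mul (hP c) (neg_mem (ofFn_mem (fr.fib c)))
  · exact zdegree_mul (hQ i) (fr.nab_mem i)
  · exact zdegree_mul (hS α β) (fr.mat_mem α β)

/-- Multivectors of negative weight vanish. -/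
theorem agreeAt_zero_of_weight_neg (fr : Frame R U ι κ l) (hx : x ∈ U) {w : ℤ} (hw : w < 0) {D : SymMult A Γ}
    (hD : D ∈ h.weight w) : R.AgreeAt x D 0 :=
  fr.vanish_of_symbol hx hw.le hD fun Y b => by
    have := h.weight_fst hD (S := 0) (by simp) (fr.fib_map_mem Y)
    rw [zero_add] at this
    rw [h.zhom_neg (by simpa using hw) this, map_zero]

/-- Each value `C(a, …, a | v)` has degree `-1`. Hence the second term of `expS_mul` disappears on
pull-backs, as it must for `(C D)^* = j(C) D^*`. -/
theorem evS_expS_core (fr : Frame R U ι κ l) (hx : x ∈ U) {C : SymMult A Γ} (hC : C ∈ h.core) {a : A} (ha : a ∈ h.homFn 1)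
    {v : Γ} (hv : ∀ t, h.sec t v = v) : R.evS x b (expS C a v) = 0 := by
  rw [R.evS_expS]
  refine finsum_eq_zero_of_forall_eq_zero fun k => ?_
  beta_reduce
  rw [fr.evS_neg hx b (m := -1) (by norm_num) fun t ht => ?_, smul_zero]
  have := h.weight_snd hC (S := 0) (T := Multiset.replicate k a) (by simp)
    (fun c hc => by rwa [Multiset.eq_of_mem_replicate hc]) hv t ht
  simpa using this

theorem isMultiDer_coeff (α : l) (D : SymMult A Γ) (v : Γ) :
    IsMultiDer fun S => fr.coeff α (D.1.2 S v) := by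
  obtain ⟨n, hn⟩ := D.2.2.1.bounded
  refine ⟨fun S a b => ?_, fun S r a => ?_, fun S a b => ?_, n, fun S hS => ?_⟩
  · rw [D.2.2.1.add, LinearMap.add_apply, map_add]
  · rw [D.2.2.1.smul, LinearMap.smul_apply, fr.coeff_rsmul]
  · rw [D.2.2.1.mul, LinearMap.add_apply, map_add, LinearMap.smul_apply, LinearMap.smul_apply,
      map_smul, map_smul]
  · rw [hn S hS, LinearMap.zero_apply, map_zero]

/-- The coefficients of the operator part of a fibre-wise linear multivector are core
multivectors. -/
def coeffMult (α : l) (D : h.lin) {v : Γ} (hv : ∀ t, h.sec t v = v) : h.core :=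
  ⟨fr.lift _ (fr.isMultiDer_coeff α D.1 v), fr.lift_mem_weight _ _ fun t ht S => by
    rw [← fr.coeff_hom, (D.2 t ht S).2, hv, fr.coeff_rsmul]
    congr 2
    ring⟩

theorem coeffMult_fst (α : l) (D : h.lin) {v : Γ} (hv : ∀ t, h.sec t v = v) (S : Multiset A) :
    (fr.coeffMult α D hv).1.1.1 S = fr.cut * fr.coeff α (D.1.1.2 S v) := rfl

theorem coeffMult_mem (α : l) (D : h.lin) {v : Γ} (hv : ∀ t, h.sec t v = v) {m : ℤ}
    (hD : D.1 ∈ zdegree (m + 1)) : (fr.coeffMult α D hv).1 ∈ zdegree m :=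
  fr.lift_mem_zdegree _ (fr.isMultiDer_coeff α D.1 v) fun S hS => by
    rw [(hD S).2 fun h => hS (add_right_cancel h), LinearMap.zero_apply, map_zero]

/-- For a pull-back `v`, the polynomial function of `coeffMult α D hv` is therefore, over `U`, the
coefficient `α` of the dual derivation applied to `v`. -/
theorem expF_coeffMult (α : l) (D : h.lin) {v : Γ} (hv : ∀ t, h.sec t v = v) (a : A) :
    expF (fr.coeffMult α D hv).1 a = fr.cut * fr.coeff α (expS D.1 a v) :=
  (expSum_map (LinearMap.mulLeft ℝ fr.cut ∘ₗ (fr.coeff α).restrictScalars ℝ) (vanishes_snd D.1 v) a).symm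

theorem ev_expF_coeffMult (hx : x ∈ U) (α : l) (D : h.lin) {v : Γ} (hv : ∀ t, h.sec t v = v) (a : A) :
    R.ev x b (expF (fr.coeffMult α D hv).1 a) = R.ev x b (fr.coeff α (expS D.1 a v)) := by
  rw [expF_coeffMult, map_mul, fr.cut_eq x hx, one_mul]

/-- The bracket has weight `0` and degree `1`, so only its symbol on a single fibre coordinate
matters, and both derivatives of that coordinate are constant over `U`. -/
theorem lie_nab_par (hx : x ∈ U) (i : ι) (c : κ) :
    R.AgreeAt x ⁅(fr.nab i).1, (fr.par c).1⁆ 0 := by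
  refine fr.vanish_of_symbol (w := 0) hx le_rfl (by simpa using! h.weight_lie (fr.nab i).2 (fr.par c).2)
    fun Y b => ?_
  by_cases hY : Y.card = 1
  · obtain ⟨e, rfl⟩ := Multiset.card_eq_one.1 hY
    rw [Multiset.map_singleton, ← Multiset.cons_zero]
    rw [coe_lie, Prod.fst_sub, Pi.sub_apply]
    simp only [RawMult.pre, unshuffleSum_cons, unshuffleSum_zero]
    have h1 : (fr.nab i).1.1.1 0 = 0 := (fr.nab_mem i 0).1 (by simp)
    have h2 : (fr.par c).1.1.1 0 = 0 := (fr.par_mem c 0).1 (by simp)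
    rw [h1, h2, (additive (fr.nab i).1).zero _ |>.1, (additive (fr.par c).1).zero _ |>.1, add_zero,
      add_zero, map_sub, fr.multi_const (R.isMultiDerAt_fst (fr.nab i).1.2.1 x b) hx 0
        (if c = e then 1 else 0), fr.multi_const (R.isMultiDerAt_fst (fr.par c).1.2.1 x b) hx 0 0,
      sub_zero]
    · intro y hy b
      rw [fr.ev_nab_cons _ _ _ hy, fr.dcrd_fib _ _ _ hy]; simp
    · intro y hy b
      rw [fr.ev_par_cons _ _ _ hy, fr.dfib_fib _ _ _ hy]; simp
  · have := (zdegree_lie (fr.nab_mem i) (fr.par_mem c) (Y.map fr.fib)).1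
      (by rw [Multiset.card_map]; norm_num; exact_mod_cast hY)
    rw [this, map_zero]

theorem lie_mat_par (hx : x ∈ U) (α β : l) (c : κ) :
    R.AgreeAt x ⁅(fr.mat α β).1, (fr.par c).1⁆ 0 := by
  refine fr.vanish_of_symbol (w := 0) hx le_rfl
    (by simpa using! h.weight_lie (fr.mat α β).2 (fr.par c).2) fun Y b => ?_
  rw [coe_lie, Prod.fst_sub, Pi.sub_apply]
  simp only [RawMult.pre]
  simp only [mat_fst]
  rw [unshuffleSum_eq_zero fun _ _ _ => rfl, unshuffleSum_eq_zero fun y z _ =>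
    ((additive (fr.par c).1).zero _).1, sub_zero, map_zero]

/-- `expS D a` is a derivation of `Γ` by `expS_op_smul`, so `evS_op_expand` applies to it. -/
theorem evS_expS_expand (hx : x ∈ U) (D : SymMult A Γ) (a : A) (v : Γ) :
    R.evS x b (expS D a v) = ∑ α, (R.ev x b (fr.coeff α v) • R.evS x b (expS D a (fr.sec α)) +
      R.ev x b (expF (ins (fr.coeff α v) D) a) • R.evS x b (fr.sec α)) := by
  let P : Module.End ℝ Γ :=
    { toFun := expS D a
      map_add' := expS_add_arg D a
      map_smul' := fun r v => by
        have := expSum_map (r • (LinearMap.id : Γ →ₗ[ℝ] Γ)) (vanishes_snd D v) a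
        simp only [LinearMap.smul_apply, LinearMap.id_apply] at this
        simp only [expS, map_smul, RingHom.id_apply]
        exact this.symm }
  exact fr.evS_op_expand hx b P (fun f => expF (ins f D) a) (fun f v => expS_op_smul D a f v) v

end Frame
end FrameDerivations
end
end FWL

namespace FWL
noncomputable section

/-! ### Uniqueness, local formula and existence of the dual derivation -/

section DualDerivations
open SymMult
variable {A Γ : Type*} [CommRing A] [Algebra ℝ A] [AddCommGroup Γ] [Module ℝ Γ] [Module A Γ]
  [IsScalarTower ℝ A Γ]
variable {A' Γ' : Type*} [CommRing A'] [Algebra ℝ A'] [AddCommGroup Γ'] [Module ℝ Γ'] [Module A' Γ']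
  [IsScalarTower ℝ A' Γ']
variable {M : Type*} [TopologicalSpace M]
variable {h : Dilation A Γ} {h' : Dilation A' Γ'} {B B' W : M → Type*} [∀ x, AddCommGroup (B x)]
    [∀ x, Module ℝ (B x)] [∀ x, AddCommGroup (B' x)]
    [∀ x, Module ℝ (B' x)] [∀ x, AddCommGroup (W x)] [∀ x, Module ℝ (W x)]
variable {R : Realization h B W} {R' : Realization h' B' W}

namespace Dilation

theorem lie_mul_core (D : h.lin) (C C' : h.core) : ⁅D, C * C'⁆ = C * ⁅D, C'⁆ + ⁅D, C⁆ * C' :=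
  Subtype.ext (SymMult.lie_mul D.1 C.1 C'.1)

theorem lie_smul_core (r : ℝ) (D : h.lin) (C : h.core) : ⁅D, r • C⁆ = r • ⁅D, C⁆ :=
  Subtype.ext (lie_smul r D.1 C.1)

theorem lie_baseMult (D : h.lin) {f : A} (hf : f ∈ h.homFn 0) :
    ⁅D, (Frame.baseMult hf : h.core)⁆ = ⟨ins f D.1, h.ins_mem_core_of_lin D.2 hf⟩ :=
  Subtype.ext (lie_ofFn D.1 f)

end Dilation

namespace DualData
variable {Φ Γ₀ : Type*} {d : DualData R R' Φ Γ₀} {U : Set M} {ι κ l : Type*} [Fintype ι] [Fintype κ]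
    [Fintype l] [DecidableEq ι] [DecidableEq κ] [DecidableEq l]

theorem sec_pull (v : Γ₀) (t : ℝ) : h.sec t (d.pull v) = d.pull v :=
  R.extS _ _ fun x b => by rw [R.evS_sec, d.evS_pull v x _ 0, d.evS_pull v x _ 0]

/-- The bracket has weight `0 + 0 - 1`, which is negative. -/
theorem lie_core_core (hd : d.HasFrames ι κ l) {C C' : SymMult A Γ} (hC : C ∈ h.core)
    (hC' : C' ∈ h.core) : ⁅C, C'⁆ = 0 := R.agreeAt_ext fun x => by
  obtain ⟨U, hU, ⟨pf⟩⟩ := hd x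
  exact pf.fr.agreeAt_zero_of_weight_neg (mem_of_mem_nhds hU) (w := -1) (by norm_num)
    (by simpa using! h.weight_lie hC hC')

/-- In the Leibniz rule for `⁅E, C * D⁆` the term with `⁅E, C⁆` vanishes by `lie_core_core`. -/
theorem smul_lie_core (hd : d.HasFrames ι κ l) (C : h.core) (D : h.lin) (E : h.core) :
    ⁅C • D, E⁆ = C * ⁅D, E⁆ := Subtype.ext (by
  change ⁅C.1 * D.1, E.1⁆ = C.1 * ⁅D.1, E.1⁆
  have h1 := SymMult.lie_mul E.1 C.1 D.1
  rw [lie_core_core hd E.2 C.2, SymMult.zero_mul', add_zero, ← lie_skew, ← lie_skew E.1 D.1] at h1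
  have h2 : C.1 * -⁅D.1, E.1⁆ = -(C.1 * ⁅D.1, E.1⁆) := by
    rw [← neg_one_smul ℝ, SymMult.mul_comm', SymMult.smul_mul', SymMult.mul_comm', neg_one_smul]
  rw [h2] at h1
  exact neg_injective h1)

variable (hd : d.HasFrames ι κ l)

/-- The derivation `T` is dual to the fibre-wise linear multivector `D` over `x`. -/
def DualAt (x : M) (D : h.lin) (T : ModDer A' Γ') : Prop :=
  (∀ C b', R'.ev x b' (ModDer.symbol T (coreFn hd C).1) = R'.ev x b' (coreFn hd ⁅D, C⁆).1) ∧
    ∀ v φ, R'.evS x (d.val φ x) (ModDer.op T (d.pull' v)) = R.evS x 0 (expS D.1 (d.lin φ) (d.pull v))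

variable {hd} {x : M}

theorem DualAt.congr {D : h.lin} {T T' : ModDer A' Γ'} (hT : DualAt hd x D T)
    (hTT' : R'.AgreeDerAt x T T') : DualAt hd x D T' :=
  ⟨fun C b' => by rw [← hTT'.1, hT.1], fun v φ => by rw [← hTT'.2, hT.2]⟩

theorem DualAt.add {D D' : h.lin} {T T' : ModDer A' Γ'} (hT : DualAt hd x D T)
    (hT' : DualAt hd x D' T') : DualAt hd x (D + D') (T + T') :=
  ⟨fun C b' => by
    rw [ModDer.symbol_add, Derivation.add_apply, map_add, hT.1, hT'.1, add_lie, map_add,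
      Subalgebra.coe_add, map_add],
    fun v φ => by
      rw [ModDer.op_add, LinearMap.add_apply, map_add, hT.2, hT'.2]
      change _ = R.evS x 0 (expS (D.1 + D'.1) _ _)
      rw [expS_add, map_add]⟩

theorem DualAt.zero : DualAt hd x (0 : h.lin) (0 : ModDer A' Γ') :=
  ⟨fun C b' => by
    rw [zero_lie, map_zero]; rfl,
    fun v φ => by
      change R'.evS x _ 0 = R.evS x 0 (expS 0 _ _)
      rw [expS_zero, map_zero, map_zero]⟩

theorem DualAt.sum {σ : Type*} {s : Finset σ} {D : σ → h.lin} {T : σ → ModDer A' Γ'}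
    (hT : ∀ i ∈ s, DualAt hd x (D i) (T i)) : DualAt hd x (∑ i ∈ s, D i) (∑ i ∈ s, T i) := by
  classical
  induction s using Finset.induction_on with
  | empty => exact .zero
  | insert i s hi ih =>
    rw [Finset.sum_insert hi, Finset.sum_insert hi]
    exact (hT i (Finset.mem_insert_self i s)).add
      (ih fun j hj => hT j (Finset.mem_insert_of_mem hj))

theorem evS_expS_smul (pf : PairedFrame d U ι κ l) (hx : x ∈ U) (C : h.core) (D : h.lin) (v : Γ₀) (φ : Φ) :
    R.evS x 0 (expS (C • D : h.lin).1 (d.lin φ) (d.pull v)) =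
      R.ev x 0 (expF C.1 (d.lin φ)) • R.evS x 0 (expS D.1 (d.lin φ) (d.pull v)) := by
  change R.evS x 0 (expS (C.1 * D.1) _ _) = _
  rw [expS_mul, map_add, R.evS_smul, R.evS_smul, pf.fr.evS_expS_core 0 hx C.2 (d.lin_mem φ)
    (sec_pull v), smul_zero, add_zero]

theorem DualAt.smul (pf : PairedFrame d U ι κ l) (hx : x ∈ U) {D : h.lin} {T : ModDer A' Γ'}
    (hT : DualAt hd x D T) (C : h.core) : DualAt hd x (C • D) ((coreFn hd C).1 • T) :=
  ⟨fun E b' => by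
    rw [smul_lie_core hd, ModDer.symbol_smul, Derivation.smul_apply, smul_eq_mul, map_mul, hT.1,
      map_mul, Subalgebra.coe_mul, map_mul],
    fun v φ => by
      rw [ModDer.smul_op, LinearMap.smul_apply, R'.evS_smul, hT.2, coreAt_coreFn hd,
        evS_expS_smul pf hx]⟩

/-- Where the coefficient vanishes nothing has to be known about `D`; this covers the points at
which a bump function is zero. -/
theorem DualAt.smul_of_eq_zero (pf : PairedFrame d U ι κ l) (hx : x ∈ U) (D : h.lin) {f : A}
    (hf : f ∈ h.homFn 0) (h0 : R.ev x 0 f = 0) : DualAt hd x ((Frame.baseMult hf : h.core) • D) 0 :=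
  ⟨fun E b' => by
    rw [smul_lie_core hd, map_mul, Subalgebra.coe_mul, map_mul, ev_coreFn_base, h0, zero_mul]
    exact map_zero _,
    fun v φ => by
      rw [evS_expS_smul pf hx]
      change _ = R.ev x 0 (expF (ofFn f) _) • _
      rw [expF_ofFn, h0, zero_smul]
      exact map_zero _⟩

/-- Duality can be checked on coordinates and sections of a frame. -/
theorem dualAt_of_coords (pf : PairedFrame d U ι κ l) (hx : x ∈ U) {D : h.lin} {T : ModDer A' Γ'}
    (h1 : ∀ i b', R'.ev x b' (ModDer.symbol T (pf.fr'.crd i)) =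
      R'.ev x b' (coreFn hd ⁅D, (Frame.baseMult (pf.fr.crd_mem i) : h.core)⁆).1)
    (h2 : ∀ c b', R'.ev x b' (ModDer.symbol T (pf.fr'.fib c)) =
      R'.ev x b' (coreFn hd ⁅D, pf.fr.par c⁆).1)
    (h3 : ∀ β φ, R'.evS x (d.val φ x) (ModDer.op T (pf.fr'.sec β)) =
      R.evS x 0 (expS D.1 (d.lin φ) (pf.fr.sec β))) : DualAt hd x D T := by
  have hs : ∀ C b', R'.ev x b' (ModDer.symbol T (coreFn hd C).1) =
      R'.ev x b' (coreFn hd ⁅D, C⁆).1 := by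
    intro C b'
    let e : h.core →ₐ[ℝ] ℝ := ((R'.ev x b').comp h'.polyFn.val).comp (coreFn hd)
    let i : h.core →ₗ[ℝ] h.core :=
      { toFun := fun C => ⁅D, C⁆
        map_add' := fun C C' => lie_add D C C'
        map_smul' := fun r C => h.lie_smul_core r D C }
    -- The defect of the first duality condition at `b'` is a derivation of the algebra of core
    -- multivectors, so `coreDer_eq_zero` applies.
    let δ : h.core →ₗ[ℝ] ℝ := (R'.ev x b').toLinearMap ∘ₗ
      (ModDer.symbol T).toLinearMap ∘ₗ (h'.polyFn.val.comp (coreFn hd)).toLinearMap -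
      e.toLinearMap ∘ₗ i
    have hδ' : ∀ C, δ C = R'.ev x b' (ModDer.symbol T (coreFn hd C).1) -
        R'.ev x b' (coreFn hd ⁅D, C⁆).1 := fun _ => rfl
    have hδ : ∀ C C', δ (C * C') = e C • δ C' + e C' • δ C := by
      intro C C'
      simp only [hδ', h.lie_mul_core, map_add, map_mul, Subalgebra.coe_mul, Subalgebra.coe_add,
        Derivation.leibniz, smul_eq_mul]
      change _ = R'.ev x b' (coreFn hd C).1 * _ + R'.ev x b' (coreFn hd C').1 * _
      ring
    refine sub_eq_zero.1 ((hδ' C).symm.trans (pf.fr.coreDer_eq_zero e ?_ δ hδ ?_ ?_ C))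
    · change R'.ev x b' (coreFn hd _).1 ≠ 0
      rw [ev_coreFn_base]
      exact (pf.fr.bump_ne x 0).2 hx
    · intro f hf
      -- Restriction to the zero section turns `δ` into a derivation of `A` at the zero over `x`,
      -- which can be expanded in coordinates. Fibre coordinates restrict to zero, and base
      -- coordinates are covered by `h1`.
      let β : A →ₗ[ℝ] h.core :=
        { toFun := fun f => Frame.baseMult (R.fn_zero_mem f)
          map_add' := fun f g => Subtype.ext (by
            change ofFn _ = ofFn _ + ofFn _
            rw [map_add, map_add])
          map_smul' := fun r f => Subtype.ext (by
            change ofFn _ = r • ofFn _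
            rw [map_smul, map_smul]) }
      have hβ : ∀ f (hf : f ∈ h.homFn 0), β f = Frame.baseMult hf := fun f hf => Subtype.ext (by
        change ofFn _ = ofFn _
        rw [h.fn_homFn_zero hf])
      have hβe : ∀ f, e (β f) = R.ev x 0 f := fun f => by
        change R'.ev x b' (coreFn hd (Frame.baseMult (R.fn_zero_mem f))).1 = _
        rw [ev_coreFn_base, R.ev_fn, zero_smul]
      have hβm : ∀ f g, β (f * g) = β f * β g := fun f g => Subtype.ext (by
        change ofFn _ = ofFn _ * ofFn _
        rw [map_mul, ofFn_mul])
      have hexp := pf.fr.pointDer_expand (b := 0) (δ := δ ∘ₗ β) (fun f g => by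
        simp only [LinearMap.comp_apply, hβm, hδ, hβe]) hx f
      rw [← hβ f hf]
      refine hexp.trans ?_
      rw [Finset.sum_eq_zero, Finset.sum_eq_zero, add_zero]
      · intro c _
        have : β (pf.fr.fib c) = 0 := Subtype.ext (by
          change ofFn _ = 0
          rw [pf.fr.fib_mem c 0, pow_one, zero_smul, map_zero])
        rw [LinearMap.comp_apply, this, map_zero, smul_zero]
      · intro i _
        rw [LinearMap.comp_apply, hβ _ (pf.fr.crd_mem i), hδ', coreFn_crd, h1, sub_self, smul_zero]
    · intro c
      rw [hδ', pf.fr'.ev_der_congr _ hx fun y hy b => ev_coreFn_par hd pf hy c b, h2, sub_self]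
  refine ⟨hs, fun v φ => ?_⟩
  -- The coefficients of a pull-back are base functions. Both sides differentiate them through the
  -- symbols, which are compared by `hs`.
  let a : l → A := fun α => pf.fr.coeff α (d.pull v)
  have ha : ∀ α, a α ∈ h.homFn 0 := fun α t => by
    rw [← pf.fr.coeff_hom, sec_pull, pow_zero, one_smul]
  let a' : l → A' := fun α => (coreFn hd (Frame.baseMult (ha α))).1
  have e1 : R'.evS x (d.val φ x) (ModDer.op T (d.pull' v)) =
      R'.evS x (d.val φ x) (ModDer.op T (∑ α, a' α • pf.fr'.sec α)) := by
    rw [← sub_eq_zero, ← map_sub, ← map_sub]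
    refine pf.fr'.evS_op_local hx _ _ _ (ModDer.op_smul T) fun y hy b => ?_
    rw [map_sub, ← d.evS_pull v y 0, pf.fr.ev_sec_expand hy, map_sum, sub_eq_zero]
    refine Finset.sum_congr rfl fun α _ => ?_
    rw [R'.evS_smul, ev_coreFn_base, pf.sec_eq, pf.sec_eq', d.evS_pull _ _ _ b]
  rw [e1, pf.fr.evS_expS_expand 0 hx, map_sum, map_sum]
  refine Finset.sum_congr rfl fun α _ => ?_
  rw [ModDer.op_smul, map_add, R'.evS_smul, R'.evS_smul, h3, hs, ev_coreFn_base,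
    h.lie_baseMult, coreAt_coreFn hd _ x φ, pf.sec_eq' , ← d.evS_pull _ _ 0, ← pf.sec_eq]

/-- Duality prescribes the symbol on the images of base coordinates and of fibre derivatives, which
are coordinates of the dual bundle over `U`, and the operator on pull-backs, among which are the
frame sections. -/
theorem DualAt.agree (pf : PairedFrame d U ι κ l) (hx : x ∈ U) {D : h.lin} {T T' : ModDer A' Γ'}
    (hT : DualAt hd x D T) (hT' : DualAt hd x D T') : R'.AgreeDerAt x T T' := by
  refine pf.fr'.agreeDerAt_of_coords hx (fun i b => ?_) (fun c b => ?_) fun α b => ?_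
  · rw [← coreFn_crd hd, hT.1, hT'.1]
  · rw [← pf.fr'.ev_der_congr _ hx fun y hy b => ev_coreFn_par hd pf hy c b, hT.1,
      ← pf.fr'.ev_der_congr _ hx fun y hy b => ev_coreFn_par hd pf hy c b, hT'.1]
  · obtain ⟨φ, rfl⟩ := d.surj x b
    rw [pf.sec_eq', hT.2, hT'.2]

theorem ev_coreFn_coeffMult (pf : PairedFrame d U ι κ l) (hx : x ∈ U) (α : l) (D : h.lin) {v : Γ}
    (hv : ∀ t, h.sec t v = v) (φ : Φ) :
    R'.ev x (d.val φ x) (coreFn hd (pf.fr.coeffMult α D hv)).1 =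
      R.ev x 0 (pf.fr.coeff α (expS D.1 (d.lin φ) v)) := by
  rw [coreAt_coreFn hd _ x φ, pf.fr.ev_expF_coeffMult 0 hx]

theorem evS_sec_eq (pf : PairedFrame d U ι κ l) (α : l) (b : B x) (b' : B' x) :
    R'.evS x b' (pf.fr'.sec α) = R.evS x b (pf.fr.sec α) := by
  rw [pf.sec_eq', pf.sec_eq, d.evS_pull _ _ b b']

/-- The dual derivation in a frame. -/
theorem dualAt_derOf (pf : PairedFrame d U ι κ l) (hx : x ∈ U) (D : h.lin) :
    DualAt hd x D (pf.fr'.derOf (fun c => (coreFn hd ⁅D, pf.fr.par c⁆).1)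
      (fun i => (coreFn hd ⁅D, (Frame.baseMult (pf.fr.crd_mem i) : h.core)⁆).1)
      (fun α β => (coreFn hd (pf.fr.coeffMult α D (pf.fr.sec_hom β))).1)) := by
  refine dualAt_of_coords pf hx (fun i b' => pf.fr'.ev_derOf_crd _ _ _ b' hx i)
    (fun c b' => pf.fr'.ev_derOf_fib _ _ _ b' hx c) fun β φ => ?_
  rw [pf.fr'.evS_derOf_sec _ _ _ _ hx, pf.fr.ev_sec_expand hx]
  refine Finset.sum_congr rfl fun α _ => ?_
  rw [ev_coreFn_coeffMult pf hx, evS_sec_eq pf α 0]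

-- Each frame gives a dual derivation over its domain by `dualAt_derOf`. Any two agree over common
-- points by `DualAt.agree`, so they glue; the degree is read off from the coefficients.
variable (hd) in
theorem exists_dual {m : ℤ} (D : h.lin) (hD : D.1 ∈ zdegree (m + 1)) :
    ∃ T ∈ h'.homDer m, ∀ x, DualAt hd x D T := by
  choose U hU hF using id hd
  let F := fun x => (hF x).some
  let T : M → ModDer A' Γ' := fun x => (F x).fr'.derOf (fun c => (coreFn hd ⁅D, (F x).fr.par c⁆).1)
      (fun i => (coreFn hd ⁅D, (Frame.baseMult ((F x).fr.crd_mem i) : h.core)⁆).1)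
      (fun α β => (coreFn hd ((F x).fr.coeffMult α D ((F x).fr.sec_hom β))).1)
  have hT : ∀ x, ∀ y ∈ U x, DualAt hd y D (T x) := fun x y hy => dualAt_derOf (F x) hy D
  obtain ⟨T', h1, h2⟩ := R'.glueDer (m := m) T (fun x₀ => by
    filter_upwards [hU x₀] with y hy
    exact (hT y y (mem_of_mem_nhds (hU y))).agree (F y) (mem_of_mem_nhds (hU y)) (hT x₀ y hy))
    fun x => by
      refine (F x).fr'.derOf_mem _ _ _ (fun c => coreFn_mem_zhom hd ?_)
        (fun i => coreFn_mem_zhom hd ?_) (fun α β => coreFn_mem_zhom hd ?_)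
      · simpa using! zdegree_lie hD ((F x).fr.par_mem c)
      · rw [h.lie_baseMult]
        exact Dilation.ins_zdegree hD _
      · exact (F x).fr.coeffMult_mem α D _ hD
  exact ⟨T', h1, fun x => (hT x x (mem_of_mem_nhds (hU x))).congr
    ⟨fun a b => ((h2 x).1 a b).symm, fun v b => ((h2 x).2 v b).symm⟩⟩

end DualData
end DualDerivations
end
end FWL

namespace FWL
noncomputable section

/-! ### Injectivity and surjectivity of duality, and its compatibility with brackets -/

section DualIsomorphism
open SymMult
variable {A Γ : Type*} [CommRing A] [Algebra ℝ A] [AddCommGroup Γ] [Module ℝ Γ] [Module A Γ]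
  [IsScalarTower ℝ A Γ]
variable {A' Γ' : Type*} [CommRing A'] [Algebra ℝ A'] [AddCommGroup Γ'] [Module ℝ Γ'] [Module A' Γ']
  [IsScalarTower ℝ A' Γ']
variable {M : Type*} [TopologicalSpace M]
variable {h : Dilation A Γ} {h' : Dilation A' Γ'} {B B' W : M → Type*} [∀ x, AddCommGroup (B x)]
    [∀ x, Module ℝ (B x)] [∀ x, AddCommGroup (B' x)]
    [∀ x, Module ℝ (B' x)] [∀ x, AddCommGroup (W x)] [∀ x, Module ℝ (W x)]
variable {R : Realization h B W} {R' : Realization h' B' W}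

namespace DualData
variable {Φ Γ₀ : Type*} {d : DualData R R' Φ Γ₀} {U : Set M} {ι κ l : Type*} [Fintype ι] [Fintype κ]
    [Fintype l] [DecidableEq ι] [DecidableEq κ] [DecidableEq l]
variable {hd : d.HasFrames ι κ l} {x : M}

theorem expS_of_mem_one {D : SymMult A Γ} (hD : D ∈ zdegree 1) (a : A) (v : Γ) :
    expS D a v = D.1.2 0 v := by
  rw [expS, expSum, finsum_eq_single _ 0]
  · simp
  · intro k hk
    rw [(hD _).2 (by rw [Multiset.card_replicate]; omega), LinearMap.zero_apply, smul_zero]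

/-- For a function `ℓ`, `⁅-ℓ, C⁆ = ⁅C, ℓ⁆` is the insertion of `ℓ` into `C`, which `ev_coreFn_ins`
identifies with the derivative in the dual direction. -/
theorem dualAt_neg_linMult (pf : PairedFrame d U ι κ l) (hx : x ∈ U) (c : κ) :
    DualAt hd x (-Frame.linMult (pf.fr.fib_mem c) : h.lin) (pf.fr'.liftDer (pf.fr'.dfib c)) := by
  refine dualAt_of_coords pf hx (fun i b' => ?_) (fun e b' => ?_) fun β φ => ?_
  · rw [pf.fr'.ev_liftDer _ _ hx, pf.fr'.dfib_crd _ _ x hx]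
    have : ⁅(-Frame.linMult (pf.fr.fib_mem c) : h.lin),
        (Frame.baseMult (pf.fr.crd_mem i) : h.core)⁆ = 0 := by
      rw [neg_lie, h.lie_baseMult, neg_eq_zero]
      exact Subtype.ext (ins_ofFn _ _)
    rw [this, map_zero]
    exact (map_zero _).symm
  · have : ⁅(-Frame.linMult (pf.fr.fib_mem c) : h.lin), pf.fr.par e⁆ = pf.fr.insFib c (pf.fr.par e) := by
      rw [neg_lie]
      refine Subtype.ext ?_
      change -⁅ofFn (pf.fr.fib c), (pf.fr.par e).1⁆ = ins (pf.fr.fib c) (pf.fr.par e).1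
      rw [lie_skew, lie_ofFn]
    rw [this, ev_coreFn_ins hd pf hx, pf.fr'.ev_liftDer _ _ hx]
    exact (pf.fr'.ev_der_congr _ hx fun y hy b => ev_coreFn_par hd pf hy e b).symm
  · rw [pf.fr'.evS_liftDer_sec _ hx]
    change _ = R.evS x 0 (expS (-ofFn (pf.fr.fib c)) _ _)
    rw [← neg_one_smul ℝ, expS_smul, expS_ofFn, smul_zero, map_zero]

/-- Base derivatives of dual frames act alike on base coordinates. They annihilate frame sections
and the dual fibre coordinates, the latter on the side of multivectors by `lie_nab_par`. -/
theorem dualAt_nab (pf : PairedFrame d U ι κ l) (hx : x ∈ U) (i : ι) :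
    DualAt hd x (pf.fr.nab i) (pf.fr'.liftDer (pf.fr'.dcrd i)) := by
  refine dualAt_of_coords pf hx (fun j b' => ?_) (fun e b' => ?_) fun β φ => ?_
  · rw [pf.fr'.ev_liftDer _ _ hx, pf.fr'.dcrd_crd _ _ x hx, h.lie_baseMult]
    obtain ⟨φ, rfl⟩ := d.surj x b'
    rw [coreAt_coreFn hd _ x φ]
    change _ = R.ev x 0 (expF (ins (pf.fr.crd j) (pf.fr.nab i).1) _)
    rw [eq_ofFn_of_mem (Dilation.ins_zdegree (m := 0) (pf.fr.nab_mem i) _), expF_ofFn, ins_fst,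
      pf.fr.ev_nab_cons _ _ _ hx, pf.fr.dcrd_crd _ _ x hx]
    simp
  · rw [pf.fr'.ev_liftDer _ _ hx, pf.fr'.dcrd_fib _ _ x hx, ev_coreFn_congr hd (C' := 0)
      (pf.fr.lie_nab_par hx i e), map_zero]
    exact (map_zero _).symm
  · rw [pf.fr'.evS_liftDer_sec _ hx, expS_of_mem_one (pf.fr.nab_mem i)]
    exact (pf.fr.evS_lift_sec _ (isMultiDer_der (pf.fr.dcrd i)) 0 hx 0 β).symm

theorem dualAt_mat (pf : PairedFrame d U ι κ l) (hx : x ∈ U) (α β : l) :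
    DualAt hd x (pf.fr.mat α β) (pf.fr'.matDer α β) := by
  refine dualAt_of_coords pf hx (fun j b' => ?_) (fun e b' => ?_) fun γ φ => ?_
  · rw [h.lie_baseMult]
    have : ins (pf.fr.crd j) (pf.fr.mat α β).1 = 0 := ext_iff'.2 ⟨fun S => rfl, fun S v => by
      rw [ins_snd, pf.fr.mat_snd, if_neg (by simp)]; rfl⟩
    rw [show (⟨ins (pf.fr.crd j) (pf.fr.mat α β).1, _⟩ : h.core) = 0 from Subtype.ext this, map_zero]
    rfl
  · rw [ev_coreFn_congr hd (C' := 0) (pf.fr.lie_mat_par hx α β e), map_zero]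
    rfl
  · rw [expS_of_mem_one (pf.fr.mat_mem α β), pf.fr.mat_snd, pf.fr'.matDer_op, R'.evS_smul,
      pf.fr'.coeff_sec _ _ x hx, if_pos Multiset.card_zero, R.evS_smul, pf.fr.coeff_sec _ _ x hx,
      evS_sec_eq pf α 0]

theorem dualAt_linOf (pf : PairedFrame d U ι κ l) (hx : x ∈ U) (P : κ → h.core) (Q : ι → h.core)
    (S : l → l → h.core) : DualAt hd x (pf.fr.linOf P Q S)
      (pf.fr'.derOf (fun c => (coreFn hd (P c)).1) (fun i => (coreFn hd (Q i)).1)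
        (fun α β => (coreFn hd (S α β)).1)) :=
  ((DualAt.sum fun c _ => (dualAt_neg_linMult pf hx c).smul pf hx _).add
    (.sum fun i _ => (dualAt_nab pf hx i).smul pf hx _)).add
    (.sum fun α _ => .sum fun β _ => (dualAt_mat pf hx α β).smul pf hx _)

/-- The value of the symbol of `D` on fibre coordinates is a fibre-linear function. The bracket with
`par c` differentiates it, up to sign, because the fibre derivatives of the arguments are constant
over `U`. So all its fibre derivatives vanish, and Euler's relation in degree `1` applies. -/
theorem ev_fst_fib_eq_zero (fr : Frame R U ι κ l) {D : h.lin} (hD : ∀ C : h.core, ⁅D, C⁆ = 0)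
    (Y : Multiset κ) (hx : x ∈ U) (b : B x) : R.ev x b (D.1.1.1 (Y.map fr.fib)) = 0 := by
  have ha : D.1.1.1 (Y.map fr.fib) ∈ h.homFn 1 := by
    have := h.weight_fst D.2 (S := 0) (by simp) (fr.fib_map_mem Y)
    rw [zero_add] at this
    exact h.zhom_one.1 (by simpa using this)
  have h1 := fr.euler 1 _ ha x hx b
  rw [Nat.cast_one, one_mul] at h1
  rw [← h1]
  refine Finset.sum_eq_zero fun c _ => ?_
  have h2 : ⁅D.1, (fr.par c).1⁆ = 0 := congrArg Subtype.val (hD (fr.par c))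
  have h3 : R.ev x b ((⁅D.1, (fr.par c).1⁆).1.1 (Y.map fr.fib)) = 0 := by
    rw [h2]; exact map_zero _
  rw [coe_lie, Prod.fst_sub, Pi.sub_apply] at h3
  simp only [RawMult.pre] at h3
  rw [map_sub, Frame.ev_unshuffleSum, Frame.ev_unshuffleSum, unshuffleSum_eq_zero, zero_sub,
    neg_eq_zero] at h3
  · simp only [fr.ev_par_cons _ _ _ hx] at h3
    rw [unshuffleSum_single (fun y => R.ev x b (fr.dfib c (D.1.1.1 y)))] at h3
    rw [h3, zero_mul]
  · intro y z hyz
    by_cases hy : y = 0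
    · rw [hy, (fr.par_mem c 0).1 (by simp), ((additive D.1).zero _).1, map_zero]
    · obtain ⟨f, hf⟩ := Multiset.exists_mem_of_ne_zero hy
      obtain ⟨y', rfl⟩ := Multiset.exists_cons_of_mem hf
      have : f ∈ Y.map fr.fib := by rw [← hyz]; exact Multiset.mem_add.2 (Or.inl hf)
      obtain ⟨e, _, rfl⟩ := Multiset.mem_map.1 this
      refine fr.multi_const (R.isMultiDerAt_fst D.1.2.1 x b) hx z
        (if y'.card = 0 then if c = e then 1 else 0 else 0) fun w hw b => ?_
      rw [fr.ev_par_cons _ _ _ hw, fr.dfib_fib _ _ w hw]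

variable (hd) in
/-- A fibre-wise linear multivector is determined by its dual derivation. -/
theorem eq_zero_of_dual {D : h.lin} (hD : ∀ x, DualAt hd x D 0) : D = 0 := by
  have h0 : ∀ C : h.core, ⁅D, C⁆ = 0 := fun C => coreFn_injective hd (Subtype.ext
    (R'.ext _ _ fun x b' => by rw [← (hD x).1, map_zero]; rfl))
  refine Subtype.ext (R.agreeAt_ext fun x => ?_)
  obtain ⟨U, hU, ⟨pf⟩⟩ := hd x
  have hx := mem_of_mem_nhds hU
  -- The bracket with a base coordinate is its insertion, so `D` vanishes as soon as one argument is
  -- a base coordinate.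
  have hcrd : ∀ i, ins (pf.fr.crd i) D.1 = 0 := fun i => by
    have := h0 (Frame.baseMult (pf.fr.crd_mem i))
    rw [h.lie_baseMult] at this
    exact congrArg Subtype.val this
  refine pf.fr.vanish_of hx D.1 (fun X Y b => ?_) fun X Y α b => ?_
  · by_cases hX : X = 0
    · rw [hX, Multiset.map_zero, zero_add]
      exact ev_fst_fib_eq_zero pf.fr h0 Y hx b
    · obtain ⟨i, hi⟩ := Multiset.exists_mem_of_ne_zero hX
      obtain ⟨X', rfl⟩ := Multiset.exists_cons_of_mem hi
      rw [Multiset.map_cons, Multiset.cons_add, ← ins_fst, hcrd]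
      exact map_zero _
  · by_cases hX : X = 0
    · rw [hX, Multiset.map_zero, zero_add, pf.fr.ev_sec_expand hx]
      refine Finset.sum_eq_zero fun β _ => ?_
      -- The coefficients of `D(… | sec α)` form core multivectors whose polynomial functions are
      -- coefficients of the dual derivation on `sec α`, hence zero.
      have : pf.fr.coeffMult β D (pf.fr.sec_hom α) = 0 := by
        refine coreFn_injective hd (Subtype.ext ?_)
        rw [map_zero]
        refine coreFn_eq hd fun y φ => ?_
        rw [Frame.expF_coeffMult, map_mul, pf.fr.coeff_zero, mul_zero]
        · exact map_zero _
        · rw [pf.sec_eq, ← (hD y).2]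
          exact map_zero _
      have h2 := congrArg (fun C : h.core => R.ev x b (C.1.1.1 (Y.map pf.fr.fib))) this
      simp only [Frame.coeffMult_fst, map_mul, pf.fr.cut_eq x hx, one_mul] at h2
      rw [h2]
      change R.ev x b 0 • _ = _
      rw [map_zero, zero_smul]
    · obtain ⟨i, hi⟩ := Multiset.exists_mem_of_ne_zero hX
      obtain ⟨X', rfl⟩ := Multiset.exists_cons_of_mem hi
      rw [Multiset.map_cons, Multiset.cons_add, ← ins_snd, hcrd]
      exact map_zero _

theorem agreeAt_of_dual (hd : d.HasFrames ι κ l) {U U' : Set M} (pf : PairedFrame d U ι κ l)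
    (pf' : PairedFrame d U' ι κ l) {D D' : h.lin} {T : ModDer A' Γ'}
    (hD : ∀ x ∈ U, DualAt hd x D T) (hD' : ∀ x ∈ U', DualAt hd x D' T) {x : M} (hx : x ∈ U)
    (hx' : x ∈ U') : R.AgreeAt x D.1 D'.1 := by
  have hm : pf.fr.bump * pf'.fr.bump ∈ h.homFn 0 := h.homFn_mul pf.fr.bump_mem pf'.fr.bump_mem
  -- Each of the two dualities holds over one domain only, so both bump functions are needed. The
  -- sign is a scalar in `h.core` in order that `DualAt.smul` applies to it.
  have e : (Frame.baseMult hm : h.core) • (D + (-1 : h.core) • D') = 0 := by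
    refine eq_zero_of_dual hd fun y => ?_
    obtain ⟨V, hV, ⟨pg⟩⟩ := hd y
    have hyV := mem_of_mem_nhds hV
    by_cases hy : y ∈ U ∧ y ∈ U'
    · have := ((hD y hy.1).add ((hD' y hy.2).smul pf' hy.2 (-1))).smul pf hy.1 (Frame.baseMult hm)
      rw [map_neg, map_one] at this
      refine cast ?_ this
      congr 1
      change _ • (T + (-1 : A') • T) = 0
      rw [neg_one_smul, add_neg_cancel, smul_zero]
    · refine DualAt.smul_of_eq_zero pg hyV _ hm ?_
      rw [map_mul]
      by_cases h1 : y ∈ U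
      · rw [pf'.fr.bump_eq_zero fun h2 => hy ⟨h1, h2⟩, mul_zero]
      · rw [pf.fr.bump_eq_zero h1, zero_mul]
  rw [neg_one_smul, smul_add, smul_neg, add_neg_eq_zero] at e
  refine R.agreeAt_of_base_mul (r := pf.fr.bump * pf'.fr.bump) (fun b => ?_) (congrArg Subtype.val e)
  rw [map_mul]
  exact mul_ne_zero ((pf.fr.bump_ne x b).2 hx) ((pf'.fr.bump_ne x b).2 hx')

/-- Brackets with core multivectors differentiate, so agreement is required over all of `U` and not
only at `x`; multiplication by the bump function makes it global. -/
theorem DualAt.congr_left (pf : PairedFrame d U ι κ l) (hx : x ∈ U) {D D' : h.lin}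
    {T : ModDer A' Γ'} (hD : DualAt hd x D T) (hDD' : ∀ y ∈ U, R.AgreeAt y D.1 D'.1) :
    DualAt hd x D' T := by
  have e : (Frame.baseMult pf.fr.bump_mem : h.core) • D = (Frame.baseMult pf.fr.bump_mem : h.core) • D' :=
    Subtype.ext (R.base_mul_eq (U := U) (fun y hy b => pf.fr.bump_eq_zero hy b) hDD')
  refine ⟨fun C b' => ?_, fun v φ => ?_⟩
  · have e1 := congrArg (fun E : h.lin => R'.ev x b' (coreFn hd ⁅E, C⁆).1) e
    simp only [smul_lie_core hd, map_mul, Subalgebra.coe_mul, ev_coreFn_base] at e1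
    rw [hD.1, mul_left_cancel₀ ((pf.fr.bump_ne x 0).2 hx) e1]
  · rw [hD.2, R.evS_expS, R.evS_expS]
    congr 1
    exact funext fun S => (hDD' x hx).2 S _ 0

variable (hd) in
/-- Every homogeneous derivation is dual to a fibre-wise linear multivector. -/
theorem exists_of_homDer {m : ℤ} (T : ModDer A' Γ') (hT : T ∈ h'.homDer m) :
    ∃ D : h.lin, D.1 ∈ zdegree (m + 1) ∧ ∀ x, DualAt hd x D T := by
  choose U hU hF using id hd
  let F := fun x => (hF x).some
  have hsym : ∀ {n : ℤ} {a : A'}, a ∈ h'.zhom n → ModDer.symbol T a ∈ h'.zhom (m + n) := by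
    intro n a ha t ht
    rw [(hT t ht).1, ha t ht, Derivation.map_smul, smul_smul, zpow_add₀ ht]
  -- The coefficients of `T` in the dual frame are homogeneous functions, hence images of core
  -- multivectors. A fibre coordinate has degree one, which accounts for `m + 1`.
  have hP : ∀ x c, ∃ C : h.core, C.1 ∈ zdegree (m + 1) ∧
      (coreFn hd C).1 = ModDer.symbol T ((F x).fr'.fib c) := fun x c =>
    exists_of_zhom hd (hsym (h'.zhom_one.2 ((F x).fr'.fib_mem c)))
  have hQ : ∀ x i, ∃ C : h.core, C.1 ∈ zdegree m ∧
      (coreFn hd C).1 = ModDer.symbol T ((F x).fr'.crd i) := fun x i =>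
    exists_of_zhom hd (by simpa using hsym (h'.zhom_zero.2 ((F x).fr'.crd_mem i)))
  have hS : ∀ x α β, ∃ C : h.core, C.1 ∈ zdegree m ∧
      (coreFn hd C).1 = (F x).fr'.coeff α (ModDer.op T ((F x).fr'.sec β)) := fun x α β =>
    exists_of_zhom hd fun t ht => by
      rw [← (F x).fr'.coeff_hom, (hT t ht).2, (F x).fr'.sec_hom, (F x).fr'.coeff_rsmul]
  choose P hP hP' using hP
  choose Q hQ hQ' using hQ
  choose S hS hS' using hS
  have hD : ∀ x, ∀ y ∈ U x, DualAt hd y ((F x).fr.linOf (P x) (Q x) (S x)) T := fun x y hy => by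
    refine (dualAt_linOf (F x) hy (P x) (Q x) (S x)).congr ?_
    simp only [hP', hQ', hS']
    exact (F x).fr'.agreeDerAt_derOf hy T
  obtain ⟨D, h1, h2, h3⟩ := R.glueMult (m := m + 1) (w := 1)
    (fun x => ((F x).fr.linOf (P x) (Q x) (S x)).1)
    (fun x₀ => by
      filter_upwards [hU x₀] with y hy
      exact agreeAt_of_dual hd (F y) (F x₀) (hD y) (hD x₀) (mem_of_mem_nhds (hU y)) hy)
    (fun x => (F x).fr.linOf_mem (hP x) (hQ x) (hS x)) fun x => ((F x).fr.linOf (P x) (Q x) (S x)).2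
  refine ⟨⟨D, h2⟩, h1, fun x => (hD x x (mem_of_mem_nhds (hU x))).congr_left (F x)
    (mem_of_mem_nhds (hU x)) fun y hy => ?_⟩
  -- The glued multivector is known to agree over `y` with the piece chosen at `y`. Over the domain
  -- of the frame at `x` this piece coincides with the one chosen at `x`.
  have e1 := (h3 y).symm
  have e2 := agreeAt_of_dual hd (F x) (F y) (hD x) (hD y) hy (mem_of_mem_nhds (hU y))
  exact ⟨fun S b => (e2.1 S b).trans (e1.1 S b), fun S v b => (e2.2 S v b).trans (e1.2 S v b)⟩

/-- The image of the pull-back of a section under a dual derivation, in a frame. -/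
theorem evS_op_op (pf : PairedFrame d U ι κ l) {D₁ D₂ : h.lin} {T₁ T₂ : ModDer A' Γ'}
    (h₁ : ∀ x, DualAt hd x D₁ T₁) (h₂ : ∀ x, DualAt hd x D₂ T₂) (hx : x ∈ U) (v : Γ₀) (φ : Φ) :
    R'.evS x (d.val φ x) (ModDer.op T₁ (ModDer.op T₂ (d.pull' v))) =
      R.evS x 0 (expS D₁.1 (d.lin φ) (expS D₂.1 (d.lin φ) (d.pull v))) -
        R.evS x 0 (expS (ins (expF D₁.1 (d.lin φ)) D₂.1) (d.lin φ) (d.pull v)) := by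
  -- `T₂` of a pull-back is not a pull-back: its coefficients in the frame are the polynomial
  -- functions of the `C α`, on which `T₁` acts as the bracket with `D₁`. The part of this bracket
  -- in which `D₁` is inserted into `C α` is the correction term.
  let C : l → h.core := fun α => pf.fr.coeffMult α D₂ (sec_pull (d := d) v)
  have e1 : R'.evS x (d.val φ x) (ModDer.op T₁ (ModDer.op T₂ (d.pull' v))) =
      R'.evS x (d.val φ x) (ModDer.op T₁ (∑ α, (coreFn hd (C α)).1 • pf.fr'.sec α)) := by
    rw [← sub_eq_zero, ← map_sub, ← map_sub]
    refine pf.fr'.evS_op_local hx _ _ _ (ModDer.op_smul T₁) fun y hy b => ?_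
    obtain ⟨ψ, rfl⟩ := d.surj y b
    rw [map_sub, (h₂ y).2, pf.fr.ev_sec_expand hy, map_sum, sub_eq_zero]
    refine Finset.sum_congr rfl fun α _ => ?_
    rw [R'.evS_smul, ev_coreFn_coeffMult pf hy, evS_sec_eq pf α 0]
  have e2 : R.evS x 0 (expS (ins (expF D₁.1 (d.lin φ)) D₂.1) (d.lin φ) (d.pull v)) =
      ∑ α, R.ev x 0 (expF (ins (expF D₁.1 (d.lin φ)) (C α).1) (d.lin φ)) •
        R.evS x 0 (pf.fr.sec α) := by
    rw [pf.fr.ev_sec_expand hx]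
    refine Finset.sum_congr rfl fun α _ => ?_
    congr 1
    have := expSum_map ((R.ev x 0).toLinearMap ∘ₗ (pf.fr.coeff α).restrictScalars ℝ)
      (vanishes_snd (ins (expF D₁.1 (d.lin φ)) D₂.1) (d.pull v)) (d.lin φ)
    refine this.trans ((R.ev_expF _ _ _ _).trans ?_).symm
    congr 1
    funext S
    rw [ins_fst, Frame.coeffMult_fst, map_mul, pf.fr.cut_eq x hx, one_mul]
    rfl
  rw [e1, e2, map_sum, map_sum, pf.fr.evS_expS_expand 0 hx, ← Finset.sum_sub_distrib]
  refine Finset.sum_congr rfl fun α _ => ?_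
  -- The two inserted functions differ by the factor `cut`, which is one over `U`, and insertion
  -- into `D₁` depends only on values over `U`.
  have e3 : R.ev x 0 (expF (ins (expF (C α).1 (d.lin φ)) D₁.1) (d.lin φ)) =
      R.ev x 0 (expF (ins (pf.fr.coeff α (expS D₂.1 (d.lin φ) (d.pull v))) D₁.1) (d.lin φ)) := by
    rw [R.ev_expF, R.ev_expF]
    congr 1
    funext S
    exact pf.fr.multi_congr (R.isMultiDerAt_fst D₁.1.2.1 x 0) hx S fun y hy b =>
      pf.fr.ev_expF_coeffMult b hy α D₂ (sec_pull (d := d) v) _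
  have e4 : R'.ev x (d.val φ x) (coreFn hd ⁅D₁, C α⁆).1 =
      R.ev x 0 (expF (ins (expF (C α).1 (d.lin φ)) D₁.1) (d.lin φ)) -
      R.ev x 0 (expF (ins (expF D₁.1 (d.lin φ)) (C α).1) (d.lin φ)) := by
    rw [coreAt_coreFn hd _ x φ, ← map_sub]
    exact congrArg _ (expF_lie _ _ _)
  rw [ModDer.op_smul, map_add, R'.evS_smul, R'.evS_smul, (h₁ x).1, e4, e3,
    ev_coreFn_coeffMult pf hx, pf.sec_eq', (h₁ x).2, ← pf.sec_eq, ← pf.sec_eq', evS_sec_eq pf α 0,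
    sub_smul, add_sub_assoc]

theorem DualAt.lie {D₁ D₂ : h.lin} {T₁ T₂ : ModDer A' Γ'} (h₁ : ∀ x, DualAt hd x D₁ T₁)
    (h₂ : ∀ x, DualAt hd x D₂ T₂) (x : M) : DualAt hd x ⁅D₁, D₂⁆ ⁅T₁, T₂⁆ := by
  have g₁ : ∀ C, ModDer.symbol T₁ (coreFn hd C).1 = (coreFn hd ⁅D₁, C⁆).1 := fun C =>
    R'.ext _ _ fun y b => (h₁ y).1 C b
  have g₂ : ∀ C, ModDer.symbol T₂ (coreFn hd C).1 = (coreFn hd ⁅D₂, C⁆).1 := fun C =>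
    R'.ext _ _ fun y b => (h₂ y).1 C b
  refine ⟨fun C b' => ?_, fun v φ => ?_⟩
  · rw [ModDer.symbol_lie, g₂, g₁, g₁, g₂, lie_lie, map_sub (coreFn hd), Subalgebra.coe_sub]
  · obtain ⟨U, hU, ⟨pf⟩⟩ := id hd x
    have hx := mem_of_mem_nhds hU
    -- The correction terms of the two compositions are exactly the insertion terms in `expS_lie`.
    rw [ModDer.op_lie, map_sub, evS_op_op pf h₁ h₂ hx, evS_op_op pf h₂ h₁ hx]
    change _ = R.evS x 0 (expS ⁅D₁.1, D₂.1⁆ _ _)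
    rw [expS_lie, map_sub, map_add, map_add]
    abel

end DualData
end DualIsomorphism
end
end FWL

namespace FWL
noncomputable section

/-! ### The Lie-Rinehart structures and the isomorphism between them -/

section LieRinehart
open SymMult
variable {A Γ : Type*} [CommRing A] [Algebra ℝ A] [AddCommGroup Γ] [Module ℝ Γ] [Module A Γ]
  [IsScalarTower ℝ A Γ]
variable {A' Γ' : Type*} [CommRing A'] [Algebra ℝ A'] [AddCommGroup Γ'] [Module ℝ Γ'] [Module A' Γ']
  [IsScalarTower ℝ A' Γ']
variable {M : Type*} [TopologicalSpace M]
variable {h : Dilation A Γ} {h' : Dilation A' Γ'} {B B' W : M → Type*} [∀ x, AddCommGroup (B x)]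
    [∀ x, Module ℝ (B x)] [∀ x, AddCommGroup (B' x)]
    [∀ x, Module ℝ (B' x)] [∀ x, AddCommGroup (W x)] [∀ x, Module ℝ (W x)]
variable {R : Realization h B W} {R' : Realization h' B' W}

/-- Polynomial derivations form a Lie-Rinehart algebra over the polynomial functions. -/
theorem Dilation.lieRinehartRing_polyDer (h : Dilation A Γ) : LieRinehartRing h.polyFn h.polyDer where
  lie_smul_eq_mul' a b D := Subtype.ext rfl
  leibniz_mul_right' D a b := Subtype.ext (by
    change ModDer.symbol D.1 (a.1 * b.1) = a.1 * ModDer.symbol D.1 b.1 + ModDer.symbol D.1 a.1 * b.1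
    rw [Derivation.leibniz, smul_eq_mul, smul_eq_mul, mul_comm b.1])
  leibniz_smul_right' D E a := Subtype.ext (by
    change ⁅D.1, a.1 • E.1⁆ = a.1 • ⁅D.1, E.1⁆ + ModDer.symbol D.1 a.1 • E.1
    refine ModDer.ext (fun b => ?_) fun v => ?_
    · simp only [ModDer.symbol_lie, ModDer.symbol_smul, ModDer.symbol_add, Derivation.smul_apply,
        Derivation.add_apply, smul_eq_mul, Derivation.leibniz]
      ring
    · simp only [ModDer.op_lie, ModDer.smul_op, ModDer.op_add, LinearMap.smul_apply,
        LinearMap.add_apply, ModDer.op_smul]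
      module)

theorem Dilation.lieRinehartAlgebra_polyDer (h : Dilation A Γ) :
    letI := h.lieRinehartRing_polyDer
    LieRinehartAlgebra ℝ h.polyFn h.polyDer :=
  letI := h.lieRinehartRing_polyDer
  { smul_assoc := fun r a D => Subtype.ext (smul_assoc r a.1 D.1)
    smul_lie := fun _ _ _ => Subtype.ext rfl
    lie_smul := fun _ _ _ => Subtype.ext (Derivation.map_smul _ _ _) }

namespace DualData
variable {Φ Γ₀ : Type*} {d : DualData R R' Φ Γ₀} {U : Set M} {ι κ l : Type*} [Fintype ι] [Fintype κ]
    [Fintype l] [DecidableEq ι] [DecidableEq κ] [DecidableEq l]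

/-- Frames enter through linearity of the anchor: it rests on the vanishing of brackets of core
multivectors, which is proved locally. The two Leibniz rules hold for all multivectors. -/
theorem lieRinehartRing_lin (hd : d.HasFrames ι κ l) : LieRinehartRing h.core h.lin where
  lie_smul_eq_mul' C E D := smul_lie_core hd C D E
  leibniz_mul_right' D C E := h.lie_mul_core D C E
  leibniz_smul_right' D E C := Subtype.ext (SymMult.lie_mul D.1 C.1 E.1)

theorem lieRinehartAlgebra_lin (hd : d.HasFrames ι κ l) :
    letI := lieRinehartRing_lin hd
    LieRinehartAlgebra ℝ h.core h.lin :=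
  have := lieRinehartRing_lin hd
  { smul_assoc := fun r C D => Subtype.ext (SymMult.smul_mul' r C.1 D.1)
    smul_lie := fun r D C => Subtype.ext (smul_lie r D.1 C.1)
    lie_smul := fun r D C => Subtype.ext (lie_smul r D.1 C.1) }

variable (hd : d.HasFrames ι κ l)

theorem DualAt.unique {D : h.lin} {T T' : ModDer A' Γ'} (hT : ∀ x, DualAt hd x D T)
    (hT' : ∀ x, DualAt hd x D T') : T = T' := R'.agreeDerAt_ext fun x => by
  obtain ⟨U, hU, ⟨pf⟩⟩ := id hd x
  exact (hT x).agree pf (mem_of_mem_nhds hU) (hT' x)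

/-- A real scalar acts as a constant core multivector, so `DualAt.smul` applies. -/
theorem DualAt.rsmul {D : h.lin} {T : ModDer A' Γ'} (hT : ∀ x, DualAt hd x D T) (r : ℝ) (x : M) :
    DualAt hd x (r • D) (r • T) := by
  obtain ⟨U, hU, ⟨pf⟩⟩ := id hd x
  have := (hT x).smul pf (mem_of_mem_nhds hU) (algebraMap ℝ h.core r)
  rw [AlgHom.commutes] at this
  refine cast ?_ this
  congr 1
  · have := lieRinehartRing_lin hd
    have := lieRinehartAlgebra_lin hd
    exact algebraMap_smul h.core r D
  · exact algebraMap_smul A' r T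

theorem lin_eq_sum (D : h.lin) : ∃ n, D = ∑ k ∈ Finset.range n,
    (⟨comp k D.1, comp_mem_weight D.2 k⟩ : h.lin) := by
  obtain ⟨n, hn⟩ := exists_eq_sum_comp D.1
  refine ⟨n, Subtype.ext ?_⟩
  rw [AddSubmonoidClass.coe_finsetSum]
  exact hn

/-- The component of degree `k` yields a derivation of degree `k - 1`, which is `-1` for the
fibre-linear functions in degree `0`. -/
theorem exists_dual_poly (D : h.lin) : ∃ T ∈ h'.polyDer, ∀ x, DualAt hd x D T := by
  choose T hT hT' using fun k : ℕ => exists_dual hd (m := (k : ℤ) - 1)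
    (⟨comp k D.1, comp_mem_weight D.2 k⟩ : h.lin) (by simpa using Dilation.comp_mem_z k D.1)
  obtain ⟨n, hn⟩ := lin_eq_sum D
  refine ⟨∑ k ∈ Finset.range n, T k, ?_, fun x => ?_⟩
  · exact Submodule.sum_mem (⨆ k, h'.homDer k) fun k _ => Submodule.mem_iSup_of_mem _ (hT k)
  · rw [hn]
    exact .sum fun k _ => hT' k x

/-- The dual derivation of a fibre-wise linear multivector. -/
def dualDer (D : h.lin) : h'.polyDer :=
  ⟨(exists_dual_poly hd D).choose, (exists_dual_poly hd D).choose_spec.1⟩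

theorem dualAt_dualDer (D : h.lin) : ∀ x, DualAt hd x D (dualDer hd D).1 :=
  (exists_dual_poly hd D).choose_spec.2

theorem dualDer_eq {D : h.lin} {T : ModDer A' Γ'} (hT : ∀ x, DualAt hd x D T) :
    (dualDer hd D).1 = T := DualAt.unique hd (dualAt_dualDer hd D) hT

/-- Duality as a morphism of Lie-Rinehart algebras. -/
def dualHom : LieRinehartAlgebra.Hom (coreEquiv hd).toAlgHom h.lin h'.polyDer where
  toFun := dualDer hd
  map_add' D E := Subtype.ext (dualDer_eq hd fun x => (dualAt_dualDer hd D x).add (dualAt_dualDer hd E x))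
  map_smul' r D := Subtype.ext (dualDer_eq hd (DualAt.rsmul hd (dualAt_dualDer hd D) r))
  map_lie' {D E} := Subtype.ext (dualDer_eq hd (DualAt.lie (dualAt_dualDer hd D) (dualAt_dualDer hd E)))
  map_smul_apply' C D := Subtype.ext (dualDer_eq hd fun x => by
    obtain ⟨U, hU, ⟨pf⟩⟩ := id hd x
    exact (dualAt_dualDer hd D x).smul pf (mem_of_mem_nhds hU) C)
  apply_lie' C D := Subtype.ext (R'.ext _ _ fun x b' => ((dualAt_dualDer hd D x).1 C b').symm)

theorem dualDer_injective : Function.Injective (dualHom hd) := by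
  refine (injective_iff_map_eq_zero (dualHom hd).toLieHom).2 fun D hD => eq_zero_of_dual hd fun x => ?_
  have := dualAt_dualDer hd D x
  rwa [show dualDer hd D = 0 from hD] at this

theorem dualDer_surjective : Function.Surjective (dualHom hd) := by
  rintro ⟨T, hT⟩
  have key : ∀ T ∈ ⨆ k, h'.homDer k, ∃ D : h.lin, ∀ x, DualAt hd x D T := by
    intro T hT
    induction hT using Submodule.iSup_induction' with
    | mem k T hT =>
      obtain ⟨D, _, hD⟩ := exists_of_homDer hd T hT
      exact ⟨D, hD⟩
    | zero => exact ⟨0, fun x => .zero⟩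
    | add f g _ _ hf hg =>
      obtain ⟨C, hC⟩ := hf
      obtain ⟨C', hC'⟩ := hg
      exact ⟨C + C', fun x => (hC x).add (hC' x)⟩
  obtain ⟨D, hD⟩ := key T hT
  exact ⟨D, Subtype.ext (dualDer_eq hd hD)⟩

theorem mem_zdegree_iff_homDer (k : ℕ) (D : h.lin) :
    D.1 ∈ zdegree (k : ℤ) ↔ (dualDer hd D).1 ∈ h'.homDer ((k : ℤ) - 1) := by
  constructor
  · intro hD
    obtain ⟨T, h1, h2⟩ := exists_dual hd (m := (k : ℤ) - 1) D (by simpa using hD)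
    rwa [dualDer_eq hd h2]
  -- Surjectivity in a fixed degree gives a multivector of degree `k` with the same dual derivation,
  -- and injectivity identifies it with `D`.
  · intro hD
    obtain ⟨D', h1, h2⟩ := exists_of_homDer hd _ hD
    have : D' = D := dualDer_injective hd (Subtype.ext (dualDer_eq hd h2))
    rw [← this]
    simpa using h1

theorem ev_coreEquiv (C : h.core) (φ : Φ) (x : M) : R'.ev x (d.val φ x) (coreEquiv hd C).1 =
    ∑ᶠ k : ℕ, ((k.factorial : ℝ)⁻¹) • R.ev x 0 (C.1.1.1 (Multiset.replicate k (d.lin φ))) :=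
  (coreAt_coreFn hd C x φ).trans (R.ev_expF C.1 x 0 (d.lin φ))

theorem eq_dualDer_iff (D : h.lin) (T : ModDer A' Γ') :
    ((∀ C, ModDer.symbol T (coreEquiv hd C).1 = (coreEquiv hd ⁅D, C⁆).1) ∧
      ∀ v φ x, R'.evS x (d.val φ x) (ModDer.op T (d.pull' v)) = ∑ᶠ k : ℕ, ((k.factorial : ℝ)⁻¹) •
        R.evS x 0 (D.1.1.2 (Multiset.replicate k (d.lin φ)) (d.pull v))) ↔
      T = (dualDer hd D).1 := by
  have hexp : ∀ v φ x, _ := fun v φ x => R.evS_expS D.1 x 0 (d.lin φ) (d.pull v)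
  constructor
  · rintro ⟨h1, h2⟩
    exact (dualDer_eq hd fun x => ⟨fun C b' => congrArg (R'.ev x b') (h1 C),
      fun v φ => (h2 v φ x).trans (hexp v φ x).symm⟩).symm
  · rintro rfl
    exact ⟨fun C => R'.ext _ _ fun x b' => (dualAt_dualDer hd D x).1 C b',
      fun v φ x => ((dualAt_dualDer hd D x).2 v φ).trans (hexp v φ x)⟩

/-- Linear multivectors are the polynomial derivations over the dual bundle, by an isomorphism of
Lie-Rinehart algebras. -/
theorem exists_duality (hd : d.HasFrames ι κ l) : ∃ (j : h.core ≃ₐ[ℝ] h'.polyFn)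
    (Ψ : LieRinehartAlgebra.Hom j.toAlgHom h.lin h'.polyDer),
    (∀ C φ x, R'.ev x (d.val φ x) (j C).1 = ∑ᶠ k : ℕ, ((k.factorial : ℝ)⁻¹) •
      R.ev x 0 (C.1.1.1 (Multiset.replicate k (d.lin φ)))) ∧
    (∀ (k : ℕ) (C : h.core), C.1 ∈ SymMult.degree k ↔ (j C).1 ∈ h'.homFn k) ∧
    (∀ D T, ((∀ C, ModDer.symbol T (j C).1 = (j ⁅D, C⁆).1) ∧
      ∀ v φ x, R'.evS x (d.val φ x) (ModDer.op T (d.pull' v)) = ∑ᶠ k : ℕ, ((k.factorial : ℝ)⁻¹) •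
        R.evS x 0 (D.1.1.2 (Multiset.replicate k (d.lin φ)) (d.pull v))) ↔ T = (Ψ D).1) ∧
    Function.Bijective Ψ ∧
    ∀ (k : ℕ) (D : h.lin), D.1 ∈ SymMult.degree k ↔ (Ψ D).1 ∈ h'.homDer ((k : ℤ) - 1) :=
  ⟨coreEquiv hd, dualHom hd, ev_coreEquiv hd,
    fun k C => SymMult.mem_degree_iff.trans (mem_zdegree_iff hd k C), eq_dualDer_iff hd,
    ⟨dualDer_injective hd, dualDer_surjective hd⟩,
    fun k D => SymMult.mem_degree_iff.trans (mem_zdegree_iff_homDer hd k D)⟩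

end DualData
end LieRinehart
end
end FWL

/-! ### Hadamard's lemma and coordinates on the total space -/

namespace FWL
noncomputable section

open MeasureTheory Convolution in
/-- Hadamard's lemma: a smooth function is, near a point, the sum of its value and of the
increment paired with a smooth family of linear forms extending the derivative. -/
theorem exists_hadamard {X : Type*} [NormedAddCommGroup X] [NormedSpace ℝ X] {f : X → ℝ}
    (hf : ContDiff ℝ ∞ f) (q : X) : ∃ k : X → X →L[ℝ] ℝ, ContDiff ℝ ∞ k ∧ k q = fderiv ℝ f q ∧
      ∀ z, f z = f q + k z (z - q) := by
  -- The family `k z = ∫₀¹ f'(q + t (z - q)) dt` is written as a convolution with the indicator of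
  -- `(0, 1]`, evaluated at `0`; convolutions depend smoothly on parameters if one factor has
  -- compact support. The bump function, one on `[-1, 1]` and zero beyond distance `2`, provides
  -- this support.
  let κ : ContDiffBump (0 : ℝ) := ⟨1, 2, by norm_num, by norm_num⟩
  -- The sign of `s` compensates for the convolution evaluating `g z` at `0 - t`.
  let g : X → ℝ → X →L[ℝ] ℝ := fun z s => κ s • fderiv ℝ f (q - s • (z - q))
  have hf' : ContDiff ℝ ∞ (fderiv ℝ f) := hf.fderiv_right (by simp)
  have hg : ContDiff ℝ ∞ (Function.uncurry g) := by
    have h1 : ContDiff ℝ ∞ fun p : X × ℝ => κ p.2 := κ.contDiff.comp contDiff_snd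
    have h2 : ContDiff ℝ ∞ fun p : X × ℝ => fderiv ℝ f (q - p.2 • (p.1 - q)) :=
      hf'.comp (contDiff_const.sub (contDiff_snd.smul (contDiff_fst.sub contDiff_const)))
    exact h1.smul h2
  have hloc : LocallyIntegrable (Set.indicator (Set.Ioc (0 : ℝ) 1) fun _ => (1 : ℝ)) volume :=
    (locallyIntegrable_const 1).indicator measurableSet_Ioc
  have hconv := contDiffOn_convolution_right_with_param (n := ⊤) (ContinuousLinearMap.lsmul ℝ ℝ)
    (s := Set.univ) (k := Metric.closedBall (0 : ℝ) 2) (g := g) isOpen_univ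
    (isCompact_closedBall 0 2) (fun p x _ hx => by
      have : κ x = 0 := κ.zero_of_le_dist (by 
        rw [Metric.mem_closedBall, not_le] at hx
        exact hx.le)
      simp [g, this]) hloc (by
        rw [Set.univ_prod_univ]
        exact hg.contDiffOn)
  rw [Set.univ_prod_univ, contDiffOn_univ] at hconv
  have hval : ∀ z, (Set.indicator (Set.Ioc (0 : ℝ) 1) (fun _ => (1 : ℝ))
      ⋆[ContinuousLinearMap.lsmul ℝ ℝ, volume] g z) 0 =
      ∫ t in (0 : ℝ)..1, fderiv ℝ f (q + t • (z - q)) := by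
    intro z
    rw [convolution_def, intervalIntegral.integral_of_le zero_le_one,
      ← integral_indicator measurableSet_Ioc]
    congr 1
    funext t
    by_cases ht : t ∈ Set.Ioc (0 : ℝ) 1
    · have : κ (-t) = 1 := κ.one_of_mem_closedBall (by
        rw [Metric.mem_closedBall, dist_zero_right, norm_neg, Real.norm_eq_abs, abs_of_pos ht.1]
        exact ht.2)
      simp only [Set.indicator_of_mem ht, g, zero_sub, this, one_smul, neg_smul, sub_neg_eq_add,
        ContinuousLinearMap.lsmul_apply]
    · simp [Set.indicator_of_notMem ht]
  refine ⟨fun z => ∫ t in (0 : ℝ)..1, fderiv ℝ f (q + t • (z - q)), ?_, ?_, fun z => ?_⟩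
  · have : ContDiff ℝ ∞ fun z : X => (z, (0 : ℝ)) := contDiff_id.prodMk contDiff_const
    simpa only [Function.comp_def, hval] using hconv.comp this
  · simp
  · have hc : Continuous fun t : ℝ => fderiv ℝ f (q + t • (z - q)) :=
      hf'.continuous.comp (by fun_prop)
    have hd : ∀ t : ℝ, HasDerivAt (fun t : ℝ => f (q + t • (z - q)))
        (fderiv ℝ f (q + t • (z - q)) (z - q)) t := by
      intro t
      have h1 : HasDerivAt (fun t : ℝ => q + t • (z - q)) (z - q) t := by
        simpa using ((hasDerivAt_id t).smul_const (z - q)).const_add q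
      exact ((hf.differentiable (by simp)).differentiableAt.hasFDerivAt).comp_hasDerivAt t h1
    rw [ContinuousLinearMap.intervalIntegral_apply (hc.intervalIntegrable 0 1),
      intervalIntegral.integral_eq_sub_of_hasDerivAt (fun t _ => hd t)
        ((hc.clm_apply continuous_const).intervalIntegrable 0 1)]
    simp

section Coordinates
variable {EM : Type*} [NormedAddCommGroup EM] [NormedSpace ℝ EM]
  {M : Type*} [TopologicalSpace M] [ChartedSpace EM M] [IsManifold 𝓘(ℝ, EM) ∞ M]
  (F : Type*) [NormedAddCommGroup F] [NormedSpace ℝ F]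
  (E : M → Type*) [TopologicalSpace (TotalSpace F E)] [∀ x, TopologicalSpace (E x)]
  [FiberBundle F E] [∀ x, AddCommGroup (E x)] [∀ x, Module ℝ (E x)] [VectorBundle ℝ F E]
  [ContMDiffVectorBundle ∞ F E 𝓘(ℝ, EM)] (x₀ : M)

variable (EM) in
/-- Coordinates on the total space of a vector bundle near the fibre over `x₀`. -/
def coords (p : TotalSpace F E) : EM × F :=
  (extChartAt 𝓘(ℝ, EM) x₀ p.1, (trivializationAt F E x₀ p).2)

/-- The point with given coordinates. -/
def uncoords (z : EM × F) : TotalSpace F E :=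
  (trivializationAt F E x₀).toOpenPartialHomeomorph.symm ((extChartAt 𝓘(ℝ, EM) x₀).symm z.1, z.2)

variable (EM) in
/-- The base of the coordinate domain. -/
def coordBase : Set M := (chartAt EM x₀).source ∩ (trivializationAt F E x₀).baseSet

/-- The range of the coordinates. -/
def coordRange : Set (EM × F) := {z | z.1 ∈ (extChartAt 𝓘(ℝ, EM) x₀).target ∧
  (extChartAt 𝓘(ℝ, EM) x₀).symm z.1 ∈ (trivializationAt F E x₀).baseSet}

variable {F E x₀}

theorem isOpen_coordRange : IsOpen (coordRange F E x₀ : Set (EM × F)) := by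
  have h1 := (continuousOn_extChartAt_symm (I := 𝓘(ℝ, EM)) x₀).isOpen_inter_preimage
    (isOpen_extChartAt_target x₀) (trivializationAt F E x₀).open_baseSet
  exact h1.preimage continuous_fst

theorem isOpen_coordBase : IsOpen (coordBase EM F E x₀) :=
  (chartAt EM x₀).open_source.inter (trivializationAt F E x₀).open_baseSet

theorem mem_coordBase : x₀ ∈ coordBase EM F E x₀ :=
  ⟨mem_chart_source EM x₀, FiberBundle.mem_baseSet_trivializationAt' x₀⟩

theorem coords_mem {p : TotalSpace F E} (hp : p.1 ∈ coordBase EM F E x₀) :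
    coords EM F E x₀ p ∈ coordRange F E x₀ := by
  have h1 : p.1 ∈ (extChartAt 𝓘(ℝ, EM) x₀).source := by rw [extChartAt_source]; exact hp.1
  refine ⟨(extChartAt 𝓘(ℝ, EM) x₀).map_source h1, ?_⟩
  change (extChartAt 𝓘(ℝ, EM) x₀).symm (extChartAt 𝓘(ℝ, EM) x₀ p.1) ∈ _
  rw [(extChartAt 𝓘(ℝ, EM) x₀).left_inv h1]
  exact hp.2

theorem uncoords_coords {p : TotalSpace F E} (hp : p.1 ∈ coordBase EM F E x₀) :
    uncoords F E x₀ (coords EM F E x₀ p) = p := by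
  have h1 : p.1 ∈ (extChartAt 𝓘(ℝ, EM) x₀).source := by rw [extChartAt_source]; exact hp.1
  have h2 := (trivializationAt F E x₀).mem_source.2 hp.2
  change (trivializationAt F E x₀).toOpenPartialHomeomorph.symm
    ((extChartAt 𝓘(ℝ, EM) x₀).symm (extChartAt 𝓘(ℝ, EM) x₀ p.1), (trivializationAt F E x₀ p).2) = p
  rw [(extChartAt 𝓘(ℝ, EM) x₀).left_inv h1]
  refine Eq.trans (congrArg _ ?_) ((trivializationAt F E x₀).toOpenPartialHomeomorph.left_inv h2)
  exact Prod.ext ((trivializationAt F E x₀).coe_fst h2).symm rfl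

theorem proj_uncoords {z : EM × F} (hz : z ∈ coordRange F E x₀) :
    (uncoords F E x₀ z).1 = (extChartAt 𝓘(ℝ, EM) x₀).symm z.1 :=
  (trivializationAt F E x₀).proj_symm_apply' hz.2

theorem coords_uncoords {z : EM × F} (hz : z ∈ coordRange F E x₀) :
    coords EM F E x₀ (uncoords F E x₀ z) = z := by
  refine Prod.ext ?_ ?_
  · change extChartAt 𝓘(ℝ, EM) x₀ (uncoords F E x₀ z).1 = _
    rw [proj_uncoords hz, (extChartAt 𝓘(ℝ, EM) x₀).right_inv hz.1]
  · change (trivializationAt F E x₀ ((trivializationAt F E x₀).toOpenPartialHomeomorph.symm _)).2 = _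
    rw [(trivializationAt F E x₀).apply_symm_apply' hz.2]

theorem uncoords_mem {z : EM × F} (hz : z ∈ coordRange F E x₀) :
    (uncoords F E x₀ z).1 ∈ coordBase EM F E x₀ := by
  rw [proj_uncoords hz]
  exact ⟨by simpa using (extChartAt 𝓘(ℝ, EM) x₀).map_target hz.1, hz.2⟩

theorem contMDiffOn_coords : ContMDiffOn (𝓘(ℝ, EM).prod 𝓘(ℝ, F)) 𝓘(ℝ, EM × F) ∞
    (coords EM F E x₀) (π F E ⁻¹' coordBase EM F E x₀) := by
  refine ContMDiffOn.prodMk_space ?_ ?_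
  · exact (contMDiffOn_extChartAt (I := 𝓘(ℝ, EM)) (x := x₀)).comp
      (Bundle.contMDiff_proj E).contMDiffOn fun p hp => hp.1
  · have h1 := ((trivializationAt F E x₀).contMDiffOn (n := ∞) (IB := 𝓘(ℝ, EM))).mono
      (t := π F E ⁻¹' coordBase EM F E x₀) fun p (hp : p.1 ∈ coordBase EM F E x₀) =>
        (trivializationAt F E x₀).mem_source.2 hp.2
    exact contMDiff_snd.comp_contMDiffOn h1

theorem contMDiffOn_uncoords : ContMDiffOn 𝓘(ℝ, EM × F) (𝓘(ℝ, EM).prod 𝓘(ℝ, F)) ∞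
    (uncoords F E x₀) (coordRange F E x₀ : Set (EM × F)) := by
  refine ((trivializationAt F E x₀).contMDiffOn_symm (n := ∞) (IB := 𝓘(ℝ, EM))).comp
    (t := (trivializationAt F E x₀).target) ?_ fun z hz => (trivializationAt F E x₀).mem_target.2 hz.2
  refine ContMDiffOn.prodMk ?_ contDiff_snd.contMDiff.contMDiffOn
  exact (contMDiffOn_extChartAt_symm x₀).comp contDiff_fst.contMDiff.contMDiffOn fun z hz => hz.1

theorem coords_scale (t : ℝ) {p : TotalSpace F E} (hp : p.1 ∈ coordBase EM F E x₀) :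
    coords EM F E x₀ (scale F t p) = ((coords EM F E x₀ p).1, t • (coords EM F E x₀ p).2) :=
  Prod.ext rfl (((trivializationAt F E x₀).linear ℝ hp.2).2 t p.2)

theorem uncoords_smul (t : ℝ) {z : EM × F} (hz : z ∈ coordRange F E x₀) :
    uncoords F E x₀ (z.1, t • z.2) = scale F t (uncoords F E x₀ z) := by
  have h1 := uncoords_mem hz
  have h2 := coords_scale t h1
  rw [coords_uncoords hz] at h2
  rw [← h2]
  exact uncoords_coords (p := scale F t (uncoords F E x₀ z)) h1

/-- A smooth function in coordinates. -/
def rep (f : TotFun 𝓘(ℝ, EM) F E) (z : EM × F) : ℝ := f (uncoords F E x₀ z)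

variable (x₀) in
theorem contDiffOn_rep (f : TotFun 𝓘(ℝ, EM) F E) :
    ContDiffOn ℝ ∞ (rep (x₀ := x₀) f) (coordRange F E x₀ : Set (EM × F)) :=
  (f.contMDiff.comp_contMDiffOn contMDiffOn_uncoords).contDiffOn

theorem rep_coords (f : TotFun 𝓘(ℝ, EM) F E) {p : TotalSpace F E} (hp : p.1 ∈ coordBase EM F E x₀) :
    rep (x₀ := x₀) f (coords EM F E x₀ p) = f p := by
  rw [rep, uncoords_coords hp]

/-- The smooth function given by a smooth function of the coordinates, cut off on the base. -/
def coordFn {χ : C^∞⟮𝓘(ℝ, EM), M; 𝓘(ℝ, ℝ), ℝ⟯} (hχ : tsupport χ ⊆ coordBase EM F E x₀) {g : EM × F → ℝ}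
    (hg : ContDiffOn ℝ ∞ g (coordRange F E x₀)) : TotFun 𝓘(ℝ, EM) F E :=
  ⟨fun p => χ p.1 * g (coords EM F E x₀ p), by
    -- Smoothness is only at issue over the support of `χ`, where the coordinates are smooth.
    have hs : tsupport (fun p : TotalSpace F E => χ p.1 * g (coords EM F E x₀ p)) ⊆
        π F E ⁻¹' tsupport χ := by
      refine closure_minimal (fun p hp => subset_tsupport _ fun h0 => hp ?_)
        ((isClosed_tsupport _).preimage (FiberBundle.continuous_proj F E))
      change χ p.1 * _ = 0
      rw [show χ p.1 = 0 from h0, zero_mul]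
    refine contMDiff_of_tsupport fun p hp => ?_
    have hp' : p.1 ∈ coordBase EM F E x₀ := hχ (hs hp)
    have hn : π F E ⁻¹' coordBase EM F E x₀ ∈ nhds p :=
      (isOpen_coordBase.preimage (FiberBundle.continuous_proj F E)).mem_nhds hp'
    have h1 : ContMDiffAt (𝓘(ℝ, EM).prod 𝓘(ℝ, F)) 𝓘(ℝ, ℝ) ∞ (fun p : TotalSpace F E => χ p.1) p :=
      (χ.contMDiff.comp (Bundle.contMDiff_proj E)).contMDiffAt
    have h2 := (hg.contMDiffOn.comp contMDiffOn_coords fun p hp => coords_mem hp).contMDiffAt hn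
    exact h1.mul h2⟩

theorem coordFn_apply {χ : C^∞⟮𝓘(ℝ, EM), M; 𝓘(ℝ, ℝ), ℝ⟯} (hχ : tsupport χ ⊆ coordBase EM F E x₀)
    {g : EM × F → ℝ} (hg : ContDiffOn ℝ ∞ g (coordRange F E x₀)) (p : TotalSpace F E) :
    coordFn hχ hg p = χ p.1 * g (coords EM F E x₀ p) := rfl

end Coordinates
end
end FWL

namespace FWL
noncomputable section

/-! ### Evaluation at points of the total space -/

section Realize
variable {EM : Type*} [NormedAddCommGroup EM] [NormedSpace ℝ EM]
  {M : Type*} [TopologicalSpace M] [ChartedSpace EM M] [IsManifold 𝓘(ℝ, EM) ∞ M]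
  (F : Type*) [NormedAddCommGroup F] [NormedSpace ℝ F]
  (E : M → Type*) [TopologicalSpace (TotalSpace F E)] [∀ x, TopologicalSpace (E x)]
  [FiberBundle F E] [∀ x, AddCommGroup (E x)] [∀ x, Module ℝ (E x)] [VectorBundle ℝ F E]
  [ContMDiffVectorBundle ∞ F E 𝓘(ℝ, EM)]
  (G : Type*) [NormedAddCommGroup G] [NormedSpace ℝ G]
  (V : M → Type*) [TopologicalSpace (TotalSpace G V)] [∀ x, TopologicalSpace (V x)]
  [FiberBundle G V] [∀ x, AddCommGroup (V x)] [∀ x, Module ℝ (V x)] [VectorBundle ℝ G V]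
  [ContMDiffVectorBundle ∞ G V 𝓘(ℝ, EM)]

/-- Functions on the total space and sections of the pull-back bundle, evaluated at points. -/
def totRealization : Realization (dilation 𝓘(ℝ, EM) F E G V) E V where
  ev x b :=
    { toFun := fun f => f ⟨x, b⟩
      map_one' := rfl
      map_mul' := fun _ _ => rfl
      map_zero' := rfl
      map_add' := fun _ _ => rfl
      commutes' := fun _ => rfl }
  evS x b :=
    { toFun := fun v => (v ⟨x, b⟩ : V x)
      map_add' := fun _ _ => rfl
      map_smul' := fun _ _ => rfl }
  evS_smul _ _ _ _ := rfl
  ev_fn _ _ _ _ := rfl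
  evS_sec _ _ _ _ := rfl
  ext a a' h := ContMDiffMap.ext fun p => h p.1 p.2
  extS v v' h := ContMDiffSection.ext fun p => h p.1 p.2
  glue a ha := by
    -- Over a neighbourhood of `p.1` the glued function coincides with the smooth function `a p.1`.
    refine ⟨⟨fun p => a p.1 p, fun p => ?_⟩, fun x b => rfl⟩
    refine (a p.1).contMDiff.contMDiffAt.congr_of_eventuallyEq ?_
    filter_upwards [(FiberBundle.continuous_proj F E).continuousAt.eventually (ha p.1)] with q hq
    exact hq q.2
  glueS v hv := by
    refine ⟨⟨fun p => v p.1 p, (contMDiff_pullback_iff _ F E G V _).2 fun p => ?_⟩, fun x b => rfl⟩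
    refine ((contMDiff_pullback_iff 𝓘(ℝ, EM) F E G V (fun q => v p.1 q)).1
      (v p.1).contMDiff).contMDiffAt.congr_of_eventuallyEq ?_
    filter_upwards [(FiberBundle.continuous_proj F E).continuousAt.eventually (hv p.1)] with q hq
    exact congrArg (fun w : V q.1 => (⟨q.1, w⟩ : TotalSpace G V)) (hq q.2)

variable {F E G V}

@[simp] theorem totRealization_ev (x : M) (b : E x) (f : TotFun 𝓘(ℝ, EM) F E) :
    (totRealization F E G V).ev x b f = f ⟨x, b⟩ := rfl

end Realize
end
end FWL

namespace FWL
noncomputable section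

/-! ### Cut-off local sections -/

section LocalSections
variable {EM : Type*} [NormedAddCommGroup EM] [NormedSpace ℝ EM]
  {M : Type*} [TopologicalSpace M] [ChartedSpace EM M] [IsManifold 𝓘(ℝ, EM) ∞ M]
  {G : Type*} [NormedAddCommGroup G] [NormedSpace ℝ G]
  {V : M → Type*} [TopologicalSpace (TotalSpace G V)] [∀ x, TopologicalSpace (V x)]
  [FiberBundle G V] [∀ x, AddCommGroup (V x)] [∀ x, Module ℝ (V x)] [VectorBundle ℝ G V]
  [ContMDiffVectorBundle ∞ G V 𝓘(ℝ, EM)] {x₀ : M} {χ : C^∞⟮𝓘(ℝ, EM), M; 𝓘(ℝ, ℝ), ℝ⟯}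

/-- The section that is constant in the local trivialization, cut off. -/
def cutSec (hχ : tsupport χ ⊆ (trivializationAt G V x₀).baseSet) (w : G) :
    Cₛ^∞⟮𝓘(ℝ, EM); G, V⟯ :=
  ⟨(χ : M → ℝ) • fun x => (trivializationAt G V x₀).symm x w, by
    refine ContMDiffOn.smul_section_of_tsupport χ.contMDiff.contMDiffOn
      (trivializationAt G V x₀).open_baseSet hχ ?_
    rw [(trivializationAt G V x₀).contMDiffOn_section_baseSet_iff]
    refine (contMDiffOn_const (c := w)).congr fun y hy => ?_
    rw [Trivialization.apply_mk_symm _ hy]⟩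

theorem cutSec_apply (hχ : tsupport χ ⊆ (trivializationAt G V x₀).baseSet) (w : G) (x : M) :
    cutSec hχ w x = χ x • (trivializationAt G V x₀).symm x w := rfl

theorem trivializationAt_smul_symm (c : ℝ) (w : G) {x : M}
    (hx : x ∈ (trivializationAt G V x₀).baseSet) :
    (trivializationAt G V x₀ ⟨x, c • (trivializationAt G V x₀).symm x w⟩).2 = c • w := by
  refine (((trivializationAt G V x₀).linear ℝ hx).2 c _).trans ?_
  rw [Trivialization.apply_mk_symm _ hx]

theorem symm_trivializationAt {x : M} (hx : x ∈ (trivializationAt G V x₀).baseSet) (v : V x) :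
    (trivializationAt G V x₀).symm x (trivializationAt G V x₀ ⟨x, v⟩).2 = v :=
  (trivializationAt G V x₀).symm_apply_apply_mk hx v

/-- A product with a cut-off function only depends on values over its support. -/
theorem cut_congr {s : Set M} (hχ : tsupport χ ⊆ s) {N : Type*} [AddCommGroup N] [Module ℝ N] {x : M}
    {a b : N} (h : x ∈ s → a = b) : χ x • a = χ x • b := by
  by_cases hx : x ∈ s
  · rw [h hx]
  · rw [image_eq_zero_of_notMem_tsupport fun h' => hx (hχ h'), zero_smul, zero_smul]

end LocalSections

/-! ### Coordinate derivatives, Euler's relation and the Taylor remainder -/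

section CoordinateFrame
variable {EM : Type*} [NormedAddCommGroup EM] [NormedSpace ℝ EM]
  {M : Type*} [TopologicalSpace M] [ChartedSpace EM M] [IsManifold 𝓘(ℝ, EM) ∞ M]
  {F : Type*} [NormedAddCommGroup F] [NormedSpace ℝ F]
  {E : M → Type*} [TopologicalSpace (TotalSpace F E)] [∀ x, TopologicalSpace (E x)]
  [FiberBundle F E] [∀ x, AddCommGroup (E x)] [∀ x, Module ℝ (E x)] [VectorBundle ℝ F E]
  [ContMDiffVectorBundle ∞ F E 𝓘(ℝ, EM)]
  {G : Type*} [NormedAddCommGroup G] [NormedSpace ℝ G]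
  {V : M → Type*} [TopologicalSpace (TotalSpace G V)] [∀ x, TopologicalSpace (V x)]
  [FiberBundle G V] [∀ x, AddCommGroup (V x)] [∀ x, Module ℝ (V x)] [VectorBundle ℝ G V]
  [ContMDiffVectorBundle ∞ G V 𝓘(ℝ, EM)] {x₀ : M} {χ : C^∞⟮𝓘(ℝ, EM), M; 𝓘(ℝ, ℝ), ℝ⟯}

variable (F E) in
/-- The pull-back of a function on the base. -/
def baseFn (χ : C^∞⟮𝓘(ℝ, EM), M; 𝓘(ℝ, ℝ), ℝ⟯) : TotFun 𝓘(ℝ, EM) F E :=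
  ⟨fun p => χ p.1, χ.contMDiff.comp (Bundle.contMDiff_proj E)⟩

theorem baseFn_mem : baseFn F E χ ∈ (dilation 𝓘(ℝ, EM) F E G V).homFn 0 := fun t =>
  ContMDiffMap.ext fun p => by
    change χ p.1 = t ^ 0 * χ p.1
    rw [pow_zero, one_mul]

theorem fderiv_rep_contDiffOn (f : TotFun 𝓘(ℝ, EM) F E) (w : EM × F) :
    ContDiffOn ℝ ∞ (fun z => fderiv ℝ (rep (x₀ := x₀) f) z w) (coordRange F E x₀) :=
  ((contDiffOn_rep x₀ f).fderiv_of_isOpen isOpen_coordRange (by simp)).clm_apply contDiffOn_const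

theorem differentiableAt_rep (f : TotFun 𝓘(ℝ, EM) F E) {z : EM × F} (hz : z ∈ coordRange F E x₀) :
    DifferentiableAt ℝ (rep (x₀ := x₀) f) z :=
  ((contDiffOn_rep x₀ f).differentiableOn (by simp)).differentiableAt (isOpen_coordRange.mem_nhds hz)

/-- The derivative in a coordinate direction, cut off. -/
def dirDer (hχ : tsupport χ ⊆ coordBase EM F E x₀) (w : EM × F) :
    Derivation ℝ (TotFun 𝓘(ℝ, EM) F E) (TotFun 𝓘(ℝ, EM) F E) :=
  Derivation.mk'
    { toFun := fun f => coordFn hχ (fderiv_rep_contDiffOn f w)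
      map_add' := fun f g => ContMDiffMap.ext fun p => by
        refine (cut_congr hχ fun hp => ?_).trans (smul_add _ _ _)
        exact congrArg (fun l : EM × F →L[ℝ] ℝ => l w)
          (fderiv_add (differentiableAt_rep f (coords_mem hp)) (differentiableAt_rep g (coords_mem hp)))
      map_smul' := fun c f => ContMDiffMap.ext fun p => by
        refine (cut_congr hχ fun hp => ?_).trans (smul_comm _ c _)
        exact congrArg (fun l : EM × F →L[ℝ] ℝ => l w)
          (fderiv_const_smul (differentiableAt_rep f (coords_mem hp)) c) }
    fun f g => ContMDiffMap.ext fun p => by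
      refine (cut_congr (b := f p * fderiv ℝ (rep (x₀ := x₀) g) (coords EM F E x₀ p) w +
        g p * fderiv ℝ (rep (x₀ := x₀) f) (coords EM F E x₀ p) w) hχ fun hp => ?_).trans ?_
      · refine (congrArg (fun l : EM × F →L[ℝ] ℝ => l w)
          (fderiv_mul (differentiableAt_rep f (coords_mem hp))
            (differentiableAt_rep g (coords_mem hp)))).trans ?_
        rw [rep_coords f hp, rep_coords g hp]
        rfl
      · change χ p.1 * _ = f p * (χ p.1 * _) + g p * (χ p.1 * _)
        ring

theorem dirDer_apply (hχ : tsupport χ ⊆ coordBase EM F E x₀) (w : EM × F) (f : TotFun 𝓘(ℝ, EM) F E)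
    (p : TotalSpace F E) :
    dirDer hχ w f p = χ p.1 * fderiv ℝ (rep (x₀ := x₀) f) (coords EM F E x₀ p) w := rfl

theorem dirDer_smul (hχ : tsupport χ ⊆ coordBase EM F E x₀) (c : ℝ) (w : EM × F)
    (f : TotFun 𝓘(ℝ, EM) F E) : dirDer hχ (c • w) f = c • dirDer hχ w f :=
  ContMDiffMap.ext fun p => by
    change χ p.1 * fderiv ℝ (rep (x₀ := x₀) f) (coords EM F E x₀ p) (c • w) =
      c * (χ p.1 * fderiv ℝ (rep (x₀ := x₀) f) (coords EM F E x₀ p) w)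
    rw [map_smul, smul_eq_mul]
    ring

/-- The chain rule for `h_t`, which in coordinates is `(x, y) ↦ (x, t y)`. With the factor `t`
placed on the direction, one formula covers base and fibre directions. -/
theorem scaleFn_dirDer (hχ : tsupport χ ⊆ coordBase EM F E x₀) (t : ℝ) (w : EM × F)
    (f : TotFun 𝓘(ℝ, EM) F E) :
    scaleFn 𝓘(ℝ, EM) F E t (dirDer hχ (w.1, t • w.2) f) =
      dirDer hχ w (scaleFn 𝓘(ℝ, EM) F E t f) := ContMDiffMap.ext fun p => by
  refine cut_congr (x := p.1) hχ fun hp => ?_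
  have hz := coords_mem hp
  have hz' : coords EM F E x₀ (scale F t p) ∈ coordRange F E x₀ := coords_mem (p := scale F t p) hp
  have hev : rep (x₀ := x₀) (scaleFn 𝓘(ℝ, EM) F E t f) =ᶠ[nhds (coords EM F E x₀ p)]
      rep (x₀ := x₀) f ∘ fun z => (z.1, t • z.2) := by
    filter_upwards [isOpen_coordRange.mem_nhds hz] with z hz
    exact congrArg f (uncoords_smul t hz).symm
  have hlin : HasFDerivAt (fun z : EM × F => (z.1, t • z.2))
      ((ContinuousLinearMap.fst ℝ EM F).prod (t • ContinuousLinearMap.snd ℝ EM F))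
      (coords EM F E x₀ p) :=
    ((ContinuousLinearMap.fst ℝ EM F).prod (t • ContinuousLinearMap.snd ℝ EM F)).hasFDerivAt
  have hd := differentiableAt_rep f hz'
  rw [coords_scale t hp] at hd
  beta_reduce
  rw [hev.fderiv_eq, (HasFDerivAt.comp (f := fun z : EM × F => (z.1, t • z.2)) _ hd.hasFDerivAt hlin).fderiv, coords_scale t hp]
  rfl

/-- For use inside derivatives, which is why the cut-off has to be one on a whole neighbourhood. -/
theorem rep_coordFn_eventuallyEq (hχ : tsupport χ ⊆ coordBase EM F E x₀) {g : EM × F → ℝ}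
    (hg : ContDiffOn ℝ ∞ g (coordRange F E x₀)) {p : TotalSpace F E} (hp : p.1 ∈ coordBase EM F E x₀)
    (h1 : ∀ᶠ x in nhds p.1, χ x = 1) :
    rep (x₀ := x₀) (coordFn hχ hg) =ᶠ[nhds (coords EM F E x₀ p)] g := by
  have hz := isOpen_coordRange.mem_nhds (coords_mem hp)
  have hc : ContinuousAt (fun z => (uncoords F E x₀ z).1) (coords EM F E x₀ p) :=
    (FiberBundle.continuous_proj F E).continuousAt.comp
      (contMDiffOn_uncoords.continuousOn.continuousAt hz)
  have h1' := hc.eventually (p := fun x => χ x = 1) (by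
    beta_reduce
    rwa [uncoords_coords hp])
  filter_upwards [hz, h1'] with z hz h1
  rw [rep, coordFn_apply, h1, one_mul, coords_uncoords hz]

/-- Linear coordinates, cut off. -/
def linCrd (hχ : tsupport χ ⊆ coordBase EM F E x₀) (l : EM × F →L[ℝ] ℝ) : TotFun 𝓘(ℝ, EM) F E :=
  coordFn hχ (g := l) l.contDiff.contDiffOn

theorem dirDer_linCrd (hχ : tsupport χ ⊆ coordBase EM F E x₀) (w : EM × F) (l : EM × F →L[ℝ] ℝ)
    {p : TotalSpace F E} (h1 : ∀ᶠ x in nhds p.1, χ x = 1) : dirDer hχ w (linCrd hχ l) p = l w := by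
  have hp : p.1 ∈ coordBase EM F E x₀ := hχ (subset_tsupport _ (by simp [h1.self_of_nhds]))
  rw [dirDer_apply, linCrd, (rep_coordFn_eventuallyEq hχ _ hp h1).fderiv_eq, h1.self_of_nhds, one_mul,
    l.fderiv]

/-- The derivative of `f(t p) = t ^ k f(p)` at `t = 1`. -/
theorem dirDer_euler (hχ : tsupport χ ⊆ coordBase EM F E x₀) {k : ℕ} {f : TotFun 𝓘(ℝ, EM) F E}
    (hf : f ∈ (dilation 𝓘(ℝ, EM) F E G V).homFn k) {p : TotalSpace F E} (h1 : χ p.1 = 1) :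
    dirDer hχ (0, (coords EM F E x₀ p).2) f p = k * f p := by
  have hp : p.1 ∈ coordBase EM F E x₀ := hχ (subset_tsupport _ (by simp [h1]))
  have hz := coords_mem hp
  rw [dirDer_apply, h1, one_mul]
  have hcurve : HasDerivAt (fun t : ℝ => ((coords EM F E x₀ p).1, t • (coords EM F E x₀ p).2))
      (0, (coords EM F E x₀ p).2) 1 := by
    refine (hasDerivAt_const _ _).prodMk ?_
    simpa using (hasDerivAt_id (1 : ℝ)).smul_const (coords EM F E x₀ p).2
  have hd : HasFDerivAt (rep (x₀ := x₀) f) (fderiv ℝ (rep (x₀ := x₀) f) (coords EM F E x₀ p))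
      ((coords EM F E x₀ p).1, (1 : ℝ) • (coords EM F E x₀ p).2) := by
    rw [one_smul]
    exact (differentiableAt_rep f hz).hasFDerivAt
  have h2 := hd.comp_hasDerivAt 1 hcurve
  have h3 : (rep (x₀ := x₀) f) ∘ (fun t : ℝ => ((coords EM F E x₀ p).1, t • (coords EM F E x₀ p).2)) =
      fun t => t ^ k * f p := by
    funext t
    have h4 : f (scale F t p) = t ^ k * f p := congrArg (fun g : TotFun 𝓘(ℝ, EM) F E => g p) (hf t)
    rw [← h4, Function.comp_apply, rep, uncoords_smul t hz, uncoords_coords hp]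
  rw [h3] at h2
  have h5 : HasDerivAt (fun t : ℝ => t ^ k * f p) (k * (1 : ℝ) ^ (k - 1) * f p) 1 :=
    (hasDerivAt_pow k 1).mul_const _
  rw [h2.unique h5, one_pow, mul_one]

/-- A smooth function with vanishing value and derivatives is in the square of the ideal of
functions vanishing at the point. -/
theorem mem_ker_sq [FiniteDimensional ℝ EM] [FiniteDimensional ℝ F]
    (hχ : tsupport χ ⊆ coordBase EM F E x₀) {g : TotFun 𝓘(ℝ, EM) F E} {p : TotalSpace F E}
    (h1 : χ p.1 = 1) (hg : g p = 0) (hd : ∀ w, dirDer hχ w g p = 0) :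
    g ∈ (RingHom.ker ((totRealization F E G V).ev p.1 p.2)) ^ 2 := by
  have hp : p.1 ∈ coordBase EM F E x₀ := hχ (subset_tsupport _ (by simp [h1]))
  set q := coords EM F E x₀ p with hq
  have hz : q ∈ coordRange F E x₀ := coords_mem hp
  obtain ⟨ε, hε, hball⟩ := Metric.isOpen_iff.1 isOpen_coordRange q hz
  -- `rep g` is known to be smooth only on the coordinate range. Multiplied by a bump function
  -- supported there it is smooth on the whole vector space, as `exists_hadamard` requires.
  let κ : ContDiffBump q := ⟨ε / 3, ε / 2, by positivity, by linarith⟩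
  have hκ : tsupport κ ⊆ coordRange F E x₀ := by
    rw [κ.tsupport_eq]
    exact (Metric.closedBall_subset_ball (by change ε / 2 < ε; linarith)).trans hball
  let r : EM × F → ℝ := fun z => κ z * rep (x₀ := x₀) g z
  have hr : ContDiff ℝ ∞ r := contDiff_iff_contDiffAt.2 fun z => by
    by_cases hzκ : z ∈ tsupport κ
    · exact κ.contDiffAt.mul ((contDiffOn_rep x₀ g).contDiffAt (isOpen_coordRange.mem_nhds (hκ hzκ)))
    · refine contDiffAt_const (c := (0 : ℝ)) |>.congr_of_eventuallyEq ?_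
      filter_upwards [(isClosed_tsupport κ).isOpen_compl.mem_nhds hzκ] with y hy
      rw [show r y = κ y * _ from rfl, image_eq_zero_of_notMem_tsupport hy, zero_mul]
  have hrq : fderiv ℝ r q = 0 := by
    have hev : r =ᶠ[nhds q] rep (x₀ := x₀) g := by
      filter_upwards [κ.eventuallyEq_one] with y hy
      rw [show r y = κ y * _ from rfl, hy, Pi.one_apply, one_mul]
    rw [hev.fderiv_eq]
    refine ContinuousLinearMap.ext fun w => ?_
    have := hd w
    rwa [dirDer_apply, h1, one_mul] at this
  obtain ⟨k, hk, hkq, hkz⟩ := exists_hadamard hr q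
  have hr0 : r q = 0 := by
    change κ q * rep (x₀ := x₀) g (coords EM F E x₀ p) = 0
    rw [rep_coords g hp, hg, mul_zero]
  let b := Module.finBasis ℝ (EM × F)
  have hc1 : ∀ a, ContDiffOn ℝ ∞ (fun z => b.coord a (z - q)) (coordRange F E x₀) := fun a =>
    ((b.coord a).toContinuousLinearMap.contDiff.comp (contDiff_id.sub contDiff_const)).contDiffOn
  have hc2 : ∀ a, ContDiffOn ℝ ∞ (fun z => k z (b a)) (coordRange F E x₀) := fun a =>
    (hk.clm_apply contDiff_const).contDiffOn
  -- `K` is one at `p`, so `(1 - K) * g` is a product of two functions vanishing there. By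
  -- Hadamard's lemma `K * g` is a sum of such products: coordinate increments times components of
  -- `k`, which vanish at `q` with the derivative of `r`. `K` contains `χ` twice, once for each
  -- factor.
  let K : TotFun 𝓘(ℝ, EM) F E := baseFn F E χ * coordFn hχ (g := κ) κ.contDiff.contDiffOn
  have hK : K * g = ∑ a, coordFn hχ (hc1 a) * coordFn hχ (hc2 a) := by
    ext x
    have h2 : (∑ a, coordFn hχ (hc1 a) * coordFn hχ (hc2 a)) x =
        ∑ a, coordFn hχ (hc1 a) x * coordFn hχ (hc2 a) x :=
      map_sum ((totRealization F E G V).ev x.1 x.2) _ _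
    rw [h2]
    have h3 : K x * g x = χ x.1 • (χ x.1 * r (coords EM F E x₀ x)) := by
      change χ x.1 * (χ x.1 * κ _) * g x = _
      rw [mul_assoc]
      refine cut_congr hχ fun hx => ?_
      rw [show r (coords EM F E x₀ x) = κ _ * rep g _ from rfl, rep_coords g hx, mul_assoc]
    refine h3.trans ?_
    simp only [coordFn_apply]
    rw [hkz, hr0, zero_add]
    conv_lhs => rw [← b.sum_repr (coords EM F E x₀ x - q), map_sum]
    rw [smul_eq_mul, Finset.mul_sum, Finset.mul_sum]
    refine Finset.sum_congr rfl fun a _ => ?_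
    rw [map_smul, smul_eq_mul, Module.Basis.coord_apply]
    ring
  have hsplit : g = (1 - K) * g + K * g := by ring
  rw [hsplit, pow_two]
  refine Ideal.add_mem _ (Ideal.mul_mem_mul ?_ hg) ?_
  · change 1 - χ p.1 * (χ p.1 * κ q) = 0
    rw [h1, κ.eventuallyEq_one.self_of_nhds, Pi.one_apply, mul_one, mul_one, sub_self]
  · rw [hK]
    refine Ideal.sum_mem _ fun a _ => Ideal.mul_mem_mul ?_ ?_
    · change χ p.1 * b.coord a (q - q) = 0
      rw [sub_self, map_zero, mul_zero]
    · change χ p.1 * k q (b a) = 0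
      rw [hkq, hrq]
      simp

/-- The coefficients of a section with respect to a linear form on the typical fibre, cut off. -/
def cutCoeff (hχ : tsupport χ ⊆ (trivializationAt G V x₀).baseSet) (l : G →L[ℝ] ℝ) :
    PullSec 𝓘(ℝ, EM) F E G V →ₗ[TotFun 𝓘(ℝ, EM) F E] TotFun 𝓘(ℝ, EM) F E where
  toFun v := ⟨fun p => χ p.1 • l (trivializationAt G V x₀ ⟨p.1, v p⟩).2, by
    have hs : tsupport (fun p : TotalSpace F E => χ p.1 • l (trivializationAt G V x₀ ⟨p.1, v p⟩).2) ⊆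
        π F E ⁻¹' tsupport χ := by
      refine closure_minimal (fun p hp => subset_tsupport _ fun h0 => hp ?_)
        ((isClosed_tsupport _).preimage (FiberBundle.continuous_proj F E))
      change χ p.1 • _ = _
      rw [show χ p.1 = 0 from h0, zero_smul]
    refine contMDiff_of_tsupport fun p hp => ?_
    have hp' : p.1 ∈ (trivializationAt G V x₀).baseSet := hχ (hs hp)
    have hv := (contMDiff_pullback_iff 𝓘(ℝ, EM) F E G V fun q => v q).1 v.contMDiff p
    have he := ((trivializationAt G V x₀).contMDiffOn (n := ∞) (IB := 𝓘(ℝ, EM))).contMDiffAt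
      ((trivializationAt G V x₀).open_source.mem_nhds
        ((trivializationAt G V x₀).mem_source (x := ⟨p.1, v p⟩).2 hp'))
    have h1 : ContMDiffAt (𝓘(ℝ, EM).prod 𝓘(ℝ, F)) 𝓘(ℝ, ℝ) ∞ (fun p : TotalSpace F E => χ p.1) p :=
      (χ.contMDiff.comp (Bundle.contMDiff_proj E)).contMDiffAt
    exact h1.smul (l.contMDiff.contMDiffAt.comp p (contMDiffAt_snd.comp p (he.comp p hv)))⟩
  map_add' v w := ContMDiffMap.ext fun p => by
    refine (cut_congr hχ fun hp => ?_).trans (smul_add _ _ _)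
    refine (congrArg l (((trivializationAt G V x₀).linear ℝ hp).1 (v p) (w p))).trans ?_
    exact map_add l _ _
  map_smul' f v := ContMDiffMap.ext fun p => by
    refine (cut_congr hχ fun hp => ?_).trans (smul_comm _ (f p) _)
    refine (congrArg l (((trivializationAt G V x₀).linear ℝ hp).2 (f p) (v p))).trans ?_
    exact map_smul l _ _

end CoordinateFrame
end
end FWL

namespace FWL
noncomputable section

/-! ### The frame of coordinates near a point -/

section CoordinateFrame
variable {EM : Type*} [NormedAddCommGroup EM] [NormedSpace ℝ EM]
  {M : Type*} [TopologicalSpace M] [ChartedSpace EM M] [IsManifold 𝓘(ℝ, EM) ∞ M]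
  {F : Type*} [NormedAddCommGroup F] [NormedSpace ℝ F]
  {E : M → Type*} [TopologicalSpace (TotalSpace F E)] [∀ x, TopologicalSpace (E x)]
  [FiberBundle F E] [∀ x, AddCommGroup (E x)] [∀ x, Module ℝ (E x)] [VectorBundle ℝ F E]
  [ContMDiffVectorBundle ∞ F E 𝓘(ℝ, EM)]
  {G : Type*} [NormedAddCommGroup G] [NormedSpace ℝ G]
  {V : M → Type*} [TopologicalSpace (TotalSpace G V)] [∀ x, TopologicalSpace (V x)]
  [FiberBundle G V] [∀ x, AddCommGroup (V x)] [∀ x, Module ℝ (V x)] [VectorBundle ℝ G V]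
  [ContMDiffVectorBundle ∞ G V 𝓘(ℝ, EM)] {x₀ : M} {χ ρ : C^∞⟮𝓘(ℝ, EM), M; 𝓘(ℝ, ℝ), ℝ⟯}
  [FiniteDimensional ℝ EM] [FiniteDimensional ℝ F] [FiniteDimensional ℝ G]
  {ι κ l : Type*} [Fintype ι] [Fintype κ] [Fintype l] [DecidableEq ι] [DecidableEq κ] [DecidableEq l]

/-- Nonvanishing of `ρ` is an open condition, so derivatives at such points do not see the cut-off
`χ`. -/
theorem eventually_cut_eq_one (hρ : ∀ x, ρ x ≠ 0 → χ x = 1) {x : M} (hx : ρ x ≠ 0) :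
    ∀ᶠ y in nhds x, χ y = 1 :=
  (ρ.contMDiff.continuous.continuousAt.eventually_ne hx).mono hρ

theorem dirDer_fst_hom (hχ : tsupport χ ⊆ coordBase EM F E x₀) (w : EM) (t : ℝ)
    (f : TotFun 𝓘(ℝ, EM) F E) : scaleFn 𝓘(ℝ, EM) F E t (dirDer hχ (w, 0) f) =
      dirDer hχ (w, 0) (scaleFn 𝓘(ℝ, EM) F E t f) := by
  have h := scaleFn_dirDer hχ t (w, 0) f
  rwa [smul_zero] at h

theorem dirDer_snd_hom (hχ : tsupport χ ⊆ coordBase EM F E x₀) (w : F) {t : ℝ} (ht : t ≠ 0)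
    (f : TotFun 𝓘(ℝ, EM) F E) : scaleFn 𝓘(ℝ, EM) F E t (dirDer hχ (0, w) f) =
      t⁻¹ • dirDer hχ (0, w) (scaleFn 𝓘(ℝ, EM) F E t f) := by
  have h := scaleFn_dirDer hχ t (0, w) f
  rw [show ((0, w) : EM × F).1 = t • (0 : EM) from (smul_zero t).symm, ← Prod.smul_mk,
    dirDer_smul, map_smul] at h
  rw [← h, inv_smul_smul₀ ht]

theorem sum_trivializationAt (bG : Module.Basis l ℝ G) {x : M}
    (hx : x ∈ (trivializationAt G V x₀).baseSet) (v : V x) :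
    ∑ α, bG.coord α (trivializationAt G V x₀ ⟨x, v⟩).2 • (trivializationAt G V x₀).symm x (bG α) =
      v := by
  have h := map_sum ((trivializationAt G V x₀).symmₗ ℝ x)
    (fun α => bG.repr (trivializationAt G V x₀ ⟨x, v⟩).2 α • bG α) Finset.univ
  simp only [map_smul, bG.sum_repr] at h
  rw [Trivialization.coe_symmₗ _ hx, symm_trivializationAt hx] at h
  exact h.symm

/-- The linear form of a base coordinate. -/
def fstCrd (bM : Module.Basis ι ℝ EM) (F : Type*) [NormedAddCommGroup F] [NormedSpace ℝ F] (i : ι) :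
    EM × F →L[ℝ] ℝ :=
  (bM.coord i).toContinuousLinearMap ∘L ContinuousLinearMap.fst ℝ EM F

/-- The linear form of a fibre coordinate. -/
def sndCrd (EM : Type*) [NormedAddCommGroup EM] [NormedSpace ℝ EM] (bF : Module.Basis κ ℝ F) (c : κ) :
    EM × F →L[ℝ] ℝ :=
  (bF.coord c).toContinuousLinearMap ∘L ContinuousLinearMap.snd ℝ EM F

theorem fstCrd_apply (bM : Module.Basis ι ℝ EM) (i : ι) (w : EM × F) :
    fstCrd bM F i w = bM.repr w.1 i := rfl

theorem sndCrd_apply (bF : Module.Basis κ ℝ F) (c : κ) (w : EM × F) :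
    sndCrd EM bF c w = bF.repr w.2 c := rfl

theorem linCrd_fst_hom (hχ : tsupport χ ⊆ coordBase EM F E x₀) (bM : Module.Basis ι ℝ EM) (i : ι) :
    linCrd hχ (fstCrd bM F i) ∈ (dilation 𝓘(ℝ, EM) F E G V).homFn 0 := fun t =>
  ContMDiffMap.ext fun p => by
    change linCrd hχ (fstCrd bM F i) (scale F t p) = t ^ 0 * linCrd hχ (fstCrd bM F i) p
    rw [pow_zero, one_mul]
    exact cut_congr (x := p.1) hχ fun hp => by
      rw [coords_scale t hp]
      rfl

theorem linCrd_snd_hom (hχ : tsupport χ ⊆ coordBase EM F E x₀) (bF : Module.Basis κ ℝ F) (c : κ) :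
    linCrd hχ (sndCrd EM bF c) ∈ (dilation 𝓘(ℝ, EM) F E G V).homFn 1 := fun t =>
  ContMDiffMap.ext fun p => by
    change linCrd hχ (sndCrd EM bF c) (scale F t p) = t ^ 1 * linCrd hχ (sndCrd EM bF c) p
    rw [pow_one]
    refine (cut_congr (x := p.1) (b := t * sndCrd EM bF c (coords EM F E x₀ p)) hχ
      fun hp => ?_).trans (mul_left_comm _ _ _)
    rw [coords_scale t hp, sndCrd_apply, sndCrd_apply, map_smul]
    rfl

/-- The frame of coordinates and a local frame of the second bundle near a point. -/
def coordFrame (hχ : tsupport χ ⊆ coordBase EM F E x₀)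
    (hχV : tsupport χ ⊆ (trivializationAt G V x₀).baseSet) (hρ : ∀ x, ρ x ≠ 0 → χ x = 1)
    (bM : Module.Basis ι ℝ EM) (bF : Module.Basis κ ℝ F) (bG : Module.Basis l ℝ G) :
    Frame (totRealization (EM := EM) F E G V) {x | ρ x ≠ 0} ι κ l where
  bump := baseFn F E ρ
  -- The frame sections and the coefficients carry one factor `χ` each.
  cut := baseFn F E χ * baseFn F E χ
  bump_mem := baseFn_mem
  cut_mem := Dilation.homFn_mul _ baseFn_mem baseFn_mem
  bump_ne _ _ := Iff.rfl
  cut_eq x hx _ := by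
    change χ x * χ x = 1
    rw [hρ x hx, mul_one]
  crd i := linCrd hχ (fstCrd bM F i)
  crd_mem := linCrd_fst_hom hχ bM
  fib c := linCrd hχ (sndCrd EM bF c)
  fib_mem := linCrd_snd_hom hχ bF
  dcrd i := dirDer hχ (bM i, 0)
  dcrd_hom i t a _ := dirDer_fst_hom hχ (bM i) t a
  dfib c := dirDer hχ (0, bF c)
  dfib_hom c t a ht := dirDer_snd_hom hχ (bF c) ht a
  sec α := pullSec 𝓘(ℝ, EM) F E G V (cutSec hχV (bG α))
  sec_hom _ _ := rfl
  coeff α := cutCoeff hχV (bG.coord α).toContinuousLinearMap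
  coeff_hom _ _ _ := rfl
  coeff_zero α v x b hv := by
    have hv' : v ⟨x, b⟩ = (0 : V x) := hv
    change χ x • bG.coord α (trivializationAt G V x₀ ⟨x, (v ⟨x, b⟩ : V x)⟩).2 = 0
    rw [hv']
    refine (cut_congr (b := (0 : ℝ)) hχV fun hx => ?_).trans (smul_zero _)
    have h0 := ((trivializationAt G V x₀).linear ℝ hx).2 0 (0 : V x)
    simp only [zero_smul] at h0
    rw [h0, map_zero]
  expand v := (totRealization F E G V).extS _ _ fun x b => by
    rw [map_sum]
    change (χ x * χ x) • (v ⟨x, b⟩ : V x) =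
      ∑ α, (χ x • bG.coord α (trivializationAt G V x₀ ⟨x, (v ⟨x, b⟩ : V x)⟩).2) •
        (χ x • (trivializationAt G V x₀).symm x (bG α))
    rw [mul_smul]
    refine (cut_congr (b := ∑ α, bG.coord α (trivializationAt G V x₀ ⟨x, (v ⟨x, b⟩ : V x)⟩).2 •
      (χ x • (trivializationAt G V x₀).symm x (bG α))) hχV fun hx => ?_).trans ?_
    · refine (congrArg (χ x • ·) (sum_trivializationAt bG hx (v ⟨x, b⟩ : V x)).symm).trans ?_
      refine Finset.smul_sum.trans (Finset.sum_congr rfl fun α _ => smul_comm _ _ _)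
    · rw [Finset.smul_sum]
      exact Finset.sum_congr rfl fun α _ => (smul_assoc _ _ _).symm
  coeff_sec α β x hx b := by
    have h1 := hρ x hx
    have hx' : x ∈ (trivializationAt G V x₀).baseSet :=
      hχV (subset_tsupport _ (by simp [h1]))
    change χ x • bG.coord α (trivializationAt G V x₀
      ⟨x, χ x • (trivializationAt G V x₀).symm x (bG β)⟩).2 = _
    rw [trivializationAt_smul_symm _ _ hx', h1, one_smul, one_smul, Module.Basis.coord_apply,
      Module.Basis.repr_self, Finsupp.single_apply]
    exact if_congr eq_comm rfl rfl
  dcrd_crd i j x hx b := by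
    refine (dirDer_linCrd hχ _ _ (p := ⟨x, b⟩) (eventually_cut_eq_one hρ hx)).trans ?_
    rw [fstCrd_apply, Module.Basis.repr_self, Finsupp.single_apply]
  dcrd_fib i c x hx b := by
    refine (dirDer_linCrd hχ _ _ (p := ⟨x, b⟩) (eventually_cut_eq_one hρ hx)).trans ?_
    rw [sndCrd_apply, map_zero, Finsupp.zero_apply]
  dfib_crd c i x hx b := by
    refine (dirDer_linCrd hχ _ _ (p := ⟨x, b⟩) (eventually_cut_eq_one hρ hx)).trans ?_
    rw [fstCrd_apply, map_zero, Finsupp.zero_apply]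
  dfib_fib c d x hx b := by
    refine (dirDer_linCrd hχ _ _ (p := ⟨x, b⟩) (eventually_cut_eq_one hρ hx)).trans ?_
    rw [sndCrd_apply, Module.Basis.repr_self, Finsupp.single_apply]
  hadamard f x hx b := by
    have h1 := eventually_cut_eq_one hρ hx
    -- The value of the remainder vanishes at the point; its derivative in direction `w` does so
    -- after `w` is expanded in the basis of coordinate directions.
    refine mem_ker_sq hχ (p := ⟨x, b⟩) (hρ x hx) ?_ fun w => ?_
    · refine (totRealization_ev (G := G) (V := V) x b _).symm.trans ?_
      simp only [map_sub, map_sum, map_smul, AlgHom.commutes, Algebra.algebraMap_self_apply, sub_self,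
        smul_zero, Finset.sum_const_zero]
    · refine (totRealization_ev (G := G) (V := V) x b _).symm.trans ?_
      have hc : ∀ i, (totRealization F E G V).ev x b (dirDer hχ w (linCrd hχ (fstCrd bM F i))) = bM.repr w.1 i := fun i =>
        dirDer_linCrd hχ w _ (p := ⟨x, b⟩) h1
      have hf : ∀ c, (totRealization F E G V).ev x b (dirDer hχ w (linCrd hχ (sndCrd EM bF c))) = bF.repr w.2 c := fun c =>
        dirDer_linCrd hχ w _ (p := ⟨x, b⟩) h1
      have hd : ∀ u, (totRealization F E G V).ev x b (dirDer hχ u f) =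
          fderiv ℝ (rep (x₀ := x₀) f) (coords EM F E x₀ ⟨x, b⟩) u := fun u => by
        refine (dirDer_apply hχ u f ⟨x, b⟩).trans ?_
        rw [hρ x hx, one_mul]
      simp only [map_sub, map_sum, Derivation.map_smul, map_smul, Derivation.map_algebraMap, hc, hf,
        hd, sub_zero]
      have hw : w = ∑ i, bM.repr w.1 i • ((bM i, 0) : EM × F) +
          ∑ c, bF.repr w.2 c • ((0, bF c) : EM × F) := by
        refine Prod.ext ?_ ?_
        · simp [Prod.fst_sum, bM.sum_repr]
        · simp [Prod.snd_sum, bF.sum_repr]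
      conv_lhs => enter [1, 1]; rw [hw]
      simp only [map_add, map_sum, map_smul, smul_eq_mul, mul_comm]
      ring
  euler k f hf x hx b := by
    have h1 := hρ x hx
    refine Eq.trans ?_ (dirDer_euler hχ hf (p := ⟨x, b⟩) h1)
    have hw : ((0, (coords EM F E x₀ ⟨x, b⟩).2) : EM × F) =
        ∑ c, bF.repr (coords EM F E x₀ ⟨x, b⟩).2 c • ((0, bF c) : EM × F) := by
      refine Prod.ext ?_ ?_
      · simp [Prod.fst_sum]
      · simp [Prod.snd_sum, bF.sum_repr]
    rw [dirDer_apply, hw, map_sum, Finset.mul_sum]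
    refine Finset.sum_congr rfl fun c _ => ?_
    change (χ x * _) * (χ x * bF.repr _ c) = χ x * _
    rw [h1, map_smul, one_mul, one_mul, one_mul, mul_comm]
    rfl

end CoordinateFrame
end
end FWL

namespace FWL
noncomputable section

/-! ### A vector bundle and its dual -/

section DualBundles
variable {EM : Type*} [NormedAddCommGroup EM] [NormedSpace ℝ EM]
  {M : Type*} [TopologicalSpace M] [ChartedSpace EM M] [IsManifold 𝓘(ℝ, EM) ∞ M]
  {F : Type*} [NormedAddCommGroup F] [NormedSpace ℝ F]
  {E : M → Type*} [TopologicalSpace (TotalSpace F E)] [∀ x, TopologicalSpace (E x)]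
  [FiberBundle F E] [∀ x, AddCommGroup (E x)] [∀ x, Module ℝ (E x)] [VectorBundle ℝ F E]
  [ContMDiffVectorBundle ∞ F E 𝓘(ℝ, EM)]
  {G : Type*} [NormedAddCommGroup G] [NormedSpace ℝ G]
  {V : M → Type*} [TopologicalSpace (TotalSpace G V)] [∀ x, TopologicalSpace (V x)]
  [FiberBundle G V] [∀ x, AddCommGroup (V x)] [∀ x, Module ℝ (V x)] [VectorBundle ℝ G V]
  [ContMDiffVectorBundle ∞ G V 𝓘(ℝ, EM)] {x₀ : M} {χ ρ : C^∞⟮𝓘(ℝ, EM), M; 𝓘(ℝ, ℝ), ℝ⟯}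

/-- Two nested bump functions, the second supported where the first is one: `χ` cuts off coordinates
and frames, and the set where `ρ` is nonzero becomes the domain of the frame. -/
theorem exists_cutoff [FiniteDimensional ℝ EM] [T2Space M] {s : Set M} (hs : s ∈ nhds x₀) :
    ∃ χ ρ : C^∞⟮𝓘(ℝ, EM), M; 𝓘(ℝ, ℝ), ℝ⟯, tsupport χ ⊆ s ∧ (∀ x, ρ x ≠ 0 → χ x = 1) ∧ ρ x₀ ≠ 0 := by
  obtain ⟨f, hf, -⟩ := (SmoothBumpFunction.nhds_basis_support (I := 𝓘(ℝ, EM)) hs).mem_iff.1 hs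
  have h1 : {x | f x = 1} ∈ nhds x₀ := f.eventuallyEq_one
  obtain ⟨g, hg, -⟩ := (SmoothBumpFunction.nhds_basis_support (I := 𝓘(ℝ, EM)) h1).mem_iff.1 h1
  refine ⟨⟨f, f.contMDiff⟩, ⟨g, g.contMDiff⟩, hf, fun x hx => hg (subset_tsupport _ hx), ?_⟩
  change g x₀ ≠ 0
  rw [g.eq_one]
  exact one_ne_zero

/-- The fibre derivative of a fibre-wise linear function. -/
theorem dirDer_linear (hχ : tsupport χ ⊆ coordBase EM F E x₀) {f : TotFun 𝓘(ℝ, EM) F E}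
    (hf : f ∈ (dilation 𝓘(ℝ, EM) F E G V).homFn 1) {x : M} (h1 : χ x = 1) (w : F) :
    dirDer hχ (0, w) f ⟨x, 0⟩ = f ⟨x, (trivializationAt F E x₀).symm x w⟩ := by
  have hx : x ∈ coordBase EM F E x₀ := hχ (subset_tsupport _ (by simp [h1]))
  set p : TotalSpace F E := ⟨x, (trivializationAt F E x₀).symm x w⟩ with hpd
  have hz : coords EM F E x₀ p ∈ coordRange F E x₀ := coords_mem (p := p) hx
  have h0 : coords EM F E x₀ ⟨x, 0⟩ = ((coords EM F E x₀ p).1, (0 : ℝ) • (coords EM F E x₀ p).2) := by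
    rw [← coords_scale 0 (p := p) hx, scale, zero_smul]
  have hw : (coords EM F E x₀ p).2 = w := congrArg Prod.snd (Trivialization.apply_mk_symm _ hx.2 w)
  -- The curve `t ↦ t p` leaves the zero section in direction `w`, and `f` is linear along it.
  have hcurve : HasDerivAt (fun t : ℝ => ((coords EM F E x₀ p).1, t • (coords EM F E x₀ p).2))
      (0, w) 0 := by
    refine (hasDerivAt_const _ _).prodMk ?_
    simpa [hw] using (hasDerivAt_id (0 : ℝ)).smul_const (coords EM F E x₀ p).2
  have hd : HasFDerivAt (rep (x₀ := x₀) f) (fderiv ℝ (rep (x₀ := x₀) f) (coords EM F E x₀ ⟨x, 0⟩))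
      ((coords EM F E x₀ p).1, (0 : ℝ) • (coords EM F E x₀ p).2) := by
    rw [← h0]
    exact (differentiableAt_rep f (coords_mem (p := ⟨x, 0⟩) hx)).hasFDerivAt
  have h2 := hd.comp_hasDerivAt 0 hcurve
  have h3 : (rep (x₀ := x₀) f) ∘ (fun t : ℝ => ((coords EM F E x₀ p).1, t • (coords EM F E x₀ p).2)) =
      fun t => t * f p := by
    funext t
    have h4 : f (scale F t p) = t ^ 1 * f p := congrArg (fun g : TotFun 𝓘(ℝ, EM) F E => g p) (hf t)
    rw [← pow_one t, ← h4, Function.comp_apply, rep, pow_one, uncoords_smul t hz,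
      uncoords_coords (p := p) hx]
  rw [h3] at h2
  rw [dirDer_apply, h1, one_mul, h2.unique ((hasDerivAt_id (0 : ℝ)).mul_const (f p)), one_mul]

theorem linFn_mem (φ : Cₛ^∞⟮𝓘(ℝ, EM); F →L[ℝ] ℝ, DualBundle E⟯) :
    linFn 𝓘(ℝ, EM) F E φ ∈ (dilation 𝓘(ℝ, EM) F E G V).homFn 1 := fun t =>
  ContMDiffMap.ext fun p => by
    change φ p.1 (t • p.2) = t ^ 1 * φ p.1 p.2
    rw [map_smul, pow_one]
    rfl

/-- The dual bundle is a bundle of homomorphisms into the trivial line bundle, so its trivialization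
is precomposition with the inverse of that of `E`. -/
theorem trivializationAt_dual_apply {x : M} (hx : x ∈ (trivializationAt F E x₀).baseSet)
    (η : DualBundle E x) (w : F) :
    (trivializationAt (F →L[ℝ] ℝ) (DualBundle E) x₀ ⟨x, η⟩).2 w =
      η ((trivializationAt F E x₀).symm x w) := by
  rw [hom_trivializationAt_apply]
  change ContinuousLinearMap.inCoordinates F E ℝ (Bundle.Trivial M ℝ) x₀ x x₀ x η w = _
  rw [ContinuousLinearMap.inCoordinates_eq hx (Set.mem_univ _)]
  simp

/-- The dual basis of the dual of the typical fibre. -/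
def clmBasis [FiniteDimensional ℝ F] {κ : Type*} [Finite κ] [DecidableEq κ] (bF : Module.Basis κ ℝ F) :
    Module.Basis κ ℝ (F →L[ℝ] ℝ) :=
  bF.dualBasis.map LinearMap.toContinuousLinearMap

theorem clmBasis_repr [FiniteDimensional ℝ F] {κ : Type*} [Finite κ] [DecidableEq κ]
    (bF : Module.Basis κ ℝ F) (θ : F →L[ℝ] ℝ) (c : κ) : (clmBasis bF).repr θ c = θ (bF c) := by
  simp [clmBasis, Module.Basis.map_repr]

/-- Restriction to the zero section followed by pull-back to another bundle. -/
def zeroPull {F' : Type*} [NormedAddCommGroup F'] [NormedSpace ℝ F']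
    (E' : M → Type*) [TopologicalSpace (TotalSpace F' E')] [∀ x, TopologicalSpace (E' x)]
    [FiberBundle F' E'] [∀ x, AddCommGroup (E' x)] [∀ x, Module ℝ (E' x)] [VectorBundle ℝ F' E']
    (f : TotFun 𝓘(ℝ, EM) F E) : TotFun 𝓘(ℝ, EM) F' E' :=
  ⟨fun p => f ⟨p.1, 0⟩, f.contMDiff.comp ((Bundle.contMDiff_zeroSection ℝ E).comp
    (Bundle.contMDiff_proj E'))⟩

variable (F E G V) [FiniteDimensional ℝ EM] [FiniteDimensional ℝ F] [FiniteDimensional ℝ G] [T2Space M]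

/-- The duality between functions on the total spaces of a vector bundle and of its dual. -/
def bundleDual : DualData (totRealization (EM := EM) F E G V)
    (totRealization (EM := EM) (F →L[ℝ] ℝ) (DualBundle E) G V)
    Cₛ^∞⟮𝓘(ℝ, EM); F →L[ℝ] ℝ, DualBundle E⟯ Cₛ^∞⟮𝓘(ℝ, EM); G, V⟯ where
  val φ := φ
  lin := linFn 𝓘(ℝ, EM) F E
  lin_mem := linFn_mem
  -- The covector is extended constantly in a trivialization and cut off.
  surj x η := by
    obtain ⟨χ, ρ, hχ, hρ, hx⟩ := exists_cutoff (EM := EM) (x₀ := x)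
      ((trivializationAt (F →L[ℝ] ℝ) (DualBundle E) x).open_baseSet.mem_nhds
        (FiberBundle.mem_baseSet_trivializationAt' x))
    refine ⟨cutSec hχ (trivializationAt (F →L[ℝ] ℝ) (DualBundle E) x ⟨x, η⟩).2, ?_⟩
    rw [cutSec_apply, hρ x hx, one_smul,
      symm_trivializationAt (FiberBundle.mem_baseSet_trivializationAt' x)]
  toDual a := ⟨zeroPull (DualBundle E) a, fun _ _ => rfl⟩
  ofDual a := ⟨zeroPull E a, fun _ _ => rfl⟩
  pull := pullSec 𝓘(ℝ, EM) F E G V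
  pull' := pullSec 𝓘(ℝ, EM) (F →L[ℝ] ℝ) (DualBundle E) G V
  evS_pull _ _ _ _ := rfl

/-- Both frames use the same chart, cut-off functions and frame of `V`, with dual bases of the
typical fibres. That they are paired amounts to computing the fibre derivative of `ℓ_φ` on the zero
section as a component of `φ`, by `dirDer_linear`. -/
theorem bundleDual_hasFrames : (bundleDual (EM := EM) F E G V).HasFrames
    (Fin (Module.finrank ℝ EM)) (Fin (Module.finrank ℝ F)) (Fin (Module.finrank ℝ G)) := by
  intro x₀
  obtain ⟨χ, ρ, hχ, hρ, hx₀⟩ := exists_cutoff (EM := EM) (x₀ := x₀)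
    (s := coordBase EM F E x₀ ∩ coordBase EM (F →L[ℝ] ℝ) (DualBundle E) x₀ ∩
      (trivializationAt G V x₀).baseSet)
    (((isOpen_coordBase.inter isOpen_coordBase).inter (trivializationAt G V x₀).open_baseSet).mem_nhds
      ⟨⟨mem_coordBase, mem_coordBase⟩, FiberBundle.mem_baseSet_trivializationAt' x₀⟩)
  have hχE : tsupport χ ⊆ coordBase EM F E x₀ := fun x hx => (hχ hx).1.1
  have hχE' : tsupport χ ⊆ coordBase EM (F →L[ℝ] ℝ) (DualBundle E) x₀ := fun x hx => (hχ hx).1.2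
  have hχV : tsupport χ ⊆ (trivializationAt G V x₀).baseSet := fun x hx => (hχ hx).2
  let bM := Module.finBasis ℝ EM
  let bF := Module.finBasis ℝ F
  let bG := Module.finBasis ℝ G
  refine ⟨{x | ρ x ≠ 0}, ρ.contMDiff.continuous.continuousAt.eventually_ne hx₀, ⟨{
    fr := coordFrame hχE hχV hρ bM bF bG
    fr' := coordFrame hχE' hχV hρ bM (clmBasis bF) bG
    crd_eq := fun _ _ _ _ => rfl
    sec₀ := fun α => cutSec hχV (bG α)
    sec_eq := fun _ => rfl
    sec_eq' := fun _ => rfl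
    dlin_eq := fun c φ x hx => ?_ }⟩⟩
  have h1 := hρ x hx
  have hx' : x ∈ coordBase EM F E x₀ := hχE (subset_tsupport _ (by simp [h1]))
  refine (dirDer_linear hχE (linFn_mem (G := G) (V := V) φ) h1 (bF c)).trans ?_
  change φ x ((trivializationAt F E x₀).symm x (bF c)) = χ x * (clmBasis bF).repr
    (trivializationAt (F →L[ℝ] ℝ) (DualBundle E) x₀ ⟨x, φ x⟩).2 c
  rw [h1, one_mul, clmBasis_repr, trivializationAt_dual_apply hx'.2]

end DualBundles
end
end FWL

/-! ### The duality theorem for vector bundles -/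

theorem mainTheorem5
    {EM : Type*} [NormedAddCommGroup EM] [NormedSpace ℝ EM] [FiniteDimensional ℝ EM]
    {M : Type*} [TopologicalSpace M] [ChartedSpace EM M] [IsManifold 𝓘(ℝ, EM) ∞ M]
    [T2Space M] [SecondCountableTopology M]
    {F : Type*} [NormedAddCommGroup F] [NormedSpace ℝ F] [FiniteDimensional ℝ F]
    (E : M → Type*) [TopologicalSpace (TotalSpace F E)] [∀ x, TopologicalSpace (E x)]
    [FiberBundle F E] [∀ x, AddCommGroup (E x)] [∀ x, Module ℝ (E x)] [VectorBundle ℝ F E]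
    [ContMDiffVectorBundle ∞ F E 𝓘(ℝ, EM)]
    {G : Type*} [NormedAddCommGroup G] [NormedSpace ℝ G] [FiniteDimensional ℝ G]
    (V : M → Type*) [TopologicalSpace (TotalSpace G V)] [∀ x, TopologicalSpace (V x)]
    [FiberBundle G V] [∀ x, AddCommGroup (V x)] [∀ x, Module ℝ (V x)] [VectorBundle ℝ G V]
    [ContMDiffVectorBundle ∞ G V 𝓘(ℝ, EM)] :
    -- core multivectors and fibre-wise polynomial functions are commutative algebras over which
    -- fibre-wise linear multivectors and polynomial derivations are Lie-Rinehart algebras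
    (∃ _ : LieRinehartRing (dilation 𝓘(ℝ, EM) F E G V).core (dilation 𝓘(ℝ, EM) F E G V).lin,
      LieRinehartAlgebra ℝ (dilation 𝓘(ℝ, EM) F E G V).core (dilation 𝓘(ℝ, EM) F E G V).lin) ∧
    (∃ _ : LieRinehartRing (dilation 𝓘(ℝ, EM) (F →L[ℝ] ℝ) (DualBundle E) G V).polyFn
        (dilation 𝓘(ℝ, EM) (F →L[ℝ] ℝ) (DualBundle E) G V).polyDer,
      LieRinehartAlgebra ℝ (dilation 𝓘(ℝ, EM) (F →L[ℝ] ℝ) (DualBundle E) G V).polyFn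
        (dilation 𝓘(ℝ, EM) (F →L[ℝ] ℝ) (DualBundle E) G V).polyDer) ∧
    ∃ (j : (dilation 𝓘(ℝ, EM) F E G V).core ≃ₐ[ℝ]
        (dilation 𝓘(ℝ, EM) (F →L[ℝ] ℝ) (DualBundle E) G V).polyFn)
      (Ψ : LieRinehartAlgebra.Hom j.toAlgHom (dilation 𝓘(ℝ, EM) F E G V).lin
        (dilation 𝓘(ℝ, EM) (F →L[ℝ] ℝ) (DualBundle E) G V).polyDer),
      -- the identification of core multivectors with polynomial functions
      (∀ C, IsCoreFn 𝓘(ℝ, EM) F E G V C (j C)) ∧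
      (∀ (k : ℕ) (C), C.1 ∈ SymMult.degree k ↔
        (j C).1 ∈ (dilation 𝓘(ℝ, EM) (F →L[ℝ] ℝ) (DualBundle E) G V).homFn k) ∧
      -- `Ψ D` is the unique derivation dual to `D`
      (∀ D D', IsDual 𝓘(ℝ, EM) F E G V j D D' ↔ D' = (Ψ D).1) ∧
      -- `Ψ` is an isomorphism compatible with the degrees
      Function.Bijective Ψ ∧
      (∀ (k : ℕ) (D), D.1 ∈ SymMult.degree k ↔
        (Ψ D).1 ∈ (dilation 𝓘(ℝ, EM) (F →L[ℝ] ℝ) (DualBundle E) G V).homDer ((k : ℤ) - 1)) := by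
  have hd := bundleDual_hasFrames (EM := EM) F E G V
  exact ⟨⟨DualData.lieRinehartRing_lin hd, DualData.lieRinehartAlgebra_lin hd⟩,
    ⟨Dilation.lieRinehartRing_polyDer _, Dilation.lieRinehartAlgebra_polyDer _⟩,
    DualData.exists_duality hd⟩
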